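/- Let $Q=(0,1)\times(0,1)\subset\mathbb C$ be the open unit square and $\Lambda=\mathbb Z+i\mathbb Z$. Let $\varpi\subset Q$ be a domain (nonempty, open, connected) such that $\partial Q\subset\partial\varpi$ and $Q\setminus\mathrm{cl}(\varpi)$ contains a nonempty open set. Let $\Omega$ be the interior of $\bigcup_{m\in\Lambda}\mathrm{cl}(\varpi+m)$, and assume that $\Omega\setminus\bigcup_{m\in\Lambda}(\varpi+m)$ has area zero. Assume that $\Omega$ satisfies condition $(\mathcal A)$: there exist an elliptic function $\varphi$ with $\varphi(z)=\varphi(z+1)=\varphi(z+i)$, not identically zero, all of whose zeros lie in $\mathbb C\setminus\mathrm{cl}(\Omega)$, and a meromorphic function $\phi$ on $\mathbb C$ with only finitely many poles, all of them in $Q$, such that $\sup_{z\in\Omega\setminus\mathrm{cl}(Q)}(1+|z|)^b|\phi(z)|<\infty$ for some $b>2$, and $\varphi(z)=\sum_{m\in\Lambda}\phi(z-m)$ for all $z\in\Omega$ at which none of the terms has a pole. For open $D\subset\mathbb C$ let $A^2(D)$ be the closed subspace of holomorphic functions in $L^2(D)$ (with respect to area measure). For $\eta=(\eta_1,\eta_2)\in\mathbf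 Q=[-\pi,\pi]^2$ let $A^2_{\eta,\mathrm{ext}}(\varpi)$ be the space of those $f\in A^2(\varpi)$ that extend holomorphically to a neighbourhood of $\mathrm{cl}(\varpi)\cap\Omega$ in $\Omega$ and satisfy $$f(1+iy)=e^{i\eta_1}f(iy),\qquad f(x+i)=e^{i\eta_2}f(x)$$ for all $x,y\in(0,1)$ such that the boundary points in question belong to $\Omega$. Let $A^2_\eta(\varpi)$ be the closure of $A^2_{\eta,\mathrm{ext}}(\varpi)$ in $A^2(\varpi)$, and let $P_\Omega$ and $P_\eta$ be the orthogonal projections of $L^2(\Omega)$ onto $A^2(\Omega)$ and of $L^2(\varpi)$ onto $A^2_\eta(\varpi)$. Let $a\in L^\infty(\Omega)$ satisfy $a(z)=a(z+1)=a(z+i)$ for almost all $z\in\Omega$. Let $T_a:A^2(\Omega)\to A^2(\Omega)$, $T_af=P_\Omega(af)$, and for $\eta\in\mathbf Q$ let $T_{a,\eta}:A^2_\eta(\varpi)\to A^2_\eta(\varpi)$, $T_{a,\eta}f=P_\eta(a|_\varpi f)$. Write $\sigma$ for the spectrum of a bounded operator on a Hilbert space, and $\sigma_{\mathrm{ess}}(T)$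 for the set of $\lambda\in\mathbb C$ such that $T-\lambda I$ is not a Fredholm operator. Then $$\sigma_{\mathrm{ess}}(T_a)=\bigcup_{\eta\in\mathbf Q}\sigma(T_{a,\eta}),\qquad\text{and moreover}\qquad \sigma(T_a)=\sigma_{\mathrm{ess}}(T_a).$$ -/

import Mathlib

open MeasureTheory Filter Topology Set
open scoped ENNReal

noncomputable section

/-! ### Bergman spaces -/

/-- The Bergman space `A²(D)`: the subspace of `L²(D)` (area measure) of the classes that have a
representative which is holomorphic on `D`. -/
def bergmanSpace (D : Set ℂ) : Submodule ℂ (Lp ℂ 2 (volume.restrict D)) where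
  carrier := {f | ∃ F : ℂ → ℂ, DifferentiableOn ℂ F D ∧ f =ᵐ[volume.restrict D] F}
  zero_mem' := ⟨0, differentiableOn_const 0, Lp.coeFn_zero _ _ _⟩
  add_mem' := by
    rintro f g ⟨F, hF, hfF⟩ ⟨G, hG, hgG⟩
    exact ⟨F + G, hF.add hG, (Lp.coeFn_add f g).trans (hfF.add hgG)⟩
  smul_mem' := by
    rintro c f ⟨F, hF, hfF⟩
    exact ⟨c • F, hF.const_smul c, (Lp.coeFn_smul c f).trans (hfF.const_smul c)⟩

/-- The mean value inequality on a circle. -/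
theorem enorm_le_lintegral_circle {F : ℂ → ℂ} {w : ℂ} {r : ℝ}
    (hF : DiffContOnCl ℂ F (Metric.ball w r)) (hr : 0 < r) :
    ENNReal.ofReal (2 * Real.pi) * ‖F w‖ₑ ≤
      ∫⁻ θ in Ioo (-Real.pi) Real.pi, ‖F (circleMap w r θ)‖ₑ := by
  have h1 : Real.circleAverage F w r = F w := by
    apply DiffContOnCl.circleAverage
    rwa [abs_of_pos hr]
  rw [Real.circleAverage_eq_integral_add (-Real.pi)] at h1
  have h2 : ∫ θ in (0 : ℝ)..2 * Real.pi, F (circleMap w r (θ + -Real.pi)) =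
      ∫ θ in Ioc (-Real.pi) Real.pi, F (circleMap w r θ) := by
    rw [intervalIntegral.integral_comp_add_right (fun θ => F (circleMap w r θ)),
      intervalIntegral.integral_of_le (by linarith [Real.pi_pos])]
    congr 2
    · congr 1 <;> ring
  rw [h2] at h1
  have h3 : ((2 * Real.pi : ℝ)) • F w = ∫ θ in Ioc (-Real.pi) Real.pi, F (circleMap w r θ) := by
    rw [← h1, smul_smul, mul_inv_cancel₀ (by positivity), one_smul]
  calc ENNReal.ofReal (2 * Real.pi) * ‖F w‖ₑ = ‖(2 * Real.pi : ℝ) • F w‖ₑ := by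
        rw [enorm_smul, Real.enorm_eq_ofReal (by positivity)]
    _ = ‖∫ θ in Ioc (-Real.pi) Real.pi, F (circleMap w r θ)‖ₑ := by rw [h3]
    _ ≤ ∫⁻ θ in Ioc (-Real.pi) Real.pi, ‖F (circleMap w r θ)‖ₑ :=
        enorm_integral_le_lintegral_enorm _
    _ = _ := setLIntegral_congr Ioo_ae_eq_Ioc.symm

/-- The mean value inequality on a disc. -/
theorem enorm_le_lintegral_ball {F : ℂ → ℂ} {w : ℂ} {r : ℝ}
    (hF : DifferentiableOn ℂ F (Metric.closedBall w r)) :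
    (∫⁻ ρ in Ioo 0 r, ENNReal.ofReal ρ * ENNReal.ofReal (2 * Real.pi)) * ‖F w‖ₑ ≤
      ∫⁻ z in Metric.ball w r, ‖F z‖ₑ := by
  have hcont : ContinuousOn F (Metric.ball w r) :=
    hF.continuousOn.mono Metric.ball_subset_closedBall
  set g : ℂ → ℝ≥0∞ := (Metric.ball w r).indicator (fun z => ‖F z‖ₑ) with hg
  have hgm : Measurable g := by
    have hm : Measurable ((Metric.ball w r).indicator F) := by
      classical
      rw [← piecewise_eq_indicator]
      exact hcont.measurable_piecewise continuousOn_const Metric.isOpen_ball.measurableSet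
    have : g = fun z => ‖(Metric.ball w r).indicator F z‖ₑ := by
      funext z
      by_cases hz : z ∈ Metric.ball w r <;> simp [g, hz]
    rw [this]
    exact hm.enorm
  rw [← lintegral_indicator Metric.isOpen_ball.measurableSet, ← hg,
    ← lintegral_add_left_eq_self g w, ← Complex.lintegral_comp_polarCoord_symm,
    polarCoord_target, Measure.volume_eq_prod, ← Measure.prod_restrict]
  have hcirc : ∀ p : ℝ × ℝ, w + Complex.polarCoord.symm p = circleMap w p.1 p.2 := by
    intro p
    simp [Complex.polarCoord_symm_apply, circleMap, Complex.exp_mul_I]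
  simp_rw [hcirc, smul_eq_mul]
  rw [lintegral_prod]
  · rw [← lintegral_mul_const' _ _ enorm_ne_top]
    calc ∫⁻ ρ in Ioo 0 r, ENNReal.ofReal ρ * ENNReal.ofReal (2 * Real.pi) * ‖F w‖ₑ
        ≤ ∫⁻ ρ in Ioo 0 r, ∫⁻ θ in Ioo (-Real.pi) Real.pi,
            ENNReal.ofReal ρ * g (circleMap w ρ θ) := by
          apply setLIntegral_mono' measurableSet_Ioo
          intro ρ hρ
          rw [lintegral_const_mul' _ _ ENNReal.ofReal_ne_top, mul_assoc]
          gcongr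
          refine (enorm_le_lintegral_circle (hF.diffContOnCl_ball
            (Metric.closedBall_subset_closedBall hρ.2.le)) hρ.1).trans_eq ?_
          apply lintegral_congr
          intro θ
          have : circleMap w ρ θ ∈ Metric.ball w r := by
            simp [circleMap, abs_of_pos hρ.1, hρ.2]
          simp [g, this]
      _ ≤ _ := lintegral_mono_set Ioo_subset_Ioi_self
  · refine AEMeasurable.mul (by fun_prop) ?_
    refine (hgm.comp ?_).aemeasurable
    have : Continuous fun p : ℝ × ℝ => circleMap w p.1 p.2 := by
      unfold circleMap; fun_prop
    exact this.measurable

/-- Point evaluations are locally uniformly bounded on Bergman spaces. -/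
theorem exists_norm_le_of_bergman {D : Set ℂ} {z : ℂ} {r : ℝ} (hr : 0 < r)
    (hz : Metric.closedBall z (2 * r) ⊆ D) :
    ∃ C : ℝ, 0 < C ∧ ∀ (f : Lp ℂ 2 (volume.restrict D)) (F : ℂ → ℂ), DifferentiableOn ℂ F D →
      f =ᵐ[volume.restrict D] F → ∀ w ∈ Metric.ball z r, C * ‖F w‖ ≤ ‖f‖ := by
  set c : ℝ≥0∞ := ∫⁻ ρ in Ioo 0 r, ENNReal.ofReal ρ * ENNReal.ofReal (2 * Real.pi) with hc
  have hcpos : 0 < c := by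
    rw [hc, setLIntegral_pos_iff (by fun_prop)]
    have : Function.support (fun ρ : ℝ => ENNReal.ofReal ρ * ENNReal.ofReal (2 * Real.pi)) ∩
        Ioo 0 r = Ioo 0 r := by
      apply inter_eq_right.2
      intro ρ hρ
      simp [hρ.1, Real.pi_pos]
    rw [this]
    simpa using hr
  have hctop : c ≠ ∞ := by
    refine ne_of_lt (lt_of_le_of_lt (setLIntegral_mono' (g := fun _ => ENNReal.ofReal r *
      ENNReal.ofReal (2 * Real.pi)) measurableSet_Ioo ?_) ?_)
    · intro ρ hρ
      gcongr
      exact hρ.2.le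
    · rw [setLIntegral_const]
      exact ENNReal.mul_lt_top (ENNReal.mul_lt_top ENNReal.ofReal_lt_top ENNReal.ofReal_lt_top)
        (by simp)
  refine ⟨Real.sqrt c.toReal, Real.sqrt_pos.2 (ENNReal.toReal_pos hcpos.ne' hctop), ?_⟩
  intro f F hF hfF w hw
  have hball : Metric.closedBall w r ⊆ D := by
    refine subset_trans ?_ hz
    apply Metric.closedBall_subset_closedBall'
    have := Metric.mem_ball.1 hw
    linarith
  have h1 := enorm_le_lintegral_ball (F := fun x => F x ^ 2) ((hF.mono hball).pow 2)
  have h2 : ∫⁻ x in Metric.ball w r, ‖F x ^ 2‖ₑ ≤ ‖f‖ₑ ^ 2 := by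
    calc ∫⁻ x in Metric.ball w r, ‖F x ^ 2‖ₑ ≤ ∫⁻ x in D, ‖F x ^ 2‖ₑ :=
          lintegral_mono_set (Metric.ball_subset_closedBall.trans hball)
      _ = ∫⁻ x in D, ‖f x‖ₑ ^ 2 := by
          apply lintegral_congr_ae
          filter_upwards [hfF] with x hx
          rw [hx, enorm_pow]
      _ = ‖f‖ₑ ^ 2 := by
          rw [Lp.enorm_def, eLpNorm_eq_lintegral_rpow_enorm_toReal (by simp) (by simp)]
          simp only [ENNReal.toReal_ofNat, one_div, ENNReal.rpow_ofNat]
          rw [← ENNReal.rpow_natCast, ← ENNReal.rpow_mul]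
          simp
  have h3 : c * ‖F w‖ₑ ^ 2 ≤ ‖f‖ₑ ^ 2 := by
    have := h1.trans h2
    rwa [enorm_pow] at this
  have h4 := ENNReal.toReal_mono (by simp) h3
  simp only [ENNReal.toReal_mul, ENNReal.toReal_pow, toReal_enorm] at h4
  rw [← Real.sqrt_sq (norm_nonneg f)]
  apply Real.le_sqrt_of_sq_le
  rw [mul_pow, Real.sq_sqrt ENNReal.toReal_nonneg]
  exact h4

/-- `A²(D)` is closed in `L²(D)`. -/
theorem isClosed_bergmanSpace {D : Set ℂ} (hD : IsOpen D) :
    IsClosed (bergmanSpace D : Set (Lp ℂ 2 (volume.restrict D))) := by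
  apply IsSeqClosed.isClosed
  intro f f₀ hf hlim
  choose F hF hfF using hf
  have hcau : CauchySeq f := hlim.cauchySeq
  have key : ∀ z ∈ D, ∃ r > 0, UniformCauchySeqOn F atTop (Metric.ball z r) := by
    intro z hz
    obtain ⟨R, hR, hRD⟩ := Metric.isOpen_iff.1 hD z hz
    have hsub : Metric.closedBall z (2 * (R / 4)) ⊆ D :=
      (Metric.closedBall_subset_ball (by linarith)).trans hRD
    obtain ⟨C, hC, hb⟩ := exists_norm_le_of_bergman (by positivity : 0 < R / 4) hsub
    refine ⟨R / 4, by positivity, ?_⟩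
    rw [Metric.uniformCauchySeqOn_iff]
    intro ε hε
    obtain ⟨N, hN⟩ := Metric.cauchySeq_iff.1 hcau (C * ε) (by positivity)
    refine ⟨N, fun m hm n hn w hw => ?_⟩
    have h1 := hb (f m - f n) (F m - F n) ((hF m).sub (hF n))
      ((Lp.coeFn_sub _ _).trans ((hfF m).sub (hfF n))) w hw
    have h2 := hN m hm n hn
    rw [dist_eq_norm] at h2 ⊢
    exact lt_of_mul_lt_mul_left (h1.trans_lt h2) hC.le
  have hpt : ∀ z, ∃ l, z ∈ D → Tendsto (fun n => F n z) atTop (𝓝 l) := by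
    intro z
    by_cases hz : z ∈ D
    · obtain ⟨r, hr, hu⟩ := key z hz
      obtain ⟨l, hl⟩ := cauchySeq_tendsto_of_complete (hu.cauchySeq (Metric.mem_ball_self hr))
      exact ⟨l, fun _ => hl⟩
    · exact ⟨0, fun h => absurd h hz⟩
  choose G hG using hpt
  have hloc : TendstoLocallyUniformlyOn F G atTop D := by
    intro u hu z hz
    obtain ⟨r, hr, hc⟩ := key z hz
    refine ⟨Metric.ball z r ∩ D, inter_mem (mem_nhdsWithin_of_mem_nhds (Metric.ball_mem_nhds z hr))
      self_mem_nhdsWithin, ?_⟩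
    exact (hc.mono inter_subset_left).tendstoUniformlyOn_of_tendsto
      (fun x hx => hG x hx.2) u hu
  refine ⟨G, hloc.differentiableOn (Eventually.of_forall hF) hD, ?_⟩
  obtain ⟨ns, hns, hae⟩ := (tendstoInMeasure_of_tendsto_Lp hlim).exists_seq_tendsto_ae
  filter_upwards [hae, ae_all_iff.2 hfF, ae_restrict_mem hD.measurableSet] with x h1 h2 h3
  refine tendsto_nhds_unique h1 ?_
  simp_rw [h2]
  exact (hG x h3).comp hns.tendsto_atTop

/-! ### Toeplitz operators and the essential spectrum -/

/-- The operator `M_a : f ↦ a f` of multiplication by an essentially bounded function on `L²`. -/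
def mulOperator {μ : Measure ℂ} (a : ℂ → ℂ) (ha : MemLp a ∞ μ) : Lp ℂ 2 μ →L[ℂ] Lp ℂ 2 μ :=
  (ContinuousLinearMap.mul ℂ ℂ).holderL μ ∞ 2 2 (ha.toLp a)

theorem mulOperator_coeFn {μ : Measure ℂ} (a : ℂ → ℂ) (ha : MemLp a ∞ μ) (f : Lp ℂ 2 μ) :
    mulOperator a ha f =ᵐ[μ] fun z => a z * f z := by
  have h := (ContinuousLinearMap.mul ℂ ℂ).coeFn_holder (r := 2) (ha.toLp a) f
  filter_upwards [h, ha.coeFn_toLp] with z h1 h2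
  simpa [mulOperator, h2] using h1

/-- The Toeplitz-type operator `f ↦ P (a f)` on a subspace `K` of `L²(μ)`, where `P` is the
orthogonal projection of `L²(μ)` onto `K`. -/
def toeplitz {μ : Measure ℂ} (K : Submodule ℂ (Lp ℂ 2 μ)) [K.HasOrthogonalProjection]
    (a : ℂ → ℂ) (ha : MemLp a ∞ μ) : K →L[ℂ] K :=
  K.orthogonalProjectionOnto ∘L mulOperator a ha ∘L K.subtypeL

/-- The essential spectrum: the set of those `c` for which `T - c I` is not a Fredholm operator. -/
def essentialSpectrum {H : Type*} [NormedAddCommGroup H] [InnerProductSpace ℂ H]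
    (T : H →L[ℂ] H) : Set ℂ :=
  {c | ¬ (T - c • ContinuousLinearMap.id ℂ H).IsFredholm}

/-! ### Doubly periodic domains -/

/-- The open unit square `(0,1) × (0,1)`. -/
def unitSquare : Set ℂ := {z | z.re ∈ Ioo (0 : ℝ) 1 ∧ z.im ∈ Ioo (0 : ℝ) 1}

/-- The Gaussian integer `m₁ + i m₂`; these are the points of the lattice of periods. -/
def latticePoint (m : ℤ × ℤ) : ℂ := (m.1 : ℂ) + (m.2 : ℂ) * Complex.I

/-- The translate `ϖ + m`. -/
def cellTranslate (ϖ : Set ℂ) (m : ℤ × ℤ) : Set ℂ := (fun z => z + latticePoint m) '' ϖ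

/-- A periodic cell: a domain contained in the open unit square whose boundary contains the
boundary of the square, and such that the square minus the closure of the cell contains a
(nonempty) open set. -/
structure IsPeriodicCell (ϖ : Set ℂ) : Prop where
  isOpen : IsOpen ϖ
  isConnected : IsConnected ϖ
  subset_unitSquare : ϖ ⊆ unitSquare
  frontier_subset : frontier unitSquare ⊆ frontier ϖ
  exists_hole : ∃ V : Set ℂ, IsOpen V ∧ V.Nonempty ∧ V ⊆ unitSquare \ closure ϖ

/-- The doubly periodic domain with periodic cell `ϖ`: the interior of the union of the closures
of all lattice translates of `ϖ`. -/
def periodicDomain (ϖ : Set ℂ) : Set ℂ := interior (⋃ m : ℤ × ℤ, closure (cellTranslate ϖ m))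

theorem isOpen_periodicDomain (ϖ : Set ℂ) : IsOpen (periodicDomain ϖ) := isOpen_interior

theorem IsPeriodicCell.subset_periodicDomain {ϖ : Set ℂ} (h : IsPeriodicCell ϖ) :
    ϖ ⊆ periodicDomain ϖ := by
  refine interior_maximal ?_ h.isOpen
  intro z hz
  exact mem_iUnion.2 ⟨(0, 0), subset_closure ⟨z, hz, by simp [latticePoint]⟩⟩

instance bergmanSpace_hasOrthogonalProjection (ϖ : Set ℂ) :
    (bergmanSpace (periodicDomain ϖ)).HasOrthogonalProjection :=
  haveI : CompleteSpace (bergmanSpace (periodicDomain ϖ)) :=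
    (isClosed_bergmanSpace (isOpen_periodicDomain ϖ)).completeSpace_coe
  inferInstance

/-- Condition `(𝒜)` on a doubly periodic domain `Ω`: there are an elliptic function `φ` with
periods `1` and `i`, all of whose zeros lie outside the closure of `Ω`, and a meromorphic
function `χ` on the plane with finitely many poles, all of them in the open unit square, with
`|χ(z)| ≤ d (1 + |z|)^(-b)` on `Ω` minus the closed square for some `b > 2`, such that
`φ(z) = ∑ χ(z - m)` (sum over the lattice) at all points `z` of `Ω` at which no term has a pole.
Meromorphic functions are represented by their normal forms (value `0` at the poles, continuous
elsewhere), and zeros and poles are read off from the order (which is `⊤` for the zero function). -/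
def ConditionA (Ω : Set ℂ) : Prop :=
  ∃ φ χ : ℂ → ℂ,
    MeromorphicNFOn φ univ ∧
    (∀ z, φ (z + 1) = φ z) ∧ (∀ z, φ (z + Complex.I) = φ z) ∧
    (∀ z, 0 < meromorphicOrderAt φ z → z ∉ closure Ω) ∧
    MeromorphicNFOn χ univ ∧
    {z | meromorphicOrderAt χ z < 0}.Finite ∧
    {z | meromorphicOrderAt χ z < 0} ⊆ unitSquare ∧
    (∃ b d : ℝ, 2 < b ∧ ∀ z ∈ Ω \ closure unitSquare, (1 + ‖z‖) ^ b * ‖χ z‖ ≤ d) ∧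
    ∀ z ∈ Ω, (∀ m : ℤ × ℤ, 0 ≤ meromorphicOrderAt χ (z - latticePoint m)) →
      HasSum (fun m : ℤ × ℤ => χ (z - latticePoint m)) (φ z)

/-! ### Quasiperiodic Bergman spaces on the cell -/

/-- The quasiperiodic boundary conditions `F(1+iy) = exp(iη₁) F(iy)`, `F(x+i) = exp(iη₂) F(x)` for
`x, y ∈ (0,1)`, at those boundary points that belong to `Ω` (where `F` is given). -/
def IsQuasiperiodic (Ω : Set ℂ) (η : ℝ × ℝ) (F : ℂ → ℂ) : Prop :=
  (∀ y ∈ Ioo (0 : ℝ) 1, (y : ℂ) * Complex.I ∈ Ω →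
    F (1 + y * Complex.I) = Complex.exp (Complex.I * η.1) * F (y * Complex.I)) ∧
  (∀ x ∈ Ioo (0 : ℝ) 1, (x : ℂ) ∈ Ω →
    F (x + Complex.I) = Complex.exp (Complex.I * η.2) * F x)

/-- The space `A²_{η,ext}(ϖ)`: the elements of `L²(ϖ)` that are restrictions to `ϖ` of functions
which are holomorphic in some neighbourhood of `cl(ϖ) ∩ Ω` in `Ω` and satisfy the quasiperiodic
boundary conditions with parameter `η`. Here `Ω` is the periodic domain with cell `ϖ`. -/
def cellSpaceExt (ϖ : Set ℂ) (η : ℝ × ℝ) : Submodule ℂ (Lp ℂ 2 (volume.restrict ϖ)) where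
  carrier := {f | ∃ (U : Set ℂ) (F : ℂ → ℂ), IsOpen U ∧ closure ϖ ∩ periodicDomain ϖ ⊆ U ∧
    U ⊆ periodicDomain ϖ ∧ DifferentiableOn ℂ F U ∧ IsQuasiperiodic (periodicDomain ϖ) η F ∧
    f =ᵐ[volume.restrict ϖ] F}
  zero_mem' := ⟨periodicDomain ϖ, 0, isOpen_periodicDomain ϖ, inter_subset_right, subset_rfl,
    differentiableOn_const 0, by simp [IsQuasiperiodic], Lp.coeFn_zero _ _ _⟩
  add_mem' := by
    rintro f g ⟨U, F, hU, hsU, hUs, hF, hqF, hfF⟩ ⟨V, G, hV, hsV, hVs, hG, hqG, hgG⟩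
    refine ⟨U ∩ V, F + G, hU.inter hV, subset_inter hsU hsV, inter_subset_left.trans hUs,
      (hF.mono inter_subset_left).add (hG.mono inter_subset_right), ⟨?_, ?_⟩,
      (Lp.coeFn_add f g).trans (hfF.add hgG)⟩
    · intro y hy hy'
      simp only [Pi.add_apply, hqF.1 y hy hy', hqG.1 y hy hy', mul_add]
    · intro x hx hx'
      simp only [Pi.add_apply, hqF.2 x hx hx', hqG.2 x hx hx', mul_add]
  smul_mem' := by
    rintro c f ⟨U, F, hU, hsU, hUs, hF, hqF, hfF⟩
    refine ⟨U, c • F, hU, hsU, hUs, hF.const_smul c, ⟨?_, ?_⟩,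
      (Lp.coeFn_smul c f).trans (hfF.const_smul c)⟩
    · intro y hy hy'
      simp only [Pi.smul_apply, smul_eq_mul, hqF.1 y hy hy']
      ring
    · intro x hx hx'
      simp only [Pi.smul_apply, smul_eq_mul, hqF.2 x hx hx']
      ring

/-- `A²_{η,ext}(ϖ)` is a subspace of `A²(ϖ)`. -/
theorem cellSpaceExt_le_bergmanSpace {ϖ : Set ℂ} (h : IsPeriodicCell ϖ) (η : ℝ × ℝ) :
    cellSpaceExt ϖ η ≤ bergmanSpace ϖ := by
  rintro f ⟨U, F, -, hsU, -, hF, -, hfF⟩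
  exact ⟨F, hF.mono ((subset_inter subset_closure h.subset_periodicDomain).trans hsU), hfF⟩

/-- The space `A²_η(ϖ)`: the closure of `A²_{η,ext}(ϖ)` (as `A²(ϖ)` is closed in `L²(ϖ)`, the
closures in these two spaces are the same). -/
def cellSpace (ϖ : Set ℂ) (η : ℝ × ℝ) : Submodule ℂ (Lp ℂ 2 (volume.restrict ϖ)) :=
  (cellSpaceExt ϖ η).topologicalClosure

instance cellSpace_hasOrthogonalProjection (ϖ : Set ℂ) (η : ℝ × ℝ) :
    (cellSpace ϖ η).HasOrthogonalProjection :=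
  haveI : CompleteSpace (cellSpace ϖ η) :=
    (cellSpaceExt ϖ η).isClosed_topologicalClosure.completeSpace_coe
  inferInstance

/-- An essentially bounded function on the periodic domain is essentially bounded on the cell. -/
theorem IsPeriodicCell.memLp_restrict {ϖ : Set ℂ} (h : IsPeriodicCell ϖ) {a : ℂ → ℂ}
    (ha : MemLp a ∞ (volume.restrict (periodicDomain ϖ))) : MemLp a ∞ (volume.restrict ϖ) :=
  ha.mono_measure (Measure.restrict_mono h.subset_periodicDomain le_rfl)

end

/-! Cutting a function g on Ω into the pieces g(· + m) on ϖ identifies L²(Ω) with the square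
summable families in L²(ϖ) indexed by ℤ², because Ω minus the cells has area zero. Multiplication by
a periodic symbol acts on every piece by the same operator M; lattice translations shift the family
and preserve A²(Ω). Floquet theory would write A²(Ω) as a direct integral of the spaces A²_η(ϖ). The
proof uses only a quantitative substitute for this decomposition.

Condition (𝒜) supplies the substitute. The function u = χ/φ has only removable singularities in Ω,
decays like |z|^(-b) with b > 2, and its lattice translates sum to 1
(`ConditionA.exists_partition`). It gives passages in both directions: the η-quasiperiodic extension
of an element of A²_{η,ext}(ϖ), multiplied by u, lies in A²(Ω); and for g in A²(Ω) the sum over m of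
(ug)(z + m) times the conjugate character lies in A²_{η,ext}(ϖ). `IsFiber` is the abstract form of
these two facts, and `IsPeriodicCell.isFiber` verifies them.

An operator is invertible if and only if it and its adjoint are bounded below, and the adjoint of a
Toeplitz operator has the conjugate symbol. So only lower bounds have to be transferred. From A²(Ω)
to a fibre: the lift of v is modulated, translated and summed over a large N × N square of indices.
The result looks like v times the character on that square, and the boundary effects are o(N²)
(`IsFiber.card_mul_le`). From all fibres to A²(Ω): if the lower bound fails, finite Fourier averages
turn approximate kernel vectors into approximate joint eigenvectors of the two generating
translations (`exists_approximate_eigenvalue`). The eigenvalues determine some η, and such vectors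
contradict the lower bound on the fibre at η (`IsFiber.sq_mul_sq_le`). Compactness of the circle
makes uniformity of the lower bounds in η unnecessary.

Finally, T_a - λ and its adjoint commute with the translations, which have no eigenvectors in L²(Ω).
A finite-dimensional kernel or cokernel must therefore vanish, so Fredholm means invertible and the
two spectra agree. -/

/-! ### Weighted sums over a group -/

/-- The Cauchy–Schwarz inequality for a weighted sum. -/
theorem sq_tsum_mul_le {ι : Type*} {κ d : ι → ℝ} (hκ : Summable κ) (hκ0 : ∀ m, 0 ≤ κ m)
    (h1 : Summable fun m => κ m * d m) (h2 : Summable fun m => κ m * d m ^ 2) :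
    (∑' m, κ m * d m) ^ 2 ≤ (∑' m, κ m) * ∑' m, κ m * d m ^ 2 := by
  refine le_of_tendsto_of_tendsto' (Tendsto.pow h1.hasSum 2)
    (Tendsto.mul hκ.hasSum h2.hasSum) fun s => ?_
  refine Finset.sum_sq_le_sum_mul_sum_of_sq_le_mul s (fun i _ => hκ0 i)
    (fun i _ => mul_nonneg (hκ0 i) (sq_nonneg _)) fun i _ => le_of_eq (by ring)

/-- A weighted form of Young's inequality for convolutions. -/
theorem young_tsum {ι : Type*} {κ : ι → ℝ} (hκ : Summable κ) (hκ0 : ∀ m, 0 ≤ κ m)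
    {d : ι → ι → ℝ} (hd0 : ∀ m k, 0 ≤ d m k) {D : ι → ℝ} {B : ℝ}
    (hd : ∀ m, HasSum (fun k => d m k ^ 2) (D m)) (hB : ∀ m, D m ≤ B) :
    (∀ k, Summable fun m => κ m * d m k) ∧ (Summable fun m => κ m * D m) ∧
      (Summable fun k => (∑' m, κ m * d m k) ^ 2) ∧
      ∑' k, (∑' m, κ m * d m k) ^ 2 ≤ (∑' m, κ m) * ∑' m, κ m * D m := by
  have hle : ∀ m k, d m k ^ 2 ≤ D m := fun m k => le_hasSum (hd m) k fun _ _ => sq_nonneg _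
  have hD0 : ∀ m, 0 ≤ D m := fun m => (hd m).nonneg fun _ => sq_nonneg _
  have hs1 : ∀ k, Summable fun m => κ m * d m k := fun k => by
    refine Summable.of_nonneg_of_le (fun m => mul_nonneg (hκ0 m) (hd0 m k)) (fun m => ?_)
      (hκ.mul_right (Real.sqrt B))
    exact mul_le_mul_of_nonneg_left (Real.le_sqrt_of_sq_le ((hle m k).trans (hB m))) (hκ0 m)
  have hsD : Summable fun m => κ m * D m := by
    refine Summable.of_nonneg_of_le (fun m => mul_nonneg (hκ0 m) (hD0 m)) (fun m => ?_)
      (hκ.mul_right B)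
    exact mul_le_mul_of_nonneg_left (hB m) (hκ0 m)
  obtain ⟨F, hF⟩ : ∃ F : ι → ι → ℝ, ∀ m k, F m k = κ m * d m k ^ 2 := ⟨_, fun _ _ => rfl⟩
  have hFsum : ∀ m, HasSum (F m) (κ m * D m) := fun m =>
    ((hd m).mul_left (κ m)).congr_fun (hF m)
  -- The double series of κ m * d m k ^ 2 converges because its row sums κ m * D m do. Hence the
  -- order of summation may be exchanged after Cauchy–Schwarz has been applied for each fixed k.
  have hpair : Summable fun p : ι × ι => F p.1 p.2 := by
    refine (summable_prod_of_nonneg (f := fun p : ι × ι => F p.1 p.2) fun p => ?_).2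
      ⟨fun m => (hFsum m).summable, hsD.congr fun m => ((hFsum m).tsum_eq).symm⟩
    exact (mul_nonneg (hκ0 p.1) (sq_nonneg (d p.1 p.2))).trans_eq (hF _ _).symm
  have hpair' : Summable fun p : ι × ι => F p.2 p.1 := hpair.prod_symm
  have hs2 : ∀ k, Summable fun m => F m k := fun k => hpair'.prod_factor k
  have hs3 : Summable fun k => (∑' m, κ m) * ∑' m, F m k := hpair'.prod.mul_left (∑' m, κ m)
  have hcs : ∀ k, (∑' m, κ m * d m k) ^ 2 ≤ (∑' m, κ m) * ∑' m, F m k := fun k => by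
    have h := hs2 k
    simp only [hF] at h ⊢
    exact sq_tsum_mul_le hκ hκ0 (hs1 k) h
  have hs4 : Summable fun k => (∑' m, κ m * d m k) ^ 2 :=
    Summable.of_nonneg_of_le (fun k => sq_nonneg _) hcs hs3
  refine ⟨hs1, hsD, hs4, (hs4.tsum_le_tsum hcs hs3).trans_eq ?_⟩
  rw [tsum_mul_left, Summable.tsum_comm (f := F) hpair]
  exact congrArg _ (tsum_congr fun m => (hFsum m).tsum_eq)

/-- The Cauchy–Schwarz inequality for series. -/
theorem summable_mul_and_tsum_mul_le {ι : Type*} {f g : ι → ℝ} {F G : ℝ}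
    (hf0 : ∀ i, 0 ≤ f i) (hg0 : ∀ i, 0 ≤ g i) (hF0 : 0 ≤ F) (hG0 : 0 ≤ G)
    (hf : Summable fun i => f i ^ 2) (hg : Summable fun i => g i ^ 2)
    (hF : ∑' i, f i ^ 2 ≤ F ^ 2) (hG : ∑' i, g i ^ 2 ≤ G ^ 2) :
    (Summable fun i => f i * g i) ∧ ∑' i, f i * g i ≤ F * G := by
  have key : ∀ s : Finset ι, ∑ i ∈ s, f i * g i ≤ F * G := fun s => by
    refine abs_le_of_sq_le_sq' ?_ (mul_nonneg hF0 hG0) |>.2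
    refine (Finset.sum_mul_sq_le_sq_mul_sq s f g).trans ?_
    rw [mul_pow]
    exact mul_le_mul ((hf.sum_le_tsum s fun _ _ => sq_nonneg _).trans hF)
      ((hg.sum_le_tsum s fun _ _ => sq_nonneg _).trans hG)
      (Finset.sum_nonneg fun _ _ => sq_nonneg _) (sq_nonneg _)
  have hsum : Summable fun i => f i * g i :=
    summable_of_sum_le (fun i => mul_nonneg (hf0 i) (hg0 i)) key
  exact ⟨hsum, hsum.tsum_le_of_sum_le key⟩

/-! ### Translation-invariant spaces and their fibres -/

section Fibers

variable {ι X H : Type*} [AddCommGroup ι]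
  [NormedAddCommGroup X] [InnerProductSpace ℂ X] [NormedAddCommGroup H] [InnerProductSpace ℂ H]

/-- A representation `R` of a Hilbert space `X` as a space of square summable families in `H`
indexed by a group, together with the translations `S` of these families. -/
structure IsFamilySpace (R : ι → X →ₗ[ℂ] H) (S : ι → X →ₗ[ℂ] X) : Prop where
  hasSum_inner : ∀ g h, HasSum (fun m => inner ℂ (R m g) (R m h)) (inner ℂ g h)
  translate : ∀ m k g, R m (S k g) = R (m + k) g

/-- The space `E` is the fibre at the character `e` of the translation-invariant space `A` of
families. The two are related by a summable partition of unity `U`. -/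
structure IsFiber (R : ι → X →ₗ[ℂ] H) (S : ι → X →ₗ[ℂ] X) (U : ι → H →ₗ[ℂ] H) (κ : ι → ℝ)
    (e : ι → ℂ) (A : Submodule ℂ X) (E : Submodule ℂ H) : Prop extends IsFamilySpace R S where
  summable : Summable κ
  norm_le : ∀ m v, ‖U m v‖ ≤ κ m * ‖v‖
  kappa_nonneg : ∀ m, 0 ≤ κ m
  partition : ∀ v, HasSum (fun m => U m v) v
  norm_char : ∀ m, ‖e m‖ = 1
  char_add : ∀ m k, e (m + k) = e m * e k
  invariant : ∀ k, ∀ g ∈ A, S k g ∈ A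
  lift : ∀ v ∈ E, ∃ g ∈ A, ∀ m, R m g = e m • U m v
  fiber : ∀ g ∈ A, ∑' m, starRingEnd ℂ (e m) • U m (R m g) ∈ E

namespace IsFamilySpace

variable {R : ι → X →ₗ[ℂ] H} {S : ι → X →ₗ[ℂ] X}

theorem hasSum_norm_sq (h : IsFamilySpace R S) (g : X) :
    HasSum (fun m => ‖R m g‖ ^ 2) (‖g‖ ^ 2) := by
  have := h.hasSum_inner g g
  simp only [inner_self_eq_norm_sq_to_K] at this
  exact_mod_cast this

theorem norm_translate (h : IsFamilySpace R S) (k : ι) (g : X) : ‖S k g‖ = ‖g‖ := by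
  have h1 := h.hasSum_norm_sq (S k g)
  simp only [h.translate] at h1
  have h2 := ((Equiv.addRight k).hasSum_iff (f := fun m => ‖R m g‖ ^ 2)).2 (h.hasSum_norm_sq g)
  have h3 : ‖S k g‖ ^ 2 = ‖g‖ ^ 2 := h1.unique h2
  exact (pow_left_inj₀ (norm_nonneg _) (norm_nonneg _) two_ne_zero).1 h3

/-- By Parseval the components determine the element, so identities between operators on X can be
checked component by component. -/
theorem eq_of_forall (h : IsFamilySpace R S) {g g' : X} (hg : ∀ m, R m g = R m g') : g = g' := by
  rw [← sub_eq_zero, ← norm_eq_zero, ← sq_eq_zero_iff]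
  refine (h.hasSum_norm_sq (g - g')).unique ?_
  simp [hg, hasSum_zero]

theorem translate_add (h : IsFamilySpace R S) (k l : ι) (g : X) :
    S (k + l) g = S k (S l g) :=
  h.eq_of_forall fun m => by simp [h.translate, add_assoc]

theorem translate_zero (h : IsFamilySpace R S) (g : X) : S 0 g = g :=
  h.eq_of_forall fun m => by simp [h.translate]

theorem norm_translate_sub_le (h : IsFamilySpace R S) (k : ι) (g : X) {c : ℂ} (hc : ‖c‖ = 1) :
    ‖S k g - c • g‖ ≤ 2 * ‖g‖ := by
  refine (norm_sub_le _ _).trans ?_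
  rw [h.norm_translate, norm_smul, hc]
  linarith

end IsFamilySpace

namespace IsFiber

variable {R : ι → X →ₗ[ℂ] H} {S : ι → X →ₗ[ℂ] X} {U : ι → H →ₗ[ℂ] H} {κ : ι → ℝ}
    {e : ι → ℂ} {A : Submodule ℂ X} {E : Submodule ℂ H}

theorem conj_mul_char (h : IsFiber R S U κ e A E) (m : ι) : starRingEnd ℂ (e m) * e m = 1 := by
  rw [mul_comm, Complex.mul_conj, Complex.normSq_eq_norm_sq, h.norm_char]
  simp

theorem inner_char_smul (h : IsFiber R S U κ e A E) (m : ι) (v w : H) :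
    inner ℂ (e m • v) (e m • w) = inner ℂ v w := by
  rw [inner_smul_left, inner_smul_right, ← mul_assoc, h.conj_mul_char, one_mul]

/-- If the compressed operator is bounded below on the fibre, then it is bounded below on
the families that are nearly eigenvectors of the translations. -/
theorem sq_mul_sq_le [A.HasOrthogonalProjection] [E.HasOrthogonalProjection] [CompleteSpace H]
    (hF : IsFiber R S U κ e A E) (T : X →L[ℂ] X) (M : H →L[ℂ] H)
    (hTM : ∀ m g, R m (T g) = M (R m g)) {c : ℝ} (hc : 0 < c)
    (hE : ∀ v ∈ E, c * ‖v‖ ≤ ‖E.orthogonalProjectionOnto (M v)‖) {g : X} (hg : g ∈ A) :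
    c ^ 2 * ‖g‖ ^ 2 ≤
      2 * (2 * ‖M‖ + c) ^ 2 * ((∑' m, κ m) * ∑' m, κ m * ‖S m g - e m • g‖ ^ 2) +
        2 * ((∑' m, κ m) * ((∑' m, κ m) * ‖A.orthogonalProjectionOnto (T g)‖ ^ 2)) := by
  set h : X := (A.orthogonalProjectionOnto (T g) : X) with hh
  have hhA : h ∈ A := Submodule.coe_mem _
  have hnh : ‖A.orthogonalProjectionOnto (T g)‖ = ‖h‖ := rfl
  set d : ι → ι → ℝ := fun m k => ‖R (m + k) g - e m • R k g‖ with hd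
  have hdsum : ∀ m, HasSum (fun k => d m k ^ 2) (‖S m g - e m • g‖ ^ 2) := fun m => by
    convert! hF.hasSum_norm_sq (S m g - e m • g) using 4 with k
    simp [hF.translate, add_comm]
  -- Two errors occur: d measures how far g is from being an eigenvector of the translations, b the
  -- size of the compressed image h. Both are controlled in ℓ² by Young's inequality.
  set b : ι → ι → ℝ := fun m k => ‖R (m + k) h‖ with hb
  have hbsum : ∀ m, HasSum (fun k => b m k ^ 2) (‖h‖ ^ 2) := fun m => by
    have := hF.hasSum_norm_sq (S m h)
    rw [hF.norm_translate] at this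
    simpa only [hF.translate, add_comm _ m] using this
  obtain ⟨hx1, hx2, hx3, hx4⟩ := young_tsum hF.summable hF.kappa_nonneg (d := d)
    (fun _ _ => norm_nonneg _) hdsum (B := (2 * ‖g‖) ^ 2)
    (fun m => pow_le_pow_left₀ (norm_nonneg _)
      (hF.norm_translate_sub_le m g (hF.norm_char m)) 2)
  obtain ⟨hy1, hy2, hy3, hy4⟩ := young_tsum hF.summable hF.kappa_nonneg (d := b)
    (fun _ _ => norm_nonneg _) hbsum (B := ‖h‖ ^ 2) (fun m => le_rfl)
  rw [tsum_mul_right] at hy4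
  set x : ι → ℝ := fun k => ∑' m, κ m * d m k with hx
  set y : ι → ℝ := fun k => ∑' m, κ m * b m k with hy
  have hx0 : ∀ k, 0 ≤ x k := fun k =>
    tsum_nonneg fun m => mul_nonneg (hF.kappa_nonneg m) (norm_nonneg _)
  have hy0 : ∀ k, 0 ≤ y k := fun k =>
    tsum_nonneg fun m => mul_nonneg (hF.kappa_nonneg m) (norm_nonneg _)
  -- For each k, the component R k g is compared with an element f of the fibre, to which the lower
  -- bound `hE` applies.
  have key : ∀ k, c * ‖R k g‖ ≤ (2 * ‖M‖ + c) * x k + y k := by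
    intro k
    set f : H := ∑' m, starRingEnd ℂ (e m) • U m (R m (S k g)) with hf
    have hfE : f ∈ E := hF.fiber _ (hF.invariant k g hg)
    have hterm : ∀ m, starRingEnd ℂ (e m) • U m (R m (S k g)) - U m (R k g) =
        starRingEnd ℂ (e m) • U m (R (m + k) g - e m • R k g) := fun m => by
      rw [hF.translate, map_sub, smul_sub, map_smul, smul_smul, hF.conj_mul_char, one_smul]
    have hbd : ∀ m, ‖starRingEnd ℂ (e m) • U m (R (m + k) g - e m • R k g)‖ ≤ κ m * d m k :=
      fun m => by
        rw [norm_smul, RCLike.norm_conj, hF.norm_char, one_mul]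
        exact hF.norm_le _ _
    have hs := Summable.of_norm_bounded (hx1 k) hbd
    -- As the U m sum to the identity, R k g is the sum of the U m (R k g), and the difference from
    -- f is a sum of terms of norm at most κ m * d m k.
    have hfg : ‖f - R k g‖ ≤ x k := by
      have h1 : HasSum (fun m => starRingEnd ℂ (e m) • U m (R m (S k g)))
          (∑' m, starRingEnd ℂ (e m) • U m (R (m + k) g - e m • R k g) + R k g) := by
        refine (hs.hasSum.add (hF.partition (R k g))).congr_fun ?_
        intro m
        rw [← hterm, sub_add_cancel]
      rw [hf, h1.tsum_eq, add_sub_cancel_right]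
      exact tsum_of_norm_bounded (hx1 k).hasSum hbd
    -- To see that v is small, ‖v‖² = ⟪v, M (R k g)⟫ is compared with the inner product of T g and
    -- the translated lift of v. Since that lift lies in A, T g can there be replaced by its
    -- projection h.
    set v : H := (E.orthogonalProjectionOnto (M (R k g)) : H) with hv
    have hvE : v ∈ E := Submodule.coe_mem _
    obtain ⟨w, hwA, hw⟩ := hF.lift v hvE
    have h1 : ∀ z : X, HasSum (fun m => inner ℂ (R m w) (R (m + k) z))
        (inner ℂ (S (-k) w) z) := fun z => by
      have := (Equiv.addRight k).hasSum_iff.2 (hF.hasSum_inner (S (-k) w) z)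
      refine this.congr_fun fun m => ?_
      simp [hF.translate]
    have h2 : (inner ℂ (S (-k) w) (T g) : ℂ) = inner ℂ (S (-k) w) h :=
      (Submodule.inner_orthogonalProjectionOnto_eq_of_mem_left
        (⟨S (-k) w, hF.invariant _ w hwA⟩ : A) (T g)).symm
    have h3 : (inner ℂ v (M (R k g)) : ℂ) = ‖v‖ ^ 2 := by
      refine (Submodule.inner_orthogonalProjectionOnto_eq_of_mem_left
        (⟨v, hvE⟩ : E) (M (R k g))).symm.trans ?_
      exact inner_self_eq_norm_sq_to_K (𝕜 := ℂ) v
    have h4 : HasSum (fun m => (inner ℂ (U m v) (M (R k g)) : ℂ)) (‖v‖ ^ 2) := by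
      rw [← h3]
      exact (innerSLFlip ℂ (M (R k g))).hasSum (hF.partition v)
    have h5 := ((h4.sub (h1 (T g))).add (h1 h))
    rw [h2, sub_add_cancel] at h5
    have h6 : HasSum (fun m => (‖M‖ * (κ m * d m k) + κ m * b m k) * ‖v‖)
        ((‖M‖ * x k + y k) * ‖v‖) :=
      (((hx1 k).hasSum.mul_left _).add (hy1 k).hasSum).mul_right _
    have h7 : ‖v‖ ^ 2 ≤ (‖M‖ * x k + y k) * ‖v‖ := by
      have h8 := tsum_of_norm_bounded h6 (f := fun m => (inner ℂ (U m v) (M (R k g)) : ℂ) -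
        inner ℂ (R m w) (R (m + k) (T g)) + inner ℂ (R m w) (R (m + k) h)) fun m => ?_
      · rw [h5.tsum_eq] at h8
        simpa using h8
      · have hRw : ‖R m w‖ ≤ κ m * ‖v‖ := by
          rw [hw, norm_smul, hF.norm_char, one_mul]
          exact hF.norm_le _ _
        have h9 : (inner ℂ (U m v) (M (R k g)) : ℂ) - inner ℂ (R m w) (R (m + k) (T g)) =
            - inner ℂ (R m w) (M (R (m + k) g - e m • R k g)) := by
          rw [hTM, map_sub, inner_sub_right, map_smul, hw, hF.inner_char_smul]
          ring
        rw [h9]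
        refine (norm_add_le _ _).trans ?_
        rw [norm_neg]
        have h10 : ‖(inner ℂ (R m w) (M (R (m + k) g - e m • R k g)) : ℂ)‖ ≤
            κ m * ‖v‖ * (‖M‖ * d m k) :=
          (norm_inner_le_norm _ _).trans (mul_le_mul hRw (M.le_opNorm _) (norm_nonneg _)
            (mul_nonneg (hF.kappa_nonneg m) (norm_nonneg _)))
        have h11 : ‖(inner ℂ (R m w) (R (m + k) h) : ℂ)‖ ≤ κ m * ‖v‖ * b m k :=
          (norm_inner_le_norm _ _).trans (mul_le_mul_of_nonneg_right hRw (norm_nonneg _))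
        calc _ ≤ κ m * ‖v‖ * (‖M‖ * d m k) + κ m * ‖v‖ * b m k := add_le_add h10 h11
          _ = _ := by ring
    have h8 : ‖v‖ ≤ ‖M‖ * x k + y k := by
      by_cases hv0 : ‖v‖ = 0
      · rw [hv0]
        exact add_nonneg (mul_nonneg (norm_nonneg _) (hx0 k)) (hy0 k)
      · rw [sq] at h7
        exact le_of_mul_le_mul_right h7 (lt_of_le_of_ne (norm_nonneg _) (Ne.symm hv0))
    have h9 : c * ‖f‖ ≤ ‖v‖ + ‖M‖ * x k := by
      refine (hE f hfE).trans ?_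
      have : M f = M (R k g) + M (f - R k g) := by rw [← map_add]; simp
      rw [this, map_add]
      refine (norm_add_le _ _).trans (add_le_add le_rfl ?_)
      refine (E.norm_orthogonalProjectionOnto_apply_le _).trans ((M.le_opNorm _).trans ?_)
      exact mul_le_mul_of_nonneg_left hfg (norm_nonneg _)
    have h10 : ‖R k g‖ ≤ ‖f‖ + x k := by
      have := norm_sub_norm_le (R k g) f
      rw [norm_sub_rev] at this
      linarith
    nlinarith
  have hA2 : ∀ k, c ^ 2 * ‖R k g‖ ^ 2 ≤ 2 * (2 * ‖M‖ + c) ^ 2 * x k ^ 2 + 2 * y k ^ 2 := by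
    intro k
    have h1 := pow_le_pow_left₀ (by positivity) (key k) 2
    have h2 := add_sq_le (a := (2 * ‖M‖ + c) * x k) (b := y k)
    rw [mul_pow] at h1 h2
    linarith
  have hfin := ((hF.hasSum_norm_sq g).mul_left (c ^ 2)).tsum_eq.symm.trans_le
    (((hF.hasSum_norm_sq g).summable.mul_left _).tsum_le_tsum hA2
      ((hx3.mul_left _).add (hy3.mul_left _)))
  rw [(hx3.mul_left _).tsum_add (hy3.mul_left _), tsum_mul_left, tsum_mul_left] at hfin
  refine hfin.trans (add_le_add ?_ ?_)
  · exact mul_le_mul_of_nonneg_left hx4 (by positivity)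
  · exact mul_le_mul_of_nonneg_left hy4 (by positivity)

end IsFiber

end Fibers

/-! ### Indicators of finite index sets and lower bounds on a fibre -/

theorem hasSum_indicator_sq {ι : Type*} [DecidableEq ι] (s : Finset ι) :
    HasSum (fun m => (if m ∈ s then 1 else 0 : ℝ) ^ 2) s.card := by
  have := hasSum_sum_of_ne_finset_zero (L := .unconditional ι) (s := s)
    (f := fun m => (if m ∈ s then 1 else 0 : ℝ) ^ 2) fun m hm => by simp [hm]
  convert this
  rw [Finset.sum_congr rfl fun m hm => by rw [if_pos hm, one_pow]]
  simp

section Fibers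

variable {ι X H : Type*} [AddCommGroup ι]
  [NormedAddCommGroup X] [InnerProductSpace ℂ X] [NormedAddCommGroup H] [InnerProductSpace ℂ H]

/-- The squared distance in `ℓ²` between the indicator of a finite set and its translate. -/
noncomputable def indicatorDefect [DecidableEq ι] (s : Finset ι) (l : ι) : ℝ :=
  ∑' m, |(if m - l ∈ s then 1 else 0 : ℝ) - (if m ∈ s then 1 else 0)| ^ 2

theorem hasSum_indicatorDefect [DecidableEq ι] (s : Finset ι) (l : ι) :
    HasSum (fun m => |(if m - l ∈ s then 1 else 0 : ℝ) - (if m ∈ s then 1 else 0)| ^ 2)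
      (indicatorDefect s l) := by
  refine (summable_of_ne_finset_zero (s := s ∪ s.image (· + l)) fun m hm => ?_).hasSum
  simp only [Finset.mem_union, Finset.mem_image, not_or, not_exists, not_and] at hm
  have h1 : m - l ∉ s := fun h => hm.2 _ h (sub_add_cancel m l)
  simp [h1, hm.1]

theorem indicatorDefect_le [DecidableEq ι] (s : Finset ι) (l : ι) :
    indicatorDefect s l ≤ 2 * s.card := by
  have h1 := hasSum_indicator_sq s
  have h2 := (Equiv.subRight l).hasSum_iff.2 h1
  have h3 := h2.add h1
  rw [two_mul]
  refine hasSum_le (fun m => ?_) (hasSum_indicatorDefect s l) h3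
  simp only [Function.comp, Equiv.subRight_apply]
  split_ifs <;> norm_num

namespace IsFiber

variable {R : ι → X →ₗ[ℂ] H} {S : ι → X →ₗ[ℂ] X} {U : ι → H →ₗ[ℂ] H} {κ : ι → ℝ}
    {e : ι → ℂ} {A : Submodule ℂ X} {E : Submodule ℂ H}

/-- The partition of unity summed over a translated finite set is close to the indicator. -/
theorem norm_sum_sub_le [DecidableEq ι] [CompleteSpace H]
    (hF : IsFiber R S U κ e A E) (s : Finset ι) (m : ι) (v : H) :
    ‖∑ k ∈ s, U (m - k) v - (if m ∈ s then 1 else 0 : ℝ) • v‖ ≤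
      (∑' l, κ l * |(if m - l ∈ s then 1 else 0 : ℝ) - (if m ∈ s then 1 else 0)|) * ‖v‖ := by
  set ρ : ι → ℝ := fun m => if m ∈ s then 1 else 0 with hρ
  have h1 : HasSum (fun k => ρ k • U (m - k) v) (∑ k ∈ s, U (m - k) v) := by
    have := hasSum_sum_of_ne_finset_zero (L := .unconditional ι) (s := s)
      (f := fun k => ρ k • U (m - k) v) fun k hk => by simp [ρ, hk]
    rwa [Finset.sum_congr rfl fun k hk => by
      rw [show ρ k = 1 from if_pos hk, one_smul]] at this
  have h2 : HasSum (fun l => ρ (m - l) • U l v) (∑ k ∈ s, U (m - k) v) := by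
    have := (Equiv.subLeft m).hasSum_iff.2 h1
    refine this.congr_fun fun l => ?_
    simp
  have h3 := h2.sub ((hF.partition v).const_smul (ρ m))
  have hs : Summable fun l => κ l * |ρ (m - l) - ρ m| := by
    refine Summable.of_nonneg_of_le (fun l => mul_nonneg (hF.kappa_nonneg l) (abs_nonneg _))
      (fun l => ?_) hF.summable
    refine mul_le_of_le_one_right (hF.kappa_nonneg l) ?_
    simp only [ρ]
    split_ifs <;> norm_num
  rw [← h3.tsum_eq]
  refine tsum_of_norm_bounded (hs.hasSum.mul_right ‖v‖) fun l => ?_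
  rw [← sub_smul, norm_smul, Real.norm_eq_abs, mul_right_comm, mul_comm]
  exact mul_le_mul_of_nonneg_right (hF.norm_le l v) (abs_nonneg _)

/-- If the compressed operator is bounded below on the space of families, then it is nearly
bounded below on the fibre, with an error controlled by a finite set of indices. -/
theorem card_mul_le [DecidableEq ι] [A.HasOrthogonalProjection] [E.HasOrthogonalProjection]
    [CompleteSpace H]
    (hF : IsFiber R S U κ e A E) (T : X →L[ℂ] X) (M : H →L[ℂ] H)
    (hTM : ∀ m g, R m (T g) = M (R m g)) {c : ℝ} (hc : 0 < c)
    (hA : ∀ g ∈ A, c * ‖g‖ ≤ ‖A.orthogonalProjectionOnto (T g)‖) {v : H} (hv : v ∈ E)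
    (s : Finset ι) :
    c ^ 2 * (s.card * ‖v‖ ^ 2) ≤ (16 * ‖M‖ ^ 2 + 2 * c ^ 2) *
        ((∑' m, κ m) * ∑' m, κ m * indicatorDefect s m) * ‖v‖ ^ 2 +
      4 * (s.card * (∑' m, κ m) ^ 2) * ‖E.orthogonalProjectionOnto (M v)‖ ^ 2 := by
  obtain ⟨w, hwA, hw⟩ := hF.lift v hv
  set ρ : ι → ℝ := fun m => if m ∈ s then 1 else 0 with hρ
  set d : ι → ι → ℝ := fun l m => |ρ (m - l) - ρ m| with hd
  obtain ⟨hx1, hx2, hx3, hx4⟩ := young_tsum hF.summable hF.kappa_nonneg (d := d)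
    (fun _ _ => abs_nonneg _) (hasSum_indicatorDefect s) (indicatorDefect_le s)
  set x : ι → ℝ := fun m => ∑' l, κ l * d l m with hx
  set K : ℝ := ∑' m, κ m with hK
  have hK0 : 0 ≤ K := tsum_nonneg hF.kappa_nonneg
  set D : ℝ := K * ∑' m, κ m * indicatorDefect s m with hD
  have hx0 : ∀ m, 0 ≤ x m := fun m =>
    tsum_nonneg fun l => mul_nonneg (hF.kappa_nonneg l) (abs_nonneg _)
  have hD0 : 0 ≤ D := (tsum_nonneg fun m => sq_nonneg (x m)).trans hx4
  have hW : ∀ m z, ‖∑ k ∈ s, U (m - k) z - ρ m • z‖ ≤ x m * ‖z‖ := fun m z =>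
    hF.norm_sum_sub_le s m z
  -- This truncates the family (e m • v), which is not square summable, to s: the component of g at
  -- m is nearly e m • ρ m • v, with error x m * ‖v‖.
  set g : X := ∑ k ∈ s, e k • S (-k) w with hg
  have hgA : g ∈ A := A.sum_mem fun k _ => A.smul_mem _ (hF.invariant _ _ hwA)
  have hRg : ∀ m, R m g = e m • ∑ k ∈ s, U (m - k) v := fun m => by
    rw [hg, map_sum, Finset.smul_sum]
    refine Finset.sum_congr rfl fun k _ => ?_
    rw [map_smul, hF.translate, hw, smul_smul, ← hF.char_add, ← sub_eq_add_neg, add_sub_cancel]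
  have hRg' : ∀ m, ‖R m g - e m • ρ m • v‖ ≤ x m * ‖v‖ := fun m => by
    rw [hRg, ← smul_sub, norm_smul, hF.norm_char, one_mul]
    exact hW m v
  set h : X := (A.orthogonalProjectionOnto (T g) : X) with hh
  have hhA : h ∈ A := Submodule.coe_mem _
  have hcg : c * ‖g‖ ≤ ‖h‖ := hA g hgA
  set p : ℝ := ‖E.orthogonalProjectionOnto (M v)‖ with hp
  -- the lower bound for `g`
  have hlow : s.card * ‖v‖ ^ 2 ≤ 2 * ‖g‖ ^ 2 + 2 * D * ‖v‖ ^ 2 := by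
    have h1 : ∀ m, ρ m ^ 2 * ‖v‖ ^ 2 ≤ 2 * ‖R m g‖ ^ 2 + 2 * (x m ^ 2 * ‖v‖ ^ 2) := fun m => by
      have h2 : ρ m * ‖v‖ ≤ ‖R m g‖ + x m * ‖v‖ := by
        have h3 : ‖e m • ρ m • v‖ = ρ m * ‖v‖ := by
          rw [norm_smul, hF.norm_char, one_mul, norm_smul, Real.norm_of_nonneg]
          simp only [ρ]
          split_ifs <;> norm_num
        have h4 := norm_sub_norm_le (e m • ρ m • v) (R m g)
        rw [norm_sub_rev, h3] at h4
        linarith [hRg' m]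
      have hρ0 : 0 ≤ ρ m := by simp only [ρ]; split_ifs <;> norm_num
      have h3 := pow_le_pow_left₀ (mul_nonneg hρ0 (norm_nonneg v)) h2 2
      have h4 := add_sq_le (a := ‖R m g‖) (b := x m * ‖v‖)
      rw [mul_pow] at h3 h4
      linarith
    have h5 := hasSum_le h1 ((hasSum_indicator_sq s).mul_right (‖v‖ ^ 2))
      (((hF.hasSum_norm_sq g).mul_left 2).add ((hx3.hasSum.mul_right (‖v‖ ^ 2)).mul_left 2))
    have h6 := mul_le_mul_of_nonneg_right hx4 (sq_nonneg ‖v‖)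
    linarith
  -- the upper bound for `h`
  set f : ι → H := fun k => ∑' m, starRingEnd ℂ (e m) • U m (R m (S k h)) with hf
  set F : H := ∑ k ∈ s, starRingEnd ℂ (e k) • f k with hFdef
  have hFE : F ∈ E := E.sum_mem fun k _ => E.smul_mem _ (hF.fiber _ (hF.invariant k h hhA))
  have hbsum : ∀ m, HasSum (fun k => ‖R (m + k) h‖ ^ 2) (‖h‖ ^ 2) := fun m => by
    have := hF.hasSum_norm_sq (S m h)
    rw [hF.norm_translate] at this
    simpa only [hF.translate, add_comm _ m] using this
  obtain ⟨hy1, hy2, hy3, hy4⟩ := young_tsum hF.summable hF.kappa_nonneg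
    (d := fun m k => ‖R (m + k) h‖)
    (fun _ _ => norm_nonneg _) hbsum (B := ‖h‖ ^ 2) (fun m => le_rfl)
  rw [tsum_mul_right] at hy4
  set y : ι → ℝ := fun k => ∑' m, κ m * ‖R (m + k) h‖ with hy
  have hy0 : ∀ k, 0 ≤ y k := fun k =>
    tsum_nonneg fun m => mul_nonneg (hF.kappa_nonneg m) (norm_nonneg _)
  have hbd : ∀ k m, ‖starRingEnd ℂ (e m) • U m (R m (S k h))‖ ≤ κ m * ‖R (m + k) h‖ :=
    fun k m => by
      rw [norm_smul, RCLike.norm_conj, hF.norm_char, one_mul, hF.translate]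
      exact hF.norm_le _ _
  have hfsum : ∀ k, HasSum (fun m => starRingEnd ℂ (e m) • U m (R m (S k h))) (f k) := fun k =>
    (Summable.of_norm_bounded (hy1 k) (hbd k)).hasSum
  have hFn : ‖F‖ ≤ Real.sqrt s.card * (K * ‖h‖) := by
    have h1 : ∀ k, ‖f k‖ ≤ y k := fun k => tsum_of_norm_bounded (hy1 k).hasSum (hbd k)
    have h2 : ‖F‖ ≤ ∑ k ∈ s, y k := by
      refine (norm_sum_le _ _).trans (Finset.sum_le_sum fun k _ => ?_)
      rw [norm_smul, RCLike.norm_conj, hF.norm_char, one_mul]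
      exact h1 k
    refine h2.trans (abs_le_of_sq_le_sq' ?_ (by positivity)).2
    have h3 := sq_sum_le_card_mul_sum_sq (s := s) (f := y)
    have h4 := (hy3.sum_le_tsum s fun _ _ => sq_nonneg _).trans hy4
    rw [mul_pow, Real.sq_sqrt (Nat.cast_nonneg _), mul_pow]
    refine h3.trans (mul_le_mul_of_nonneg_left (h4.trans_eq (by ring)) (Nat.cast_nonneg _))
  -- Reindexing by j = m + k shows that F is approximately the sum of conj (e j) • R j h over j in
  -- s. The same truncation thus appears as in g, but now within the fibre.
  have hFsum : HasSum (fun j => starRingEnd ℂ (e j) • ∑ k ∈ s, U (j - k) (R j h)) F := by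
    have h1 : ∀ k ∈ s, HasSum (fun j => starRingEnd ℂ (e j) • U (j - k) (R j h))
        (starRingEnd ℂ (e k) • f k) := fun k _ => by
      have h2 := (Equiv.subRight k).hasSum_iff.2 ((hfsum k).const_smul (starRingEnd ℂ (e k)))
      refine h2.congr_fun fun j => ?_
      simp only [Function.comp, Equiv.subRight_apply, hF.translate, sub_add_cancel, smul_smul,
        ← map_mul, ← hF.char_add, add_sub_cancel]
    refine (hasSum_sum h1).congr_fun fun j => ?_
    rw [Finset.smul_sum]
  have hFM : HasSum (fun j => (inner ℂ (starRingEnd ℂ (e j) • ∑ k ∈ s, U (j - k) (R j h))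
      (M v) : ℂ)) (inner ℂ F (M v)) :=
    (innerSLFlip ℂ (M v)).hasSum hFsum
  have hhT : HasSum (fun m => (inner ℂ (R m h) (M (R m g)) : ℂ)) (‖h‖ ^ 2) := by
    have h1 : (inner ℂ h (T g) : ℂ) = ‖h‖ ^ 2 := by
      refine (Submodule.inner_orthogonalProjectionOnto_eq_of_mem_left
        (⟨h, hhA⟩ : A) (T g)).symm.trans ?_
      exact inner_self_eq_norm_sq_to_K (𝕜 := ℂ) h
    rw [← h1]
    simpa only [hTM] using hF.hasSum_inner h (T g)
  obtain ⟨hc1, hc2⟩ := summable_mul_and_tsum_mul_le hx0 (fun m => norm_nonneg (R m h))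
    (Real.sqrt_nonneg D) (norm_nonneg h) hx3 (hF.hasSum_norm_sq h).summable
    (hx4.trans_eq (Real.sq_sqrt hD0).symm) (hF.hasSum_norm_sq h).tsum_eq.le
  -- Both ⟪h, T g⟫ = ‖h‖² and ⟪F, M v⟫ are close to the sum of ρ m * ⟪R m h, e m • M v⟫. Each
  -- replacement costs ‖M‖ * ‖v‖ times the sum of x m * ‖R m h‖, hence the factor 2.
  have hdiff : ‖((‖h‖ ^ 2 : ℝ) : ℂ) - inner ℂ F (M v)‖ ≤
      (2 * ‖M‖ * ‖v‖) * (Real.sqrt D * ‖h‖) := by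
    have h1 := hhT.sub hFM
    have h2 : ((‖h‖ ^ 2 : ℝ) : ℂ) = (‖h‖ : ℂ) ^ 2 := by push_cast; rfl
    rw [h2, ← h1.tsum_eq]
    refine (tsum_of_norm_bounded (hc1.hasSum.mul_left (2 * ‖M‖ * ‖v‖)) fun m => ?_).trans
      (mul_le_mul_of_nonneg_left hc2 (by positivity))
    have h3 : (inner ℂ (R m h) (M (R m g)) : ℂ) -
        inner ℂ (starRingEnd ℂ (e m) • ∑ k ∈ s, U (m - k) (R m h)) (M v) =
        inner ℂ (R m h) (M (R m g - e m • ρ m • v)) -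
        inner ℂ (starRingEnd ℂ (e m) • (∑ k ∈ s, U (m - k) (R m h) - ρ m • R m h)) (M v) := by
      have h4 : M (e m • ρ m • v) = e m • (ρ m : ℂ) • M v := by
        rw [map_smul, ← Complex.coe_smul, map_smul]
      rw [map_sub, inner_sub_right, smul_sub, inner_sub_left, h4, ← Complex.coe_smul,
        inner_smul_right, inner_smul_right, inner_smul_left, inner_smul_left, inner_smul_left]
      simp
    rw [h3]
    refine (norm_sub_le _ _).trans ?_
    have h5 : ‖(inner ℂ (R m h) (M (R m g - e m • ρ m • v)) : ℂ)‖ ≤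
        ‖R m h‖ * (‖M‖ * (x m * ‖v‖)) :=
      (norm_inner_le_norm _ _).trans (mul_le_mul_of_nonneg_left ((M.le_opNorm _).trans
        (mul_le_mul_of_nonneg_left (hRg' m) (norm_nonneg _))) (norm_nonneg _))
    have h6 : ‖(inner ℂ (starRingEnd ℂ (e m) • (∑ k ∈ s, U (m - k) (R m h) - ρ m • R m h))
        (M v) : ℂ)‖ ≤ (x m * ‖R m h‖) * (‖M‖ * ‖v‖) := by
      refine (norm_inner_le_norm _ _).trans (mul_le_mul ?_ (M.le_opNorm _) (norm_nonneg _)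
        (mul_nonneg (hx0 m) (norm_nonneg _)))
      rw [norm_smul, RCLike.norm_conj, hF.norm_char, one_mul]
      exact hW m _
    linarith
  -- Since F lies in E, only the projection of M v onto E contributes.
  have hinner : ‖(inner ℂ F (M v) : ℂ)‖ ≤ Real.sqrt s.card * (K * ‖h‖) * p := by
    rw [← Submodule.inner_orthogonalProjectionOnto_eq_of_mem_left (⟨F, hFE⟩ : E) (M v)]
    exact (norm_inner_le_norm _ _).trans (mul_le_mul_of_nonneg_right hFn (norm_nonneg _))
  have hup : ‖h‖ ≤ 2 * ‖M‖ * ‖v‖ * Real.sqrt D + Real.sqrt s.card * K * p := by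
    have h1 : ‖h‖ * ‖h‖ ≤ (2 * ‖M‖ * ‖v‖ * Real.sqrt D + Real.sqrt s.card * K * p) * ‖h‖ := by
      have h2 := norm_le_norm_add_norm_sub' ((‖h‖ ^ 2 : ℝ) : ℂ) (inner ℂ F (M v))
      rw [Complex.norm_real, Real.norm_of_nonneg (sq_nonneg _)] at h2
      nlinarith
    by_cases h0 : ‖h‖ = 0
    · rw [h0]; positivity
    · exact le_of_mul_le_mul_right h1 (lt_of_le_of_ne (norm_nonneg _) (Ne.symm h0))
  have hup2 : ‖h‖ ^ 2 ≤ 8 * ‖M‖ ^ 2 * D * ‖v‖ ^ 2 + 2 * (s.card * K ^ 2) * p ^ 2 := by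
    have h1 := (pow_le_pow_left₀ (norm_nonneg _) hup 2).trans add_sq_le
    rw [mul_pow, mul_pow, mul_pow, mul_pow, mul_pow, Real.sq_sqrt hD0,
      Real.sq_sqrt (Nat.cast_nonneg _)] at h1
    linarith
  have hcg2 : c ^ 2 * ‖g‖ ^ 2 ≤ ‖h‖ ^ 2 := by
    rw [← mul_pow]
    exact pow_le_pow_left₀ (by positivity) hcg 2
  have := mul_le_mul_of_nonneg_left hlow (sq_nonneg c)
  linarith

end IsFiber

end Fibers

/-! ### Joint approximate eigenvectors -/

section ApproximateEigenvectors

variable {V : Type*} [NormedAddCommGroup V] [InnerProductSpace ℂ V]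

/-- The finite Parseval identity for vector-valued sequences. -/
theorem sum_norm_sq_dft {N : ℕ} {ζ : ℂ} (hζ : IsPrimitiveRoot ζ N) (hN : 0 < N) (a : ℕ → V) :
    ∑ j ∈ Finset.range N, ‖∑ k ∈ Finset.range N, (ζ ^ j) ^ k • a k‖ ^ 2 =
      N * ∑ k ∈ Finset.range N, ‖a k‖ ^ 2 := by
  have hζ0 : ζ ≠ 0 := hζ.ne_zero hN.ne'
  have hζn : ‖ζ‖ = 1 := hζ.norm'_eq_one hN.ne'
  have hconj : starRingEnd ℂ ζ = ζ⁻¹ := (Complex.inv_eq_conj hζn).symm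
  have horth : ∀ k ∈ Finset.range N, ∀ l ∈ Finset.range N,
      ∑ j ∈ Finset.range N, (starRingEnd ℂ ((ζ ^ j) ^ k) * (ζ ^ j) ^ l) =
        if k = l then (N : ℂ) else 0 := by
    intro k hk l hl
    have h1 : ∀ j, starRingEnd ℂ ((ζ ^ j) ^ k) * (ζ ^ j) ^ l = ((ζ ^ k)⁻¹ * ζ ^ l) ^ j := by
      intro j
      rw [map_pow, map_pow, hconj, mul_pow, inv_pow, inv_pow, inv_pow]
      congr 1
      · congr 1; ring
      · ring
    simp_rw [h1]
    split_ifs with h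
    · subst h
      simp [hζ0]
    · have hx : (ζ ^ k)⁻¹ * ζ ^ l ≠ 1 := by
        intro h2
        rw [inv_mul_eq_one₀ (pow_ne_zero _ hζ0)] at h2
        exact h (hζ.pow_inj (Finset.mem_range.1 hk) (Finset.mem_range.1 hl) h2)
      rw [geom_sum_eq hx, mul_pow, inv_pow, ← pow_mul, ← pow_mul, mul_comm k, mul_comm l, pow_mul,
        pow_mul, hζ.pow_eq_one]
      simp
  have key : (∑ j ∈ Finset.range N, (‖∑ k ∈ Finset.range N, (ζ ^ j) ^ k • a k‖ : ℂ) ^ 2) =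
      N * ∑ k ∈ Finset.range N, (‖a k‖ : ℂ) ^ 2 := by
    have h1 : ∀ j, ((‖∑ k ∈ Finset.range N, (ζ ^ j) ^ k • a k‖ : ℂ)) ^ 2 =
        ∑ k ∈ Finset.range N, ∑ l ∈ Finset.range N,
          (starRingEnd ℂ ((ζ ^ j) ^ k) * (ζ ^ j) ^ l) * inner ℂ (a k) (a l) := by
      intro j
      refine (inner_self_eq_norm_sq_to_K (𝕜 := ℂ)
        (∑ k ∈ Finset.range N, (ζ ^ j) ^ k • a k)).symm.trans ?_
      rw [sum_inner]
      refine Finset.sum_congr rfl fun k _ => ?_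
      rw [inner_sum]
      refine Finset.sum_congr rfl fun l _ => ?_
      rw [inner_smul_left, inner_smul_right, mul_assoc]
    simp_rw [h1]
    rw [Finset.sum_comm, Finset.mul_sum]
    refine Finset.sum_congr rfl fun k hk => ?_
    rw [Finset.sum_comm]
    have h2 : ∀ l ∈ Finset.range N, ∑ j ∈ Finset.range N,
        (starRingEnd ℂ ((ζ ^ j) ^ k) * (ζ ^ j) ^ l) * inner ℂ (a k) (a l) =
        if k = l then (N : ℂ) * inner ℂ (a k) (a l) else 0 := by
      intro l hl
      rw [← Finset.sum_mul, horth k hk l hl, ite_mul, zero_mul]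
    rw [Finset.sum_congr rfl h2, Finset.sum_ite_eq, if_pos hk]
    congr 1
    exact inner_self_eq_norm_sq_to_K (𝕜 := ℂ) (a k)
  exact_mod_cast key

/-- A quantitative version of the fact that operators commuting with an isometry `S` which are not
jointly bounded below have approximate joint kernel vectors which are nearly eigenvectors
of `S`. -/
theorem exists_norm_sub_smul_sq_le {S B₁ B₂ : V →ₗ[ℂ] V} (hS : ∀ g, ‖S g‖ = ‖g‖)
    (h₁ : ∀ g, B₁ (S g) = S (B₁ g)) (h₂ : ∀ g, B₂ (S g) = S (B₂ g))
    {N : ℕ} (hN : 0 < N) {b : ℝ} (hb : 0 < b) {g : V} (hg : g ≠ 0)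
    (hB : ‖B₁ g‖ ^ 2 + ‖B₂ g‖ ^ 2 ≤ b * ‖g‖ ^ 2) :
    ∃ μ : ℂ, ‖μ‖ = 1 ∧ ∃ f ≠ 0, ‖B₁ f‖ ^ 2 + ‖B₂ f‖ ^ 2 ≤ 2 * b * ‖f‖ ^ 2 ∧
      ‖S f - μ • f‖ ^ 2 ≤ 8 / N * ‖f‖ ^ 2 := by
  have hζ := Complex.isPrimitiveRoot_exp N hN.ne'
  set ζ := Complex.exp (2 * Real.pi * Complex.I / N)
  have hζ0 : ζ ≠ 0 := hζ.ne_zero hN.ne'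
  have hζn : ‖ζ‖ = 1 := hζ.norm'_eq_one hN.ne'
  have hN' : (0 : ℝ) < N := Nat.cast_pos.2 hN
  have hSk : ∀ (k : ℕ) (v : V), ‖(S ^ k) v‖ = ‖v‖ := by
    intro k v
    induction k with
    | zero => simp
    | succ k ih => rw [pow_succ', Module.End.mul_apply, hS, ih]
  have hcomm : ∀ {B : V →ₗ[ℂ] V}, (∀ g, B (S g) = S (B g)) → ∀ (k : ℕ) (v : V),
      B ((S ^ k) v) = (S ^ k) (B v) := by
    intro B hB k v
    induction k with
    | zero => simp
    | succ k ih => rw [pow_succ', Module.End.mul_apply, hB, ih, Module.End.mul_apply]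
  -- The finite Fourier components of the orbit of g: operators commuting with S act through g, and
  -- `S` multiplies f j by the inverse of ζ ^ j up to a boundary term.
  set f : ℕ → V := fun j => ∑ k ∈ Finset.range N, (ζ ^ j) ^ k • (S ^ k) g with hf
  have hpars : ∀ v : V, ∑ j ∈ Finset.range N,
      ‖∑ k ∈ Finset.range N, (ζ ^ j) ^ k • (S ^ k) v‖ ^ 2 = N ^ 2 * ‖v‖ ^ 2 := by
    intro v
    rw [sum_norm_sq_dft hζ hN]
    simp only [hSk, Finset.sum_const, Finset.card_range, nsmul_eq_mul]
    ring
  have hBf : ∀ {B : V →ₗ[ℂ] V}, (∀ g, B (S g) = S (B g)) →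
      ∑ j ∈ Finset.range N, ‖B (f j)‖ ^ 2 = N ^ 2 * ‖B g‖ ^ 2 := by
    intro B hB
    rw [← hpars (B g)]
    refine Finset.sum_congr rfl fun j _ => ?_
    simp only [hf, map_sum, map_smul, hcomm hB]
  have hff : ∑ j ∈ Finset.range N, ‖f j‖ ^ 2 = N ^ 2 * ‖g‖ ^ 2 := hpars g
  have hSf : ∀ j, ‖S (f j) - (ζ ^ j)⁻¹ • f j‖ ^ 2 ≤ 4 * ‖g‖ ^ 2 := by
    intro j
    have hz : (ζ ^ j) ≠ 0 := pow_ne_zero _ hζ0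
    -- Applying ζ ^ j • S shifts the summation index by one, so only the two end terms survive; (ζ ^
    -- j) ^ N = 1 removes the phase of the last one.
    have h1 : (ζ ^ j) • S (f j) = f j + ((S ^ N) g - g) := by
      have h2 : (ζ ^ j) • S (f j) =
          ∑ k ∈ Finset.range N, (ζ ^ j) ^ (k + 1) • (S ^ (k + 1)) g := by
        simp only [hf, map_sum, map_smul, Finset.smul_sum, smul_smul, ← pow_succ']
        refine Finset.sum_congr rfl fun k _ => ?_
        rw [pow_succ' S, Module.End.mul_apply]
      have h3 := Finset.sum_range_succ (fun k => (ζ ^ j) ^ k • (S ^ k) g) N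
      rw [Finset.sum_range_succ'] at h3
      have h4 : (ζ ^ j) ^ N = 1 := by rw [← pow_mul, mul_comm, pow_mul, hζ.pow_eq_one, one_pow]
      simp only [h4, pow_zero, one_smul, Module.End.one_apply] at h3
      rw [h2, eq_sub_of_add_eq h3, add_sub_assoc]
    have h5 : S (f j) - (ζ ^ j)⁻¹ • f j = (ζ ^ j)⁻¹ • ((S ^ N) g - g) := by
      rw [← inv_smul_smul₀ hz (S (f j)), h1, ← smul_sub, add_sub_cancel_left]
    rw [h5, norm_smul, norm_inv, norm_pow, hζn, one_pow, inv_one, one_mul]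
    have h6 : ‖(S ^ N) g - g‖ ≤ 2 * ‖g‖ := by
      refine (norm_sub_le _ _).trans ?_
      rw [hSk]
      linarith
    have := pow_le_pow_left₀ (norm_nonneg _) h6 2
    linarith
  have hgpos : 0 < ‖g‖ ^ 2 := by positivity
  -- Averaging over j: by Parseval, each of the two terms on the left sums to at most N² * ‖g‖², and
  -- the right side sums to exactly 2 * N² * ‖g‖². The weights 1 / b and N / 4 are chosen for this
  -- balance.
  obtain ⟨j, hj, hj0, hle⟩ : ∃ j ∈ Finset.range N, f j ≠ 0 ∧
      (‖B₁ (f j)‖ ^ 2 + ‖B₂ (f j)‖ ^ 2) / b + N / 4 * ‖S (f j) - (ζ ^ j)⁻¹ • f j‖ ^ 2 ≤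
        2 * ‖f j‖ ^ 2 := by
    by_contra! hcon
    have h1 : ∑ j ∈ Finset.range N, 2 * ‖f j‖ ^ 2 < ∑ j ∈ Finset.range N,
        ((‖B₁ (f j)‖ ^ 2 + ‖B₂ (f j)‖ ^ 2) / b +
          N / 4 * ‖S (f j) - (ζ ^ j)⁻¹ • f j‖ ^ 2) := by
      refine Finset.sum_lt_sum (fun j hj => ?_) ?_
      · by_cases h0 : f j = 0
        · simp [h0]
        · exact (hcon j hj h0).le
      · obtain ⟨j, hj, h2⟩ := Finset.exists_ne_zero_of_sum_ne_zero
          (hff.trans_ne (by positivity : (N : ℝ) ^ 2 * ‖g‖ ^ 2 ≠ 0))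
        refine ⟨j, hj, hcon j hj fun h0 => h2 (by simp [h0])⟩
    rw [Finset.sum_add_distrib, ← Finset.sum_div, Finset.sum_add_distrib, hBf h₁, hBf h₂,
      ← Finset.mul_sum, ← Finset.mul_sum, hff] at h1
    have h2 : ∑ j ∈ Finset.range N, ‖S (f j) - (ζ ^ j)⁻¹ • f j‖ ^ 2 ≤ N * (4 * ‖g‖ ^ 2) := by
      refine (Finset.sum_le_sum fun j _ => hSf j).trans_eq ?_
      simp
    have h3 : ((N : ℝ) ^ 2 * ‖B₁ g‖ ^ 2 + N ^ 2 * ‖B₂ g‖ ^ 2) / b ≤ N ^ 2 * ‖g‖ ^ 2 := by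
      rw [div_le_iff₀ hb, ← mul_add]
      calc _ ≤ (N : ℝ) ^ 2 * (b * ‖g‖ ^ 2) := mul_le_mul_of_nonneg_left hB (sq_nonneg _)
        _ = _ := by ring
    have h4 := mul_le_mul_of_nonneg_left h2 (by positivity : (0 : ℝ) ≤ N / 4)
    nlinarith
  have hp1 : 0 ≤ (‖B₁ (f j)‖ ^ 2 + ‖B₂ (f j)‖ ^ 2) / b := by positivity
  have hp2 : 0 ≤ N / 4 * ‖S (f j) - (ζ ^ j)⁻¹ • f j‖ ^ 2 := by positivity
  refine ⟨(ζ ^ j)⁻¹, by simp [hζn], f j, hj0, ?_, ?_⟩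
  · have : (‖B₁ (f j)‖ ^ 2 + ‖B₂ (f j)‖ ^ 2) / b ≤ 2 * ‖f j‖ ^ 2 := by linarith
    rw [div_le_iff₀ hb] at this
    linarith
  · have : N / 4 * ‖S (f j) - (ζ ^ j)⁻¹ • f j‖ ^ 2 ≤ 2 * ‖f j‖ ^ 2 := by linarith
    rw [div_mul_eq_mul_div, le_div_iff₀ hN']
    linarith

/-- Operators commuting with an isometry `S` which are not jointly bounded below have approximate
joint kernel vectors which are approximate eigenvectors of `S`. -/
theorem exists_approximate_eigenvalue {S B₁ B₂ : V →ₗ[ℂ] V} (hS : ∀ g, ‖S g‖ = ‖g‖)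
    (h₁ : ∀ g, B₁ (S g) = S (B₁ g)) (h₂ : ∀ g, B₂ (S g) = S (B₂ g))
    (hB : ∀ ε > 0, ∃ g ≠ 0, ‖B₁ g‖ ≤ ε * ‖g‖ ∧ ‖B₂ g‖ ≤ ε * ‖g‖) :
    ∃ μ : ℂ, ‖μ‖ = 1 ∧ ∀ ε > 0, ∃ g ≠ 0, ‖B₁ g‖ ≤ ε * ‖g‖ ∧ ‖B₂ g‖ ≤ ε * ‖g‖ ∧
      ‖S g - μ • g‖ ≤ ε * ‖g‖ := by
  have key : ∀ ε > 0, ∃ μ : ℂ, ‖μ‖ = 1 ∧ ∃ g ≠ 0, ‖B₁ g‖ ≤ ε * ‖g‖ ∧ ‖B₂ g‖ ≤ ε * ‖g‖ ∧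
      ‖S g - μ • g‖ ≤ ε * ‖g‖ := by
    intro ε hε
    obtain ⟨g, hg, hg1, hg2⟩ := hB (ε / 2) (by positivity)
    obtain ⟨N, hN⟩ := exists_nat_gt (8 / ε ^ 2)
    have hN0 : (0 : ℝ) < N := lt_of_le_of_lt (by positivity) hN
    obtain ⟨μ, hμ, f, hf, hf1, hf2⟩ := exists_norm_sub_smul_sq_le hS h₁ h₂ (Nat.cast_pos.1 hN0)
      (b := ε ^ 2 / 2) (by positivity) hg (by
        have h3 := pow_le_pow_left₀ (norm_nonneg _) hg1 2
        have h4 := pow_le_pow_left₀ (norm_nonneg _) hg2 2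
        rw [mul_pow] at h3 h4
        linarith)
    refine ⟨μ, hμ, f, hf, ?_, ?_, ?_⟩
    · refine (abs_le_of_sq_le_sq' ?_ (by positivity)).2
      rw [mul_pow]
      nlinarith [sq_nonneg ‖B₂ f‖]
    · refine (abs_le_of_sq_le_sq' ?_ (by positivity)).2
      rw [mul_pow]
      nlinarith [sq_nonneg ‖B₁ f‖]
    · refine (abs_le_of_sq_le_sq' ?_ (by positivity)).2
      rw [mul_pow]
      refine hf2.trans (mul_le_mul_of_nonneg_right ?_ (sq_nonneg _))
      rw [div_lt_iff₀ (by positivity)] at hN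
      rw [div_le_iff₀ hN0]
      linarith
  choose! μ hμ g hg hg1 hg2 hg3 using key
  have hpos : ∀ n : ℕ, (0 : ℝ) < 1 / ((n : ℝ) + 1) := fun n => Nat.one_div_pos_of_nat
  -- The eigenvalue still depends on ε; compactness of the unit circle gives a limit that serves for
  -- every ε.
  obtain ⟨μ₀, hμ₀, φ, hφ, hlim⟩ := (isCompact_sphere (0 : ℂ) 1).tendsto_subseq
    (x := fun n : ℕ => μ (1 / ((n : ℝ) + 1))) fun n => by
      rw [mem_sphere_zero_iff_norm]
      exact hμ _ (hpos n)
  refine ⟨μ₀, by simpa using hμ₀, fun ε hε => ?_⟩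
  have ht : Tendsto (fun n : ℕ => 1 / ((φ n : ℝ) + 1)) atTop (𝓝 0) :=
    tendsto_one_div_add_atTop_nhds_zero_nat.comp hφ.tendsto_atTop
  obtain ⟨n, hn1, hn2⟩ := ((ht.eventually (gt_mem_nhds (half_pos hε))).and
    (Metric.tendsto_nhds.1 hlim (ε / 2) (half_pos hε))).exists
  set δ : ℝ := 1 / ((φ n : ℝ) + 1)
  have hδ : 0 < δ := hpos (φ n)
  have hle : δ * ‖g δ‖ ≤ ε * ‖g δ‖ := by gcongr; linarith
  refine ⟨g δ, hg δ hδ, (hg1 δ hδ).trans hle, (hg2 δ hδ).trans hle, ?_⟩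
  have h1 : S (g δ) - μ₀ • g δ = (S (g δ) - μ δ • g δ) + (μ δ - μ₀) • g δ := by
    rw [sub_smul]; abel
  rw [h1]
  refine (norm_add_le _ _).trans ?_
  rw [norm_smul, ← dist_eq_norm (μ δ)]
  have h2 := hg3 δ hδ
  have h3 : dist (μ δ) μ₀ * ‖g δ‖ ≤ ε / 2 * ‖g δ‖ :=
    mul_le_mul_of_nonneg_right hn2.le (norm_nonneg _)
  have h4 : δ * ‖g δ‖ ≤ ε / 2 * ‖g δ‖ := mul_le_mul_of_nonneg_right hn1.le (norm_nonneg _)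
  linarith

end ApproximateEigenvectors

/-! ### Invertibility criteria -/

theorem isFredholm_of_isUnit {V : Type*} [NormedAddCommGroup V] [InnerProductSpace ℂ V]
    {B : V →L[ℂ] V} (hB : IsUnit B) : B.IsFredholm := by
  obtain ⟨u, rfl⟩ := hB
  refine ContinuousLinearMap.IsFredholm.of_isQuasiInverse (v := (↑u⁻¹ : V →L[ℂ] V)) ?_
  have h1 : ((↑u⁻¹ : V →L[ℂ] V) : V →ₗ[ℂ] V) ∘ₗ ((u : V →L[ℂ] V) : V →ₗ[ℂ] V) = LinearMap.id :=
    LinearMap.ext fun v => DFunLike.congr_fun (u.inv_mul) v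
  have h2 : ((u : V →L[ℂ] V) : V →ₗ[ℂ] V) ∘ₗ ((↑u⁻¹ : V →L[ℂ] V) : V →ₗ[ℂ] V) = LinearMap.id :=
    LinearMap.ext fun v => DFunLike.congr_fun (u.mul_inv) v
  constructor
  · rw [LinearMap.IsLeftQuasiInverse, h1]
  · rw [LinearMap.IsRightQuasiInverse, h2]

section Invertibility

variable {V : Type*} [NormedAddCommGroup V] [InnerProductSpace ℂ V] [CompleteSpace V]

/-- The orthogonal complement of the range of B lies in the kernel of the adjoint B', so a closed
range is the whole space. -/
theorem isUnit_of_ker_eq_bot {B B' : V →L[ℂ] V} (hadj : ∀ x y, inner ℂ (B x) y = inner ℂ x (B' y))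
    (hker : ∀ x, B x = 0 → x = 0) (hker' : ∀ x, B' x = 0 → x = 0)
    (hcl : IsClosed (B.range : Set V)) : IsUnit B := by
  refine ContinuousLinearMap.isUnit_iff_bijective.2 ⟨?_, ?_⟩
  · exact (injective_iff_map_eq_zero B).2 hker
  · have : CompleteSpace B.range := hcl.completeSpace_coe
    have h1 : B.range = ⊤ := by
      rw [← Submodule.orthogonal_eq_bot_iff, Submodule.eq_bot_iff]
      intro y hy
      refine hker' y (ext_inner_left ℂ fun x => ?_)
      rw [← hadj, inner_zero_right]
      exact (Submodule.mem_orthogonal _ _).1 hy _ (LinearMap.mem_range_self _ x)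
    exact LinearMap.range_eq_top.1 h1

/-- This reduces invertibility to two one-sided estimates of the same kind, one for an operator and
one for its adjoint. A lower bound for B makes its range closed, and one for B' makes the range
dense. -/
theorem isUnit_iff_bounded_below {B B' : V →L[ℂ] V}
    (hadj : ∀ x y, inner ℂ (B x) y = inner ℂ x (B' y)) :
    IsUnit B ↔ (∃ c > 0, ∀ v, c * ‖v‖ ≤ ‖B v‖) ∧ (∃ c > 0, ∀ v, c * ‖v‖ ≤ ‖B' v‖) := by
  constructor
  · rintro ⟨u, rfl⟩
    set C : V →L[ℂ] V := ↑u⁻¹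
    have hC1 : ∀ v, C ((u : V →L[ℂ] V) v) = v := fun v =>
      DFunLike.congr_fun (u.inv_mul) v
    have hC2 : ∀ v, (u : V →L[ℂ] V) (C v) = v := fun v =>
      DFunLike.congr_fun (u.mul_inv) v
    have hpos : 0 < (‖C‖ + 1)⁻¹ := by positivity
    have hCle : ∀ v, ‖C v‖ ≤ (‖C‖ + 1) * ‖v‖ := fun v =>
      (C.le_opNorm v).trans (by gcongr; linarith)
    refine ⟨⟨_, hpos, fun v => ?_⟩, ⟨_, hpos, fun v => ?_⟩⟩
    · rw [inv_mul_le_iff₀ (by positivity)]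
      have := hCle ((u : V →L[ℂ] V) v)
      rwa [hC1] at this
    · rw [inv_mul_le_iff₀ (by positivity)]
      have h1 : ‖v‖ * ‖v‖ ≤ ((‖C‖ + 1) * ‖B' v‖) * ‖v‖ := by
        have h2 : (inner ℂ v v : ℂ) = inner ℂ (C v) (B' v) := by rw [← hadj, hC2]
        rw [← sq, ← inner_self_eq_norm_sq (𝕜 := ℂ), h2]
        calc _ ≤ ‖(inner ℂ (C v) (B' v) : ℂ)‖ := RCLike.re_le_norm _
          _ ≤ ‖C v‖ * ‖B' v‖ := norm_inner_le_norm _ _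
          _ ≤ ((‖C‖ + 1) * ‖v‖) * ‖B' v‖ := mul_le_mul_of_nonneg_right (hCle v) (norm_nonneg _)
          _ = _ := by ring
      by_cases h0 : ‖v‖ = 0
      · rw [h0]; positivity
      · exact le_of_mul_le_mul_right h1 (lt_of_le_of_ne (norm_nonneg _) (Ne.symm h0))
  · rintro ⟨⟨c, hc, hB⟩, ⟨c', hc', hB'⟩⟩
    have hz : ∀ {D : V →L[ℂ] V} {c : ℝ}, 0 < c → (∀ v, c * ‖v‖ ≤ ‖D v‖) → ∀ x, D x = 0 → x = 0 := by
      intro D c hc hD x hx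
      have h1 := hD x
      rw [hx, norm_zero] at h1
      exact norm_le_zero_iff.1 (nonpos_of_mul_nonpos_right h1 hc)
    refine isUnit_of_ker_eq_bot hadj (hz hc hB) (hz hc' hB') ?_
    have hanti : AntilipschitzWith (Real.toNNReal c⁻¹) B := by
      refine B.antilipschitz_of_bound fun x => ?_
      rw [Real.coe_toNNReal _ (inv_nonneg.2 hc.le), ← div_eq_inv_mul, le_div_iff₀ hc, mul_comm]
      exact hB x
    exact hanti.isClosed_range B.uniformContinuous

/-- A Fredholm operator which commutes, together with its adjoint, with an operator without
eigenvectors is invertible. -/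
theorem isUnit_of_isFredholm {B B' : V →L[ℂ] V} (hadj : ∀ x y, inner ℂ (B x) y = inner ℂ x (B' y))
    (hB : B.IsFredholm) {S : V →ₗ[ℂ] V} (hBS : ∀ g, B (S g) = S (B g))
    (hBS' : ∀ g, B' (S g) = S (B' g)) (hS : ∀ (μ : ℂ) (g : V), S g = μ • g → g = 0) :
    IsUnit B := by
  -- A nonzero finite-dimensional invariant subspace over ℂ would contain an eigenvector of S.
  have key : ∀ W : Submodule ℂ V, FiniteDimensional ℂ W → (∀ w ∈ W, S w ∈ W) → W = ⊥ := by
    intro W hW hinv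
    by_contra hne
    have : Nontrivial W := Submodule.nontrivial_iff_ne_bot.2 hne
    obtain ⟨μ, hμ⟩ := Module.End.exists_eigenvalue (S.restrict hinv)
    obtain ⟨w, hw⟩ := hμ.exists_hasEigenvector
    have h1 := congrArg Subtype.val hw.apply_eq_smul
    exact hw.2 (Subtype.ext (hS μ w h1))
  have hk : B.ker = ⊥ := key _ hB.finite_ker fun w hw => by
    rw [LinearMap.mem_ker] at hw ⊢
    have := hBS w
    change B w = 0 at hw
    rw [hw, map_zero] at this
    exact this
  have hperp : ∀ y, B' y = 0 → y ∈ B.rangeᗮ := fun y hy => by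
    rw [Submodule.mem_orthogonal]
    rintro _ ⟨x, rfl⟩
    change inner ℂ (B x) y = 0
    rw [hadj, hy, inner_zero_right]
  have hfin : FiniteDimensional ℂ B'.ker := by
    have := hB.finite_coker
    have hq : FiniteDimensional ℂ (V ⧸ B.range) := this
    -- The kernel of the adjoint is orthogonal to the range of B, so it embeds into the cokernel.
    refine FiniteDimensional.of_injective (B.range.mkQ ∘ₗ B'.ker.subtype) ?_
    refine (injective_iff_map_eq_zero _).2 fun y hy => ?_
    have h1 : (y : V) ∈ B.range := (Submodule.Quotient.mk_eq_zero _).1 hy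
    have h2 : (y : V) ∈ B.rangeᗮ := hperp y y.2
    exact Subtype.ext (inner_self_eq_zero.1 ((Submodule.mem_orthogonal _ _).1 h2 _ h1))
  have hk' : B'.ker = ⊥ := key _ hfin fun w hw => by
    rw [LinearMap.mem_ker] at hw ⊢
    have := hBS' w
    change B' w = 0 at hw
    rw [hw, map_zero] at this
    exact this
  exact isUnit_of_ker_eq_bot hadj (fun x hx => LinearMap.ker_eq_bot'.1 hk x hx)
    (fun x hx => LinearMap.ker_eq_bot'.1 hk' x hx) hB.isClosed_range

end Invertibility

/-! ### Compressions, characters of ℤ² and the limits of the quantitative estimates -/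

section PlaneLattice

variable {X H : Type*}
  [NormedAddCommGroup X] [InnerProductSpace ℂ X] [NormedAddCommGroup H] [InnerProductSpace ℂ H]

/-- The compression of a bounded operator to a subspace. -/
noncomputable def compression (A : Submodule ℂ X) [A.HasOrthogonalProjection] (T : X →L[ℂ] X) :
    A →L[ℂ] A :=
  A.orthogonalProjectionOnto ∘L T ∘L A.subtypeL

theorem compression_apply (A : Submodule ℂ X) [A.HasOrthogonalProjection] (T : X →L[ℂ] X) (g : A) :
    compression A T g = A.orthogonalProjectionOnto (T g) := rfl

theorem inner_compression {A : Submodule ℂ X} [A.HasOrthogonalProjection] {T T' : X →L[ℂ] X}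
    (h : ∀ x y, inner ℂ (T x) y = inner ℂ x (T' y)) (x y : A) :
    inner ℂ (compression A T x) y = inner ℂ x (compression A T' y) := by
  rw [compression_apply, compression_apply,
    Submodule.inner_orthogonalProjectionOnto_eq_of_mem_right,
    Submodule.inner_orthogonalProjectionOnto_eq_of_mem_left, h]

/-- The character of `ℤ²` with parameter `η`. -/
noncomputable def latticeCharacter (η : ℝ × ℝ) (m : ℤ × ℤ) : ℂ :=
  Complex.exp (Complex.I * (η.1 * m.1 + η.2 * m.2))

theorem norm_latticeCharacter (η : ℝ × ℝ) (m : ℤ × ℤ) : ‖latticeCharacter η m‖ = 1 := by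
  rw [latticeCharacter, mul_comm]
  exact_mod_cast Complex.norm_exp_ofReal_mul_I (η.1 * m.1 + η.2 * m.2)

theorem latticeCharacter_add (η : ℝ × ℝ) (m k : ℤ × ℤ) :
    latticeCharacter η (m + k) = latticeCharacter η m * latticeCharacter η k := by
  rw [latticeCharacter, latticeCharacter, latticeCharacter, ← Complex.exp_add]
  congr 1
  push_cast [Prod.fst_add, Prod.snd_add]
  ring

/-- The principal arguments lie in (-π, π], so every pair of unimodular eigenvalues is realized by a
parameter in the closed square. -/
theorem exists_latticeCharacter {μ₁ μ₂ : ℂ} (h₁ : ‖μ₁‖ = 1) (h₂ : ‖μ₂‖ = 1) :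
    ∃ η ∈ Icc (-Real.pi) Real.pi ×ˢ Icc (-Real.pi) Real.pi,
      latticeCharacter η (1, 0) = μ₁ ∧ latticeCharacter η (0, 1) = μ₂ := by
  have key : ∀ {μ : ℂ}, ‖μ‖ = 1 → Complex.exp (Complex.I * μ.arg) = μ := fun {μ} h => by
    have := Complex.norm_mul_exp_arg_mul_I μ
    rwa [h, Complex.ofReal_one, one_mul, mul_comm] at this
  have hmem : ∀ μ : ℂ, μ.arg ∈ Icc (-Real.pi) Real.pi := fun μ =>
    ⟨(Complex.neg_pi_lt_arg μ).le, Complex.arg_le_pi μ⟩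
  refine ⟨(μ₁.arg, μ₂.arg), ⟨hmem _, hmem _⟩, ?_, ?_⟩
  · simpa [latticeCharacter] using key h₁
  · simpa [latticeCharacter] using key h₂

/-- The translates of a large square by a fixed vector differ little from the square. -/
theorem indicatorDefect_square_le (N : ℕ) (l : ℤ × ℤ) :
    indicatorDefect (Finset.Ico (0 : ℤ) N ×ˢ Finset.Ico (0 : ℤ) N) l ≤
      4 * (|l.1| + |l.2|) * N := by
  set I := Finset.Ico (0 : ℤ) N with hI
  set s := I ×ˢ I with hs
  have hcardI : I.card = N := by simp [hI]
  -- A point that leaves the interval under a shift by j lies within |j| of one of its ends.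
  have hone : ∀ j : ℤ, (I.filter (fun i => i - j ∉ I)).card ≤ 2 * |j| := by
    intro j
    have hsub : I.filter (fun i => i - j ∉ I) ⊆
        Finset.Ico 0 |j| ∪ Finset.Ico (N - |j|) N := by
      intro i hi
      simp only [hI, Finset.mem_filter, Finset.mem_Ico, Finset.mem_union, not_and, not_lt] at hi ⊢
      rcases abs_cases j with h | h <;> omega
    have h1 := (Finset.card_le_card hsub).trans (Finset.card_union_le _ _)
    simp only [Int.card_Ico] at h1
    rcases abs_cases j with h | h <;> omega
  have htwo : ∀ l : ℤ × ℤ, ((s.filter (fun m => m - l ∉ s)).card : ℤ) ≤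
      2 * (|l.1| + |l.2|) * N := by
    intro l
    have hsub : s.filter (fun m => m - l ∉ s) ⊆
        (I.filter (fun i => i - l.1 ∉ I)) ×ˢ I ∪ I ×ˢ (I.filter (fun i => i - l.2 ∉ I)) := by
      intro m hm
      simp only [hs, Finset.mem_filter, Finset.mem_product, Finset.mem_union, Prod.fst_sub,
        Prod.snd_sub] at hm ⊢
      tauto
    have h1 := (Finset.card_le_card hsub).trans (Finset.card_union_le _ _)
    rw [Finset.card_product, Finset.card_product, hcardI] at h1
    have h2 := hone l.1
    have h3 := hone l.2
    have hN : (0 : ℤ) ≤ N := Int.natCast_nonneg N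
    zify at h1
    nlinarith
  -- The symmetric difference of s and s + l consists of the points of s outside s + l and the
  -- translate by l of the points of s outside s - l.
  have hsum := (hasSum_indicator_sq (s.filter (fun m => m - l ∉ s))).add
    ((Equiv.subRight l).hasSum_iff.2 (hasSum_indicator_sq (s.filter (fun m => m - -l ∉ s))))
  have h1 : indicatorDefect s l ≤ (s.filter (fun m => m - l ∉ s)).card +
      (s.filter (fun m => m - -l ∉ s)).card := by
    refine hasSum_le (fun m => ?_) (hasSum_indicatorDefect s l) hsum
    simp only [Function.comp, Equiv.subRight_apply, Finset.mem_filter, sub_neg_eq_add,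
      sub_add_cancel]
    by_cases ha : m ∈ s <;> by_cases hb : m - l ∈ s <;> simp [ha, hb]
  refine h1.trans ?_
  have h2 := htwo l
  have h3 := htwo (-l)
  rw [Prod.fst_neg, Prod.snd_neg, abs_neg, abs_neg] at h3
  have h4 : (((s.filter (fun m => m - l ∉ s)).card : ℤ) +
      ((s.filter (fun m => m - -l ∉ s)).card : ℤ)) ≤ 4 * (|l.1| + |l.2|) * N := by linarith
  exact_mod_cast h4

namespace IsFiber

variable {R : ℤ × ℤ → X →ₗ[ℂ] H} {S : ℤ × ℤ → X →ₗ[ℂ] X} {U : ℤ × ℤ → H →ₗ[ℂ] H}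
  {κ : ℤ × ℤ → ℝ} {e : ℤ × ℤ → ℂ} {A : Submodule ℂ X} {E : Submodule ℂ H}

/-- The defect ‖S m g - e m • g‖ is subadditive in m and does not increase under m ↦ -m, because S
is isometric and e is a unimodular character. -/
theorem norm_translate_sub_le_generators (hF : IsFiber R S U κ e A E) (g : X) (m : ℤ × ℤ) :
    ‖S m g - e m • g‖ ≤
      |m.1| * ‖S (1, 0) g - e (1, 0) • g‖ + |m.2| * ‖S (0, 1) g - e (0, 1) • g‖ := by
  have h0 : e 0 = 1 := by
    have h1 := hF.char_add 0 0
    rw [add_zero] at h1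
    have h2 : e 0 ≠ 0 := norm_ne_zero_iff.1 (by rw [hF.norm_char]; exact one_ne_zero)
    exact (mul_eq_left₀ h2).1 h1.symm
  have hzero : ‖S 0 g - e 0 • g‖ = 0 := by
    rw [hF.translate_zero, h0, one_smul, sub_self, norm_zero]
  have hadd : ∀ m k, ‖S (m + k) g - e (m + k) • g‖ ≤ ‖S m g - e m • g‖ + ‖S k g - e k • g‖ := by
    intro m k
    have h1 : S (m + k) g - e (m + k) • g =
        e k • (S m g - e m • g) + S m (S k g - e k • g) := by
      rw [hF.translate_add, map_sub, map_smul, smul_sub, smul_smul, hF.char_add, mul_comm (e k)]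
      abel
    rw [h1]
    refine (norm_add_le _ _).trans_eq ?_
    rw [norm_smul, hF.norm_char, one_mul, hF.norm_translate]
  have hneg : ∀ m, ‖S (-m) g - e (-m) • g‖ ≤ ‖S m g - e m • g‖ := by
    intro m
    have h1 : S (-m) g - e (-m) • g = -(e (-m) • S (-m) (S m g - e m • g)) := by
      rw [map_sub, ← hF.translate_add, map_smul, smul_sub, smul_smul, ← hF.char_add,
        neg_add_cancel, h0, hF.translate_zero, one_smul]
      abel
    rw [h1, norm_neg, norm_smul, hF.norm_char, one_mul, hF.norm_translate]
  have hnat : ∀ (n : ℕ) m, ‖S (n • m) g - e (n • m) • g‖ ≤ n * ‖S m g - e m • g‖ := by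
    intro n m
    induction n with
    | zero => simp [hzero]
    | succ n ih =>
      rw [succ_nsmul]
      refine (hadd _ _).trans ?_
      push_cast
      linarith
  have hint : ∀ (a : ℤ) m, ‖S (a • m) g - e (a • m) • g‖ ≤ |a| * ‖S m g - e m • g‖ := by
    intro a m
    have h1 := hnat a.natAbs m
    rw [← natCast_zsmul, Nat.cast_natAbs, Nat.cast_natAbs, Int.cast_id] at h1
    rcases abs_choice a with h | h
    · rw [h] at h1 ⊢
      exact h1
    · rw [h] at h1 ⊢
      refine le_trans ?_ h1
      have h2 := hneg (-(a • m))
      rw [neg_neg] at h2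
      rwa [neg_smul]
  have hm : m = m.1 • ((1, 0) : ℤ × ℤ) + m.2 • ((0, 1) : ℤ × ℤ) := by ext <;> simp
  conv_lhs => rw [hm]
  exact (hadd _ _).trans (add_le_add (hint _ _) (hint _ _))

/-- If the compressed operator is bounded below on the fibre, then it has no approximate kernel
vectors which are approximate eigenvectors of the translations. -/
theorem exists_forall_eq_zero [A.HasOrthogonalProjection] [E.HasOrthogonalProjection]
    [CompleteSpace H]
    (hF : IsFiber R S U κ e A E) (T : X →L[ℂ] X) (M : H →L[ℂ] H)
    (hTM : ∀ m g, R m (T g) = M (R m g)) {c : ℝ} (hc : 0 < c)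
    (hE : ∀ v ∈ E, c * ‖v‖ ≤ ‖E.orthogonalProjectionOnto (M v)‖) :
    ∃ ε > 0, ∀ g ∈ A, ‖A.orthogonalProjectionOnto (T g)‖ ≤ ε * ‖g‖ →
      ‖S (1, 0) g - e (1, 0) • g‖ ≤ ε * ‖g‖ → ‖S (0, 1) g - e (0, 1) • g‖ ≤ ε * ‖g‖ → g = 0 := by
  by_contra! hcon
  have hpos : ∀ n : ℕ, (0 : ℝ) < 1 / ((n : ℝ) + 1) := fun n => Nat.one_div_pos_of_nat
  choose! g hgA hg1 hg2 hg3 hg0 using hcon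
  set ε : ℕ → ℝ := fun n => 1 / ((n : ℝ) + 1) with hε
  have hε0 : Tendsto ε atTop (𝓝 0) := tendsto_one_div_add_atTop_nhds_zero_nat
  -- For fixed m the normalized defects tend to 0, though not uniformly in m. The uniform bound 4
  -- and the summability of κ allow dominated convergence.
  set r : ℕ → ℤ × ℤ → ℝ := fun n m => ‖S m (g (ε n)) - e m • g (ε n)‖ ^ 2 / ‖g (ε n)‖ ^ 2 with hr
  have hgn : ∀ n, 0 < ‖g (ε n)‖ := fun n => norm_pos_iff.2 (hg0 _ (hpos n))
  have hr0 : ∀ n m, 0 ≤ r n m := fun n m => by positivity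
  have hr1 : ∀ n m, r n m ≤ 4 := fun n m => by
    rw [hr]
    simp only
    rw [div_le_iff₀ (by have := hgn n; positivity)]
    have h1 := pow_le_pow_left₀ (norm_nonneg _)
      (hF.norm_translate_sub_le m (g (ε n)) (hF.norm_char m)) 2
    linarith
  have hr2 : ∀ n m, r n m ≤ ((|m.1| + |m.2|) * ε n) ^ 2 := fun n m => by
    rw [hr]
    simp only
    rw [div_le_iff₀ (by have := hgn n; positivity), ← mul_pow]
    refine pow_le_pow_left₀ (norm_nonneg _)
      ((hF.norm_translate_sub_le_generators _ m).trans ?_) 2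
    have h1 := mul_le_mul_of_nonneg_left (hg2 (ε n) (hpos n))
      (by positivity : (0 : ℝ) ≤ |m.1|)
    have h2 := mul_le_mul_of_nonneg_left (hg3 (ε n) (hpos n))
      (by positivity : (0 : ℝ) ≤ |m.2|)
    calc _ ≤ _ := add_le_add h1 h2
      _ = _ := by ring
  have hlim : Tendsto (fun n => ∑' m, κ m * r n m) atTop (𝓝 (∑' _ : ℤ × ℤ, (0 : ℝ))) := by
    refine tendsto_tsum_of_dominated_convergence (hF.summable.mul_right 4) (fun m => ?_)
      (Eventually.of_forall fun n m => ?_)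
    · rw [← mul_zero (κ m)]
      refine Tendsto.const_mul _ (squeeze_zero (fun n => hr0 n m) (fun n => hr2 n m) ?_)
      have := ((hε0.const_mul ((|m.1| + |m.2| : ℤ) : ℝ)).pow 2)
      simpa using this
    · rw [Real.norm_of_nonneg (mul_nonneg (hF.kappa_nonneg m) (hr0 n m))]
      exact mul_le_mul_of_nonneg_left (hr1 n m) (hF.kappa_nonneg m)
  rw [tsum_zero] at hlim
  have hmain : ∀ n, c ^ 2 ≤ 2 * (2 * ‖M‖ + c) ^ 2 * ((∑' m, κ m) * ∑' m, κ m * r n m) +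
      2 * ((∑' m, κ m) * ((∑' m, κ m) * ε n ^ 2)) := by
    intro n
    have h1 := hF.sq_mul_sq_le T M hTM hc hE (hgA (ε n) (hpos n))
    have h2 : ∑' m, κ m * ‖S m (g (ε n)) - e m • g (ε n)‖ ^ 2 =
        (∑' m, κ m * r n m) * ‖g (ε n)‖ ^ 2 := by
      rw [← tsum_mul_right]
      refine tsum_congr fun m => ?_
      rw [mul_assoc, div_mul_cancel₀]
      have := hgn n
      positivity
    have h3 := pow_le_pow_left₀ (norm_nonneg _) (hg1 (ε n) (hpos n)) 2
    have hK0 : 0 ≤ ∑' m, κ m := tsum_nonneg hF.kappa_nonneg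
    have h4 := mul_le_mul_of_nonneg_left (mul_le_mul_of_nonneg_left
      (mul_le_mul_of_nonneg_left h3 hK0) hK0) zero_le_two
    rw [h2] at h1
    have h5 : 0 < ‖g (ε n)‖ ^ 2 := by have := hgn n; positivity
    refine le_of_mul_le_mul_right (h1.trans ((add_le_add le_rfl h4).trans_eq ?_)) h5
    ring
  have hlim2 := ((hlim.const_mul (∑' m, κ m)).const_mul (2 * (2 * ‖M‖ + c) ^ 2)).add
    ((((hε0.pow 2).const_mul (∑' m, κ m)).const_mul (∑' m, κ m)).const_mul 2)
  have h1 := ge_of_tendsto' hlim2 hmain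
  simp only [mul_zero, add_zero, ne_eq, OfNat.ofNat_ne_zero, not_false_eq_true, zero_pow] at h1
  have : 0 < c ^ 2 := by positivity
  linarith

/-- If the compressed operator is bounded below on the space of families, then it is bounded below
on the fibres. -/
theorem exists_bounded_below_fiber [A.HasOrthogonalProjection] [E.HasOrthogonalProjection]
    [CompleteSpace H]
    (hF : IsFiber R S U κ e A E) (T : X →L[ℂ] X) (M : H →L[ℂ] H)
    (hTM : ∀ m g, R m (T g) = M (R m g))
    (hA : ∃ c > 0, ∀ g : A, c * ‖g‖ ≤ ‖compression A T g‖) :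
    ∃ c > 0, ∀ v : E, c * ‖v‖ ≤ ‖compression E M v‖ := by
  obtain ⟨c, hc, hA⟩ := hA
  set K := ∑' m, κ m with hK
  have hK0 : 0 ≤ K := tsum_nonneg hF.kappa_nonneg
  set C := 16 * ‖M‖ ^ 2 + 2 * c ^ 2 with hC
  -- The squares form a Følner sequence: for each shift the relative boundary is O(1 / N), and it is
  -- at most 2 for all shifts, so dominated convergence applies.
  have hlim : Tendsto (fun N : ℕ => ∑' m, κ m * (indicatorDefect
      (Finset.Ico (0 : ℤ) N ×ˢ Finset.Ico (0 : ℤ) N) m / (N : ℝ) ^ 2)) atTop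
      (𝓝 (∑' _ : ℤ × ℤ, (0 : ℝ))) := by
    have hnn : ∀ (s : Finset (ℤ × ℤ)) m, 0 ≤ indicatorDefect s m := fun s m =>
      tsum_nonneg fun _ => sq_nonneg _
    refine tendsto_tsum_of_dominated_convergence (hF.summable.mul_right 2) (fun m => ?_)
      (Eventually.of_forall fun N m => ?_)
    · rw [← mul_zero (κ m)]
      refine Tendsto.const_mul _ (squeeze_zero (fun N => div_nonneg (hnn _ _) (sq_nonneg _))
        (g := fun N : ℕ => 4 * (|m.1| + |m.2| : ℤ) * (1 / (N : ℝ))) (fun N => ?_) ?_)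
      · rcases Nat.eq_zero_or_pos N with h | h
        · simp [h]
        · have hN : (0 : ℝ) < N := Nat.cast_pos.2 h
          rw [div_le_iff₀ (by positivity)]
          refine (indicatorDefect_square_le N m).trans_eq ?_
          field_simp
          push_cast
          ring
      · simpa using (tendsto_const_div_atTop_nhds_zero_nat (1 : ℝ)).const_mul
          (4 * ((|m.1| + |m.2| : ℤ) : ℝ))
    · rw [Real.norm_of_nonneg (mul_nonneg (hF.kappa_nonneg m)
        (div_nonneg (hnn _ _) (sq_nonneg _)))]
      refine mul_le_mul_of_nonneg_left ?_ (hF.kappa_nonneg m)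
      rcases Nat.eq_zero_or_pos N with h | h
      · simp [h]
      · have hN : (0 : ℝ) < N := Nat.cast_pos.2 h
        rw [div_le_iff₀ (by positivity)]
        refine (indicatorDefect_le _ _).trans_eq ?_
        simp [sq]
  rw [tsum_zero] at hlim
  have hlim2 := (hlim.const_mul K).const_mul C
  rw [mul_zero, mul_zero] at hlim2
  obtain ⟨N, hN1, hN2⟩ := ((hlim2.eventually (gt_mem_nhds (by positivity : 0 < c ^ 2 / 2))).and
    (eventually_gt_atTop 0)).exists
  have hN : (0 : ℝ) < N := Nat.cast_pos.2 hN2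
  set s := Finset.Ico (0 : ℤ) N ×ˢ Finset.Ico (0 : ℤ) N with hs
  have hcard : (s.card : ℝ) = (N : ℝ) ^ 2 := by simp [hs, sq]
  have hD : ∑' m, κ m * indicatorDefect s m =
      (∑' m, κ m * (indicatorDefect s m / (N : ℝ) ^ 2)) * (N : ℝ) ^ 2 := by
    rw [← tsum_mul_right]
    refine tsum_congr fun m => ?_
    field_simp
  -- Absorbing the boundary term, made smaller than c² / 2 * ‖v‖² by the choice of N, leaves c² *
  -- ‖v‖² ≤ 8 * K² * p². The 1 added to K keeps the constant well defined without K > 0.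
  refine ⟨c / (4 * (K + 1)), by positivity, fun v => ?_⟩
  have h1 := hF.card_mul_le T M hTM hc (fun g hg => hA ⟨g, hg⟩) v.2 s
  rw [hcard, hD] at h1
  set p := ‖compression E M v‖ with hp
  change _ ≤ _ + 4 * ((N : ℝ) ^ 2 * K ^ 2) * p ^ 2 at h1
  set d := ∑' m, κ m * (indicatorDefect s m / (N : ℝ) ^ 2)
  have h2 : c ^ 2 * ‖(v : H)‖ ^ 2 ≤ C * (K * d) * ‖(v : H)‖ ^ 2 + 4 * K ^ 2 * p ^ 2 := by
    refine le_of_mul_le_mul_right ?_ (by positivity : 0 < (N : ℝ) ^ 2)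
    linarith
  have h3 : C * (K * d) * ‖(v : H)‖ ^ 2 ≤ c ^ 2 / 2 * ‖(v : H)‖ ^ 2 :=
    mul_le_mul_of_nonneg_right hN1.le (sq_nonneg _)
  have h4 : (c * ‖v‖) ^ 2 ≤ (4 * (K + 1) * p) ^ 2 := by
    have h5 : ‖v‖ = ‖(v : H)‖ := rfl
    rw [h5, mul_pow, mul_pow, mul_pow]
    nlinarith [mul_nonneg hK0 (sq_nonneg p), sq_nonneg p, mul_nonneg (sq_nonneg K) (sq_nonneg p)]
  have h5 := (abs_le_of_sq_le_sq' h4 (by positivity)).2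
  rw [div_mul_eq_mul_div, div_le_iff₀ (by positivity)]
  linarith

end IsFiber

end PlaneLattice

/-! ### Invertibility on the space of families and on its fibres -/

section DirectIntegral

variable {X H : Type*}
  [NormedAddCommGroup X] [InnerProductSpace ℂ X] [NormedAddCommGroup H] [InnerProductSpace ℂ H]

theorem IsFamilySpace.inner_translate {ι : Type*} [AddCommGroup ι]
    {R : ι → X →ₗ[ℂ] H} {S : ι → X →ₗ[ℂ] X} (h : IsFamilySpace R S) (k : ι) (x y : X) :
    inner ℂ (S k x) y = inner ℂ x (S (-k) y) := by
  have h1 := (Equiv.subRight k).hasSum_iff.2 (h.hasSum_inner (S k x) y)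
  refine h1.unique ((h.hasSum_inner x (S (-k) y)).congr_fun fun m => ?_)
  simp [h.translate, sub_eq_add_neg]

/-- Translations have no eigenvectors in a space of square summable families. -/
theorem IsFamilySpace.eq_zero_of_translate_eq_smul {R : ℤ × ℤ → X →ₗ[ℂ] H}
    {S : ℤ × ℤ → X →ₗ[ℂ] X} (h : IsFamilySpace R S) {μ : ℂ} {g : X}
    (hg : S (1, 0) g = μ • g) : g = 0 := by
  by_contra hg0
  have hμ : ‖μ‖ = 1 := by
    have h1 := h.norm_translate (1, 0) g
    rw [hg, norm_smul] at h1
    exact (mul_eq_right₀ (norm_ne_zero_iff.2 hg0)).1 h1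
  -- The norms of the components are constant along each horizontal line of indices, so square
  -- summability forces them to vanish.
  have hstep : ∀ m, ‖R (m + (1, 0)) g‖ = ‖R m g‖ := fun m => by
    rw [← h.translate, hg, map_smul, norm_smul, hμ, one_mul]
  refine hg0 (h.eq_of_forall fun m => ?_)
  have hconst : ∀ n : ℕ, ‖R (m + n • (1, 0)) g‖ = ‖R m g‖ := by
    intro n
    induction n with
    | zero => simp
    | succ n ih => rw [succ_nsmul, ← add_assoc, hstep, ih]
  have hinj : Function.Injective fun n : ℕ => m + n • ((1, 0) : ℤ × ℤ) := by
    intro a b hab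
    simpa using hab
  have hs := (h.hasSum_norm_sq g).summable.comp_injective hinj
  have hs' : Summable fun _ : ℕ => ‖R m g‖ ^ 2 :=
    hs.congr fun n => by simp only [Function.comp, hconst]
  have h2 := (summable_const_iff _).1 hs'
  rw [map_zero]
  simpa using h2

/-- T commutes with the translations since it acts on each component by the same M. The adjoint of a
translation is the opposite translation, which also preserves A, so the projection onto A commutes
with translations as well. -/
theorem IsFamilySpace.compression_translate {ι : Type*} [AddCommGroup ι]
    {R : ι → X →ₗ[ℂ] H} {S : ι → X →ₗ[ℂ] X} (h : IsFamilySpace R S) {A : Submodule ℂ X}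
    [A.HasOrthogonalProjection] (hA : ∀ k, ∀ g ∈ A, S k g ∈ A) {T : X →L[ℂ] X} {M : H →L[ℂ] H}
    (hTM : ∀ m g, R m (T g) = M (R m g)) (k : ι) (g : A) :
    compression A T ((S k).restrict (hA k) g) = (S k).restrict (hA k) (compression A T g) := by
  have hTS : T (S k g) = S k (T g) := h.eq_of_forall fun m => by
    rw [hTM, h.translate, h.translate, hTM]
  refine Subtype.ext ?_
  change A.starProjection (T (S k g)) = S k (A.starProjection (T g))
  rw [hTS]
  refine Submodule.eq_starProjection_of_mem_of_inner_eq_zero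
    (hA k _ (Submodule.coe_mem _)) fun w hw => ?_
  rw [← map_sub, h.inner_translate]
  exact Submodule.starProjection_inner_eq_zero _ _ (hA _ w hw)

variable {R : ℤ × ℤ → X →ₗ[ℂ] H} {S : ℤ × ℤ → X →ₗ[ℂ] X} {U : ℤ × ℤ → H →ₗ[ℂ] H}
  {κ : ℤ × ℤ → ℝ} {A : Submodule ℂ X} {E : ℝ × ℝ → Submodule ℂ H}

/-- If the compressions to all the fibres are bounded below, so is the compression to the space
of families. -/
theorem exists_bounded_below_of_fibers [A.HasOrthogonalProjection]
    [∀ η, (E η).HasOrthogonalProjection] [CompleteSpace H]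
    (hF : ∀ η, IsFiber R S U κ (latticeCharacter η) A (E η)) {T : X →L[ℂ] X} {M : H →L[ℂ] H}
    (hTM : ∀ m g, R m (T g) = M (R m g))
    (hE : ∀ η ∈ Icc (-Real.pi) Real.pi ×ˢ Icc (-Real.pi) Real.pi,
      ∃ c > 0, ∀ v : E η, c * ‖v‖ ≤ ‖compression (E η) M v‖) :
    ∃ c > 0, ∀ g : A, c * ‖g‖ ≤ ‖compression A T g‖ := by
  by_contra! hcon
  have hF0 := hF 0
  set S₁ := (S (1, 0)).restrict (hF0.invariant (1, 0)) with hS₁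
  set S₂ := (S (0, 1)).restrict (hF0.invariant (0, 1)) with hS₂
  have hn₁ : ∀ g, ‖S₁ g‖ = ‖g‖ := fun g => hF0.norm_translate (1, 0) g
  have hn₂ : ∀ g, ‖S₂ g‖ = ‖g‖ := fun g => hF0.norm_translate (0, 1) g
  have hc₁ := hF0.compression_translate hF0.invariant hTM (1, 0)
  have hc₂ := hF0.compression_translate hF0.invariant hTM (0, 1)
  have hcS : ∀ g, S₁ (S₂ g) = S₂ (S₁ g) := fun g => Subtype.ext <| by
    change S (1, 0) (S (0, 1) (g : X)) = S (0, 1) (S (1, 0) (g : X))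
    rw [← hF0.translate_add, ← hF0.translate_add, add_comm]
  obtain ⟨μ₁, hμ₁, h₁⟩ := exists_approximate_eigenvalue (S := S₁)
    (B₁ := (compression A T : A →ₗ[ℂ] A)) (B₂ := 0) hn₁ hc₁ (by simp) fun ε hε => by
      obtain ⟨g, hg⟩ := hcon ε hε
      refine ⟨g, ?_, hg.le, ?_⟩
      · rintro rfl
        simp at hg
      · rw [LinearMap.zero_apply, norm_zero]
        positivity
  -- Second pass: S₁ - μ₁ is included among the operators with approximate kernel, so the new
  -- vectors remain approximate eigenvectors of S₁.
  obtain ⟨μ₂, hμ₂, h₂⟩ := exists_approximate_eigenvalue (S := S₂)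
    (B₁ := (compression A T : A →ₗ[ℂ] A)) (B₂ := S₁ - μ₁ • LinearMap.id) hn₂ hc₂
    (fun g => by simp [hcS]) fun ε hε => by
      obtain ⟨g, hg0, hg1, -, hg2⟩ := h₁ ε hε
      exact ⟨g, hg0, hg1, by simpa using hg2⟩
  obtain ⟨η, hη, he₁, he₂⟩ := exists_latticeCharacter hμ₁ hμ₂
  obtain ⟨c, hc, hEη⟩ := hE η hη
  obtain ⟨ε, hε, hfin⟩ := (hF η).exists_forall_eq_zero T M hTM hc fun v hv => hEη ⟨v, hv⟩
  obtain ⟨g, hg0, hg1, hg2, hg3⟩ := h₂ ε hε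
  refine hg0 (Subtype.ext (hfin g g.2 hg1 ?_ ?_))
  · rw [he₁]
    exact hg2
  · rw [he₂]
    exact hg3

/-- The compression to the space of families is invertible if and only if the compressions to all
the fibres are. -/
theorem isUnit_compression_iff [A.HasOrthogonalProjection]
    [∀ η, (E η).HasOrthogonalProjection] [CompleteSpace H] [CompleteSpace A]
    [∀ η, CompleteSpace (E η)]
    (hF : ∀ η, IsFiber R S U κ (latticeCharacter η) A (E η)) {T T' : X →L[ℂ] X} {M M' : H →L[ℂ] H}
    (hT : ∀ x y, inner ℂ (T x) y = inner ℂ x (T' y))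
    (hM : ∀ x y, inner ℂ (M x) y = inner ℂ x (M' y))
    (hTM : ∀ m g, R m (T g) = M (R m g)) (hTM' : ∀ m g, R m (T' g) = M' (R m g)) :
    IsUnit (compression A T) ↔ ∀ η ∈ Icc (-Real.pi) Real.pi ×ˢ Icc (-Real.pi) Real.pi,
      IsUnit (compression (E η) M) := by
  rw [isUnit_iff_bounded_below (inner_compression hT)]
  simp only [isUnit_iff_bounded_below (inner_compression hM)]
  constructor
  · rintro ⟨h1, h2⟩ η -
    exact ⟨(hF η).exists_bounded_below_fiber T M hTM h1,
      (hF η).exists_bounded_below_fiber T' M' hTM' h2⟩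
  · intro h
    exact ⟨exists_bounded_below_of_fibers hF hTM fun η hη => (h η hη).1,
      exists_bounded_below_of_fibers hF hTM' fun η hη => (h η hη).2⟩

/-- The translation by (1, 0) commutes with the compression and with its adjoint, and it has no
eigenvectors. -/
theorem isFredholm_compression_iff [A.HasOrthogonalProjection] [CompleteSpace A]
    (h : IsFamilySpace R S) (hA : ∀ k, ∀ g ∈ A, S k g ∈ A) {T T' : X →L[ℂ] X} {M M' : H →L[ℂ] H}
    (hT : ∀ x y, inner ℂ (T x) y = inner ℂ x (T' y))
    (hTM : ∀ m g, R m (T g) = M (R m g)) (hTM' : ∀ m g, R m (T' g) = M' (R m g)) :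
    (compression A T).IsFredholm ↔ IsUnit (compression A T) := by
  refine ⟨fun hfr => ?_, isFredholm_of_isUnit⟩
  refine isUnit_of_isFredholm (inner_compression hT) hfr
    (h.compression_translate hA hTM (1, 0)) (h.compression_translate hA hTM' (1, 0))
    fun μ g hg => ?_
  exact Subtype.ext (h.eq_zero_of_translate_eq_smul (congrArg Subtype.val hg))

end DirectIntegral

/-! ### The lattice of Gaussian integers -/

theorem latticePoint_add (m k : ℤ × ℤ) : latticePoint (m + k) = latticePoint m + latticePoint k := by
  simp only [latticePoint, Prod.fst_add, Prod.snd_add]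
  push_cast
  ring

theorem latticePoint_neg (m : ℤ × ℤ) : latticePoint (-m) = -latticePoint m := by
  simp only [latticePoint, Prod.fst_neg, Prod.snd_neg]
  push_cast
  ring

theorem latticePoint_zero : latticePoint 0 = 0 := by simp [latticePoint]

theorem latticePoint_re (m : ℤ × ℤ) : (latticePoint m).re = m.1 := by simp [latticePoint]

theorem latticePoint_im (m : ℤ × ℤ) : (latticePoint m).im = m.2 := by simp [latticePoint]

theorem norm_le_norm_latticePoint (m : ℤ × ℤ) : ‖m‖ ≤ ‖latticePoint m‖ := by
  rw [Prod.norm_def, max_le_iff, Int.norm_eq_abs, Int.norm_eq_abs, ← latticePoint_re,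
    ← latticePoint_im]
  exact ⟨Complex.abs_re_le_norm _, Complex.abs_im_le_norm _⟩

theorem summable_one_add_norm_rpow {b : ℝ} (hb : 2 < b) :
    Summable fun m : ℤ × ℤ => (1 + ‖m‖) ^ (-b) := by
  have h1 : Summable fun m : ℤ × ℤ => ‖m‖ ^ (-b) := by
    rw [← (finTwoArrowEquiv ℤ).summable_iff]
    refine (EisensteinSeries.summable_one_div_norm_rpow hb).congr fun x => ?_
    simp [EisensteinSeries.norm_eq_max_natAbs, Prod.norm_def, Int.norm_eq_abs]
  refine Summable.of_norm_bounded_eventually h1 ?_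
  refine (Set.finite_singleton (0 : ℤ × ℤ)).subset fun m hm => ?_
  by_contra hm0
  refine hm ?_
  have hm1 : 0 < ‖m‖ := norm_pos_iff.2 hm0
  change ‖(1 + ‖m‖) ^ (-b)‖ ≤ ‖m‖ ^ (-b)
  rw [Real.norm_of_nonneg (by positivity)]
  exact Real.rpow_le_rpow_of_nonpos hm1 (by linarith) (by linarith)

/-- From 1 + ‖m‖ ≤ (1 + r) * (1 + ‖z + m‖): decay in z becomes decay in the lattice index, uniformly
for z in a bounded set. -/
theorem one_add_norm_rpow_le {b r : ℝ} (hb : 0 ≤ b) (hr : 0 ≤ r) {z : ℂ} (hz : ‖z‖ ≤ r)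
    (m : ℤ × ℤ) :
    (1 + ‖z + latticePoint m‖) ^ (-b) ≤ (1 + r) ^ b * (1 + ‖m‖) ^ (-b) := by
  have h1 : ‖latticePoint m‖ ≤ ‖z + latticePoint m‖ + ‖z‖ := by
    have := norm_sub_le (z + latticePoint m) z
    rwa [add_sub_cancel_left] at this
  have h2 := norm_le_norm_latticePoint m
  have h3 : 1 + ‖m‖ ≤ (1 + r) * (1 + ‖z + latticePoint m‖) := by
    nlinarith [norm_nonneg (z + latticePoint m)]
  have h4 := Real.rpow_le_rpow (by positivity) h3 hb
  rw [Real.mul_rpow (by positivity) (by positivity)] at h4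
  rw [Real.rpow_neg (by positivity), Real.rpow_neg (by positivity), ← div_eq_mul_inv,
    le_div_iff₀ (by positivity), inv_mul_le_iff₀ (by positivity)]
  linarith

theorem isOpen_unitSquare : IsOpen unitSquare :=
  (isOpen_Ioo.preimage Complex.continuous_re).inter (isOpen_Ioo.preimage Complex.continuous_im)

theorem closure_unitSquare :
    closure unitSquare = {z : ℂ | z.re ∈ Icc (0 : ℝ) 1 ∧ z.im ∈ Icc (0 : ℝ) 1} := by
  have h : unitSquare = Ioo (0 : ℝ) 1 ×ℂ Ioo (0 : ℝ) 1 := rfl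
  rw [h, Complex.closure_reProdIm, closure_Ioo zero_ne_one]
  rfl

theorem isCompact_closure_unitSquare : IsCompact (closure unitSquare) := by
  rw [closure_unitSquare]
  exact isCompact_Icc.reProdIm isCompact_Icc

theorem norm_le_two_of_mem_closure {z : ℂ} (hz : z ∈ closure unitSquare) : ‖z‖ ≤ 2 := by
  rw [closure_unitSquare] at hz
  obtain ⟨⟨h1, h2⟩, h3, h4⟩ := hz
  refine (Complex.norm_le_abs_re_add_abs_im z).trans ?_
  rw [abs_of_nonneg h1, abs_of_nonneg h3]
  linarith

/-- The lattice index of the half-open square which contains a point. -/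
noncomputable def latticeFloor (z : ℂ) : ℤ × ℤ := (⌊z.re⌋, ⌊z.im⌋)

theorem sub_latticeFloor_mem (z : ℂ) : z - latticePoint (latticeFloor z) ∈ closure unitSquare := by
  rw [closure_unitSquare]
  simp only [mem_ofPred_eq, Complex.sub_re, Complex.sub_im, latticePoint_re, latticePoint_im,
    latticeFloor]
  exact ⟨⟨Int.fract_nonneg _, (Int.fract_lt_one _).le⟩, Int.fract_nonneg _, (Int.fract_lt_one _).le⟩

theorem sub_latticePoint_notMem {z : ℂ} (hz : z ∈ unitSquare) {m : ℤ × ℤ} (hm : m ≠ 0) :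
    z - latticePoint m ∉ closure unitSquare := by
  rw [closure_unitSquare]
  rintro ⟨⟨h1, h2⟩, h3, h4⟩
  obtain ⟨⟨h5, h6⟩, h7, h8⟩ := hz
  rw [Complex.sub_re, latticePoint_re] at h1 h2
  rw [Complex.sub_im, latticePoint_im] at h3 h4
  refine hm (Prod.ext ?_ ?_)
  · have a1 : (m.1 : ℝ) < 1 := by linarith
    have a2 : (-1 : ℝ) < m.1 := by linarith
    have b1 : m.1 < 1 := by exact_mod_cast a1
    have b2 : -1 < m.1 := by exact_mod_cast a2
    simp only [Prod.fst_zero]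
    omega
  · have a1 : (m.2 : ℝ) < 1 := by linarith
    have a2 : (-1 : ℝ) < m.2 := by linarith
    have b1 : m.2 < 1 := by exact_mod_cast a1
    have b2 : -1 < m.2 := by exact_mod_cast a2
    simp only [Prod.snd_zero]
    omega

theorem apply_add_latticePoint {φ : ℂ → ℂ} (h1 : ∀ z, φ (z + 1) = φ z)
    (hI : ∀ z, φ (z + Complex.I) = φ z) (z : ℂ) (m : ℤ × ℤ) : φ (z + latticePoint m) = φ z := by
  have h1' : Function.Periodic φ 1 := h1
  have hI' : Function.Periodic φ Complex.I := hI
  have := (h1'.int_mul m.1).add_period (hI'.int_mul m.2)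
  rw [latticePoint]
  simpa using this z

theorem finite_setOf_norm_le (c : ℝ) : {m : ℤ × ℤ | ‖m‖ ≤ c}.Finite := by
  have : {m : ℤ × ℤ | ‖m‖ ≤ c} = Metric.closedBall 0 c := by ext; simp
  rw [this]
  exact isCompact_iff_finite.1 (isCompact_closedBall _ _)

/-! ### The holomorphic partition of unity -/

/-- A locally uniformly convergent sum over the lattice of translates of a decaying holomorphic
function. -/
theorem differentiableOn_tsum_translates {Ω : Set ℂ} (hΩ : IsOpen Ω)
    {g : ℤ × ℤ → ℂ → ℂ} (hg : ∀ m, DifferentiableOn ℂ (g m) Ω) {b : ℝ} (hb : 2 < b)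
    {C : ℂ → ℝ} (hC : ∀ z₀ ∈ Ω, ∃ r > 0, ∀ z ∈ Ω ∩ Metric.ball z₀ r, ∀ m,
      ‖g m z‖ ≤ C z₀ * (1 + ‖m‖) ^ (-b)) :
    DifferentiableOn ℂ (fun z => ∑' m, g m z) Ω := by
  intro z₀ hz₀
  obtain ⟨r, hr, h⟩ := hC z₀ hz₀
  have hopen : IsOpen (Ω ∩ Metric.ball z₀ r) := hΩ.inter Metric.isOpen_ball
  have := Complex.differentiableOn_tsum_of_summable_norm
    ((summable_one_add_norm_rpow hb).mul_left (C z₀))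
    (fun m => (hg m).mono inter_subset_left) hopen (fun m z hz => h z hz m)
  exact (this.differentiableAt (hopen.mem_nhds ⟨hz₀, Metric.mem_ball_self hr⟩)).differentiableWithinAt

/-- Under condition `(𝒜)` there is a holomorphic partition of unity on the periodic domain formed
by the translates of a single decaying function. -/
theorem ConditionA.exists_partition {Ω : Set ℂ} (hA : ConditionA Ω) (hΩ : IsOpen Ω)
    (htr : ∀ z ∈ Ω, ∀ m, z + latticePoint m ∈ Ω) :
    ∃ (u : ℂ → ℂ) (b C : ℝ), DifferentiableOn ℂ u Ω ∧ 2 < b ∧ 0 ≤ C ∧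
      (∀ z ∈ Ω, ‖u z‖ ≤ C * (1 + ‖z‖) ^ (-b)) ∧
      ∀ z ∈ Ω, HasSum (fun m : ℤ × ℤ => u (z + latticePoint m)) 1 := by
  classical
  obtain ⟨φ, χ, hφ, hφ1, hφI, hφz, hχ, hfin, hPQ, ⟨b, d, hb, hd⟩, hsum⟩ := hA
  have htr' : ∀ z ∈ Ω, ∀ m, z - latticePoint m ∈ Ω := fun z hz m => by
    rw [sub_eq_add_neg, ← latticePoint_neg]
    exact htr z hz _
  set P : Set ℂ := {z | meromorphicOrderAt χ z < 0} with hP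
  set ψ : ℂ → ℂ := φ⁻¹ with hψ
  have hord : ∀ z ∈ closure Ω, meromorphicOrderAt φ z ≤ 0 := fun z hz =>
    not_lt.1 fun h => hφz z h hz
  -- The inverse of a normal form is a normal form, and one of nonnegative order is analytic. So ψ
  -- is analytic also at the poles of φ, without changing any value.
  have hψan : ∀ z ∈ closure Ω, AnalyticAt ℂ ψ z := fun z hz => by
    refine (hφ (mem_univ z)).inv.meromorphicOrderAt_nonneg_iff_analyticAt.1 ?_
    rw [meromorphicOrderAt_inv]
    have h1 := hord z hz
    revert h1
    induction meromorphicOrderAt φ z with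
    | top => simp
    | coe n =>
      intro h1
      have : n ≤ 0 := by exact_mod_cast h1
      have h2 : 0 ≤ -n := by omega
      exact_mod_cast h2
  have hψper : ∀ z m, ψ (z + latticePoint m) = ψ z := fun z m => by
    simp only [hψ, Pi.inv_apply, apply_add_latticePoint hφ1 hφI]
  have hφper : ∀ z m, φ (z + latticePoint m) = φ z := apply_add_latticePoint hφ1 hφI
  -- By periodicity it suffices to bound ψ on the compact set where the closed square meets the
  -- closure of Ω.
  obtain ⟨c, hc0, hc⟩ : ∃ c, 0 ≤ c ∧ ∀ z ∈ Ω, ‖ψ z‖ ≤ c := by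
    obtain ⟨c, hc⟩ := (isCompact_closure_unitSquare.inter_left
      (isClosed_closure (s := Ω))).exists_bound_of_continuousOn (f := ψ)
      fun z hz => (hψan z hz.1).continuousAt.continuousWithinAt
    refine ⟨max c 0, le_max_right _ _, fun z hz => ?_⟩
    have h1 := hc (z - latticePoint (latticeFloor z))
      ⟨subset_closure (htr' z hz _), sub_latticeFloor_mem z⟩
    rw [← hψper _ (latticeFloor z), sub_add_cancel] at h1
    exact h1.trans (le_max_left _ _)
  have hχan : ∀ z ∉ P, AnalyticAt ℂ χ z := fun z hz =>
    (hχ (mem_univ z)).meromorphicOrderAt_nonneg_iff_analyticAt.1 (not_lt.1 hz)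
  set D := max d 0 with hD
  have hD0 : 0 ≤ D := le_max_right _ _
  have hχD : ∀ z ∈ Ω, z ∉ closure unitSquare → ‖χ z‖ ≤ D * (1 + ‖z‖) ^ (-b) := by
    intro z hz hz'
    have h1 := (hd z ⟨hz, hz'⟩).trans (le_max_left d 0)
    rw [Real.rpow_neg (by positivity), ← div_eq_mul_inv, le_div_iff₀ (by positivity)]
    linarith
  have hPcl : IsClosed P := hfin.isClosed
  -- the sum of the terms of nonzero index
  set γ : ℤ × ℤ → ℂ → ℂ := fun m z => if m = 0 then 0 else χ (z - latticePoint m) with hγ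
  set G : ℂ → ℂ := fun z => ∑' m, γ m z with hG
  have hΩQ : IsOpen (Ω ∩ unitSquare) := hΩ.inter isOpen_unitSquare
  have hγbd : ∀ z ∈ Ω ∩ unitSquare, ∀ m, ‖γ m z‖ ≤ D * (1 + 2) ^ b * (1 + ‖m‖) ^ (-b) := by
    intro z hz m
    by_cases hm : m = 0
    · simp only [hγ, if_pos hm, norm_zero]
      positivity
    · simp only [hγ, if_neg hm]
      refine (hχD _ (htr' z hz.1 m) (sub_latticePoint_notMem hz.2 hm)).trans ?_
      have h1 := one_add_norm_rpow_le (b := b) (by linarith) zero_le_two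
        (norm_le_two_of_mem_closure (subset_closure hz.2)) (-m)
      rw [latticePoint_neg, ← sub_eq_add_neg, norm_neg] at h1
      rw [mul_assoc]
      exact mul_le_mul_of_nonneg_left h1 hD0
  have hγP : ∀ z ∈ unitSquare, ∀ m ≠ 0, z - latticePoint m ∉ P := fun z hz m hm h =>
    sub_latticePoint_notMem hz hm (subset_closure (hPQ h))
  have hGd : DifferentiableOn ℂ G (Ω ∩ unitSquare) := by
    refine differentiableOn_tsum_translates hΩQ (fun m => ?_) hb
      (C := fun _ => D * (1 + 2) ^ b) fun z₀ _ => ⟨1, one_pos, fun z hz m => hγbd z hz.1 m⟩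
    by_cases hm : m = 0
    · simp only [hγ, if_pos hm]
      exact differentiableOn_const 0
    · simp only [hγ, if_neg hm]
      intro z hz
      exact ((hχan _ (hγP z hz.2 m hm)).differentiableAt.comp z
        (differentiableAt_id.sub_const _)).differentiableWithinAt
  -- In the square φ = χ + G away from the poles, so χ * ψ = 1 - ψ * G there. The right side has no
  -- singularity at the poles of χ, all of which lie in the square.
  set u : ℂ → ℂ := fun z => if z ∈ unitSquare then 1 - ψ z * G z else χ z * ψ z with hu
  have hφne : ∀ z ∈ Ω, ∀ᶠ w in 𝓝[≠] z, φ w ≠ 0 := fun z hz => by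
    refine (meromorphicOrderAt_ne_top_iff_eventually_ne_zero (hφ (mem_univ z)).meromorphicAt).1 ?_
    exact ((hord z (subset_closure hz)).trans_lt (WithTop.coe_lt_top 0)).ne
  have hψd : DifferentiableOn ℂ ψ Ω := fun z hz =>
    (hψan z (subset_closure hz)).differentiableAt.differentiableWithinAt
  have hueq : ∀ z ∈ Ω, z ∉ P → u z = χ z * ψ z := by
    intro z hz hzP
    by_cases hzQ : z ∈ unitSquare
    · simp only [hu, if_pos hzQ]
      have hnhds : Ω ∩ unitSquare ∈ 𝓝 z := hΩQ.mem_nhds ⟨hz, hzQ⟩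
      have hψz := (hψan z (subset_closure hz)).continuousAt
      have hc1 : ContinuousAt (fun w => 1 - ψ w * G w) z :=
        continuousAt_const.sub (hψz.mul (hGd.differentiableAt hnhds).continuousAt)
      have hc2 : ContinuousAt (fun w => χ w * ψ w) z := (hχan z hzP).continuousAt.mul hψz
      refine ((hc1.eventuallyEq_nhds_iff_eventuallyEq_nhdsNE hc2).1 ?_).eq_of_nhds
      filter_upwards [hφne z hz, mem_nhdsWithin_of_mem_nhds hnhds,
        mem_nhdsWithin_of_mem_nhds (hPcl.isOpen_compl.mem_nhds hzP)] with w hw1 hw2 hw3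
      have h1 : HasSum (fun m : ℤ × ℤ => χ (w - latticePoint m)) (φ w) := by
        refine hsum w hw2.1 fun m => not_lt.1 fun h => ?_
        by_cases hm : m = 0
        · rw [hm, latticePoint_zero, sub_zero] at h
          exact hw3 h
        · exact hγP w hw2.2 m hm h
      have h2 : G w = φ w - χ w := by
        refine HasSum.tsum_eq ?_
        have h3 := h1.update 0 0
        rw [latticePoint_zero, sub_zero, zero_sub, neg_add_eq_sub] at h3
        refine h3.congr_fun fun m => ?_
        by_cases hm : m = 0
        · simp [hγ, hm]
        · simp [hγ, hm]
      have h3 : ψ w * φ w = 1 := inv_mul_cancel₀ hw1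
      rw [h2, mul_sub, h3]
      ring
    · simp only [hu, if_neg hzQ]
  have hud : DifferentiableOn ℂ u Ω := by
    intro z hz
    refine DifferentiableAt.differentiableWithinAt ?_
    by_cases hzQ : z ∈ unitSquare
    · have hnhds : Ω ∩ unitSquare ∈ 𝓝 z := hΩQ.mem_nhds ⟨hz, hzQ⟩
      have h1 : DifferentiableAt ℂ (fun w => 1 - ψ w * G w) z :=
        (differentiableAt_const 1).sub ((hψan z (subset_closure hz)).differentiableAt.mul
          (hGd.differentiableAt hnhds))
      refine h1.congr_of_eventuallyEq ?_
      filter_upwards [hnhds] with w hw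
      simp only [hu, if_pos hw.2]
    · have hzP : z ∉ P := fun h => hzQ (hPQ h)
      have h1 : DifferentiableAt ℂ (fun w => χ w * ψ w) z :=
        (hχan z hzP).differentiableAt.mul (hψan z (subset_closure hz)).differentiableAt
      refine h1.congr_of_eventuallyEq ?_
      filter_upwards [(hΩ.inter hPcl.isOpen_compl).mem_nhds ⟨hz, hzP⟩] with w hw
      exact hueq w hw.1 hw.2
  have hsumb := (summable_one_add_norm_rpow hb).mul_left (D * (1 + 2) ^ b)
  set B := ∑' m : ℤ × ℤ, D * (1 + 2) ^ b * (1 + ‖m‖) ^ (-b) with hB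
  have hB0 : 0 ≤ B := tsum_nonneg fun m => by positivity
  have hubd1 : ∀ z ∈ Ω ∩ unitSquare, ‖u z‖ ≤ 1 + c * B := by
    intro z hz
    simp only [hu, if_pos hz.2]
    refine (norm_sub_le _ _).trans ?_
    rw [norm_one, norm_mul]
    have h1 : ‖G z‖ ≤ B := tsum_of_norm_bounded hsumb.hasSum (hγbd z hz)
    have := mul_le_mul (hc z hz.1) h1 (norm_nonneg _) hc0
    linarith
  -- The decay of χ is assumed only off the closed square, so the points of Ω on its boundary
  -- inherit the interior bound by continuity.
  have hubd2 : ∀ z ∈ Ω, z ∈ closure unitSquare → ‖u z‖ ≤ 1 + c * B := by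
    intro z hz hzQ
    have h1 : z ∈ closure (Ω ∩ unitSquare) := hΩ.inter_closure ⟨hz, hzQ⟩
    have h2 : ContinuousWithinAt u (Ω ∩ unitSquare) z :=
      (hud.continuousOn z hz).mono inter_subset_left
    have h3 : u '' (Ω ∩ unitSquare) ⊆ Metric.closedBall 0 (1 + c * B) := by
      rintro _ ⟨w, hw, rfl⟩
      rw [mem_closedBall_zero_iff]
      exact hubd1 w hw
    have h4 := closure_minimal h3 Metric.isClosed_closedBall (h2.mem_closure_image h1)
    rwa [mem_closedBall_zero_iff] at h4
  set C := (1 + c * B) * (1 + 2) ^ b + D * c with hC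
  have hC0 : 0 ≤ C := by positivity
  have hubd : ∀ z ∈ Ω, ‖u z‖ ≤ C * (1 + ‖z‖) ^ (-b) := by
    intro z hz
    have hp : 0 ≤ (1 + ‖z‖) ^ (-b) := by positivity
    by_cases hzQ : z ∈ closure unitSquare
    · refine (hubd2 z hz hzQ).trans ?_
      have h1 := one_add_norm_rpow_le (b := b) (by linarith) zero_le_two
        (norm_le_two_of_mem_closure hzQ) 0
      have h2 : 1 ≤ (1 + 2) ^ b * (1 + ‖z‖) ^ (-b) := by
        rw [Real.rpow_neg (by positivity), ← div_eq_mul_inv, le_div_iff₀ (by positivity), one_mul]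
        exact Real.rpow_le_rpow (by positivity)
          (by linarith [norm_le_two_of_mem_closure hzQ]) (by linarith)
      have h3 : 0 ≤ 1 + c * B := by positivity
      have h4 := mul_le_mul_of_nonneg_left h2 h3
      have h5 : 0 ≤ D * c * (1 + ‖z‖) ^ (-b) := by positivity
      rw [hC, add_mul]
      linarith
    · have hzP : z ∉ P := fun h => hzQ (subset_closure (hPQ h))
      rw [hueq z hz hzP, norm_mul]
      have h1 := mul_le_mul (hχD z hz hzQ) (hc z hz) (norm_nonneg _) (by positivity)
      have h2 : 0 ≤ (1 + c * B) * (1 + 2) ^ b * (1 + ‖z‖) ^ (-b) := by positivity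
      rw [hC, add_mul]
      linarith
  refine ⟨u, b, C, hud, hb, hC0, hubd, ?_⟩
  -- the translates sum up to one
  have hbd : ∀ z₀ ∈ Ω, ∀ z ∈ Ω ∩ Metric.ball z₀ 1, ∀ m,
      ‖u (z + latticePoint m)‖ ≤ C * (1 + (‖z₀‖ + 1)) ^ b * (1 + ‖m‖) ^ (-b) := by
    intro z₀ _ z hz m
    have hzn : ‖z‖ ≤ ‖z₀‖ + 1 := by
      have h1 := Metric.mem_ball.1 hz.2
      rw [dist_eq_norm] at h1
      linarith [norm_le_norm_add_norm_sub' z z₀]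
    refine (hubd _ (htr z hz.1 m)).trans ?_
    rw [mul_assoc]
    exact mul_le_mul_of_nonneg_left (one_add_norm_rpow_le (by linarith) (by positivity) hzn m) hC0
  set v : ℂ → ℂ := fun z => ∑' m, u (z + latticePoint m) with hv
  have hvd : DifferentiableOn ℂ v Ω := by
    refine differentiableOn_tsum_translates hΩ (fun m => ?_) hb
      (C := fun z₀ => C * (1 + (‖z₀‖ + 1)) ^ b) fun z₀ hz₀ => ⟨1, one_pos, hbd z₀ hz₀⟩
    exact hud.comp (differentiableOn_id.add_const _) fun z hz => htr z hz m
  intro z₀ hz₀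
  have hsm : Summable fun m => u (z₀ + latticePoint m) :=
    Summable.of_norm_bounded ((summable_one_add_norm_rpow hb).mul_left _)
      (hbd z₀ hz₀ z₀ ⟨hz₀, Metric.mem_ball_self one_pos⟩)
  suffices h : v z₀ = 1 by
    rw [← h]
    exact hsm.hasSum
  -- For z within 1 of z₀ and a pole z + m, which has norm at most 2, the index satisfies ‖m‖ ≤ ‖z₀‖
  -- + 3. So only finitely many points have to be avoided.
  have hnp : ∀ᶠ z in 𝓝[≠] z₀, ∀ m, z + latticePoint m ∉ P := by
    set F : Set ℂ := (fun q : ℂ × (ℤ × ℤ) => q.1 - latticePoint q.2) ''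
      (P ×ˢ {m : ℤ × ℤ | ‖m‖ ≤ ‖z₀‖ + 3}) with hF
    have hFfin : F.Finite := (hfin.prod (finite_setOf_norm_le _)).image _
    have h1 : (F \ {z₀})ᶜ ∈ 𝓝 z₀ :=
      (hFfin.subset sdiff_subset).isClosed.isOpen_compl.mem_nhds fun h => h.2 rfl
    filter_upwards [mem_nhdsWithin_of_mem_nhds h1, self_mem_nhdsWithin,
      mem_nhdsWithin_of_mem_nhds (Metric.ball_mem_nhds z₀ one_pos)] with z hz1 hz2 hz3 m hm
    refine hz1 ⟨⟨(z + latticePoint m, m), ⟨hm, ?_⟩, add_sub_cancel_right _ _⟩, hz2⟩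
    have h2 := norm_le_two_of_mem_closure (subset_closure (hPQ hm))
    have h3 := norm_le_norm_latticePoint m
    have h4 := Metric.mem_ball.1 hz3
    rw [dist_eq_norm] at h4
    have h5 := norm_le_norm_add_norm_sub' z z₀
    have h6 := norm_sub_le (z + latticePoint m) z
    rw [add_sub_cancel_left] at h6
    simp only [mem_ofPred_eq]
    linarith
  have hvc := (hvd.differentiableAt (hΩ.mem_nhds hz₀)).continuousAt
  -- The identity v = 1 holds in a punctured neighbourhood, where no term has a pole and φ does not
  -- vanish; continuity gives it at z₀.
  refine ((hvc.eventuallyEq_nhds_iff_eventuallyEq_nhdsNE continuousAt_const).1 ?_).eq_of_nhds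
  filter_upwards [hφne z₀ hz₀, hnp, mem_nhdsWithin_of_mem_nhds (hΩ.mem_nhds hz₀)]
    with z hz1 hz2 hz3
  have h1 : HasSum (fun m : ℤ × ℤ => χ (z - latticePoint m)) (φ z) := by
    refine hsum z hz3 fun m => not_lt.1 fun h => hz2 (-m) ?_
    rw [latticePoint_neg, ← sub_eq_add_neg]
    exact h
  have h2 := ((Equiv.neg (ℤ × ℤ)).hasSum_iff.2 h1).mul_right (ψ z)
  rw [show φ z * ψ z = 1 from mul_inv_cancel₀ hz1] at h2
  refine HasSum.tsum_eq (h2.congr_fun fun m => ?_)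
  rw [hueq _ (htr z hz3 m) (hz2 m), hψper]
  simp [latticePoint_neg]

/-! ### Geometry of the periodic domain -/

theorem mem_cellTranslate {ϖ : Set ℂ} {m : ℤ × ℤ} {z : ℂ} :
    z ∈ cellTranslate ϖ m ↔ z - latticePoint m ∈ ϖ := by
  constructor
  · rintro ⟨w, hw, rfl⟩
    simpa using hw
  · exact fun h => ⟨_, h, sub_add_cancel _ _⟩

theorem preimage_cellTranslate (ϖ : Set ℂ) (m k : ℤ × ℤ) :
    (· + latticePoint k) ⁻¹' cellTranslate ϖ m = cellTranslate ϖ (m - k) := by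
  ext z
  rw [mem_preimage, mem_cellTranslate, mem_cellTranslate, sub_eq_add_neg m, latticePoint_add,
    latticePoint_neg]
  ring_nf

theorem preimage_periodicDomain (ϖ : Set ℂ) (k : ℤ × ℤ) :
    (· + latticePoint k) ⁻¹' periodicDomain ϖ = periodicDomain ϖ := by
  have h1 : ∀ s : Set ℂ, (· + latticePoint k) ⁻¹' s = Homeomorph.addRight (latticePoint k) ⁻¹' s :=
    fun _ => rfl
  rw [periodicDomain, h1, Homeomorph.preimage_interior, preimage_iUnion]
  congr 1
  have h2 : ∀ m, Homeomorph.addRight (latticePoint k) ⁻¹' closure (cellTranslate ϖ m) =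
      closure (cellTranslate ϖ (m - k)) := fun m => by
    rw [Homeomorph.preimage_closure, ← h1, preimage_cellTranslate]
  simp only [h2]
  exact (Equiv.subRight k).iSup_comp (g := fun m => closure (cellTranslate ϖ m))

theorem add_latticePoint_mem_iff {ϖ : Set ℂ} {z : ℂ} {k : ℤ × ℤ} :
    z + latticePoint k ∈ periodicDomain ϖ ↔ z ∈ periodicDomain ϖ := by
  conv_rhs => rw [← preimage_periodicDomain ϖ k]
  rfl

theorem sub_latticePoint_mem_iff {ϖ : Set ℂ} {z : ℂ} {k : ℤ × ℤ} :
    z - latticePoint k ∈ periodicDomain ϖ ↔ z ∈ periodicDomain ϖ := by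
  rw [← add_latticePoint_mem_iff (k := k), sub_add_cancel]

theorem isOpen_cellTranslate {ϖ : Set ℂ} (h : IsOpen ϖ) (m : ℤ × ℤ) :
    IsOpen (cellTranslate ϖ m) :=
  (Homeomorph.addRight (latticePoint m)).isOpenMap ϖ h

namespace IsPeriodicCell

variable {ϖ : Set ℂ}

theorem cellTranslate_subset (h : IsPeriodicCell ϖ) (m : ℤ × ℤ) : cellTranslate ϖ m ⊆ periodicDomain ϖ := by
  rintro _ ⟨w, hw, rfl⟩
  exact add_latticePoint_mem_iff.2 (h.subset_periodicDomain hw)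

theorem pairwise_disjoint (h : IsPeriodicCell ϖ) :
    Pairwise (Function.onFun Disjoint (cellTranslate ϖ)) := by
  intro m k hmk
  refine Set.disjoint_left.2 fun z hz hz' => ?_
  rw [mem_cellTranslate] at hz hz'
  have h1 := sub_latticePoint_notMem (h.subset_unitSquare hz) (sub_ne_zero.2 hmk.symm)
  refine h1 (subset_closure (h.subset_unitSquare ?_))
  rw [sub_eq_add_neg k m, latticePoint_add, latticePoint_neg]
  convert hz' using 1
  ring

theorem latticeFloor_add (h : IsPeriodicCell ϖ) {z : ℂ} (hz : z ∈ ϖ) (m : ℤ × ℤ) :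
    latticeFloor (z + latticePoint m) = m := by
  obtain ⟨⟨h1, h2⟩, h3, h4⟩ := h.subset_unitSquare hz
  refine Prod.ext ?_ ?_
  · simp only [latticeFloor, Complex.add_re, latticePoint_re, Int.floor_add_intCast]
    rw [Int.floor_eq_zero_iff.2 ⟨h1.le, h2⟩, zero_add]
  · simp only [latticeFloor, Complex.add_im, latticePoint_im, Int.floor_add_intCast]
    rw [Int.floor_eq_zero_iff.2 ⟨h3.le, h4⟩, zero_add]

/-- In the open square no other translate of the closed cell is present, and the boundary of the
square belongs to the closure of ϖ by assumption. Hence a function holomorphic near cl(ϖ) ∩ Ω is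
analytic at every point of Ω in the closed square. -/
theorem mem_closure_of_mem (h : IsPeriodicCell ϖ) {z : ℂ}
    (hz : z ∈ periodicDomain ϖ) (hzQ : z ∈ closure unitSquare) : z ∈ closure ϖ := by
  by_cases hQ : z ∈ unitSquare
  · obtain ⟨m, hm⟩ := mem_iUnion.1 (interior_subset hz)
    have h1 : z - latticePoint m ∈ closure ϖ := by
      have h2 : closure (cellTranslate ϖ m) =
          (Homeomorph.addRight (latticePoint m)) '' closure ϖ :=
        (Homeomorph.image_closure (Homeomorph.addRight (latticePoint m)) ϖ).symm
      rw [h2] at hm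
      obtain ⟨w, hw, rfl⟩ := hm
      simpa using hw
    by_cases hm0 : m = 0
    · simpa [hm0, latticePoint_zero] using h1
    · exact absurd (closure_mono h.subset_unitSquare h1) (sub_latticePoint_notMem hQ hm0)
  · refine frontier_subset_closure (h.frontier_subset ⟨hzQ, ?_⟩)
    rwa [isOpen_unitSquare.interior_eq]

end IsPeriodicCell

/-! ### Quasiperiodic extension -/

/-- The end points are included so that the identity theorem also applies at the corners of the
square, where no boundary condition is imposed. -/
theorem frequently_mem_Ioo {y₀ : ℝ} (hy : y₀ ∈ Icc (0 : ℝ) 1) :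
    ∃ᶠ y in 𝓝[≠] y₀, y ∈ Ioo (0 : ℝ) 1 := by
  rcases eq_or_lt_of_le hy.2 with h | h
  · subst h
    refine Frequently.filter_mono ?_ (nhdsLT_le_nhdsNE (1 : ℝ))
    exact Eventually.frequently (Ioo_mem_nhdsLT one_pos)
  · refine Frequently.filter_mono ?_ (nhdsGT_le_nhdsNE y₀)
    refine Eventually.frequently ?_
    filter_upwards [Ioo_mem_nhdsGT h] with y hy'
    exact ⟨hy.1.trans_lt hy'.1, hy'.2⟩

/-- A quasiperiodicity relation on an edge extends to a neighbourhood. -/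
theorem eventually_quasiperiodic {Ω : Set ℂ} (hΩ : IsOpen Ω) {F : ℂ → ℂ} {p : ℝ → ℂ} {t c : ℂ}
    (hp : Continuous p) (hpi : Function.Injective p) {y₀ : ℝ} (hy : y₀ ∈ Icc (0 : ℝ) 1)
    (hpΩ : p y₀ ∈ Ω) (h1 : AnalyticAt ℂ F (p y₀)) (h2 : AnalyticAt ℂ F (p y₀ + t))
    (hq : ∀ y ∈ Ioo (0 : ℝ) 1, p y ∈ Ω → F (p y + t) = c * F (p y)) :
    ∀ᶠ z in 𝓝 (p y₀), F (z + t) = c * F z := by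
  have h3 : AnalyticAt ℂ (fun z => F (z + t)) (p y₀) :=
    h2.comp_of_eq (analyticAt_id.add analyticAt_const) rfl
  have h4 : AnalyticAt ℂ (fun z => c * F z) (p y₀) := analyticAt_const.mul h1
  refine (h3.frequently_eq_iff_eventually_eq h4).1 ?_
  have ht : Tendsto p (𝓝[≠] y₀) (𝓝[≠] (p y₀)) :=
    tendsto_nhdsWithin_of_tendsto_nhds_of_eventually_within _
      (hp.continuousAt.tendsto.mono_left nhdsWithin_le_nhds)
      (eventually_nhdsWithin_of_forall fun y hy' h => hy' (hpi h))
  refine ht.frequently ?_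
  have h5 : ∀ᶠ y in 𝓝[≠] y₀, p y ∈ Ω :=
    (hp.continuousAt.tendsto.mono_left nhdsWithin_le_nhds).eventually (hΩ.mem_nhds hpΩ)
  exact ((frequently_mem_Ioo hy).and_eventually h5).mono fun y hy' => hq y hy'.1 hy'.2

theorem latticeCharacter_one_zero (η : ℝ × ℝ) :
    latticeCharacter η (1, 0) = Complex.exp (Complex.I * η.1) := by simp [latticeCharacter]

theorem latticeCharacter_zero_one (η : ℝ × ℝ) :
    latticeCharacter η (0, 1) = Complex.exp (Complex.I * η.2) := by simp [latticeCharacter]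

theorem latticePoint_one_zero : latticePoint (1, 0) = 1 := by simp [latticePoint]

theorem latticePoint_zero_one : latticePoint (0, 1) = Complex.I := by simp [latticePoint]

/-- The extension of a function from the cell to the plane with the given quasiperiodicity. -/
noncomputable def quasiperiodicExtension (η : ℝ × ℝ) (F : ℂ → ℂ) (z : ℂ) : ℂ :=
  latticeCharacter η (latticeFloor z) * F (z - latticePoint (latticeFloor z))

/-- The quasiperiodic extension of a function which is holomorphic near the closed cell and
satisfies the quasiperiodic boundary conditions is holomorphic. -/
theorem IsPeriodicCell.differentiableOn_quasiperiodicExtension {ϖ : Set ℂ} (h : IsPeriodicCell ϖ)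
    {η : ℝ × ℝ} {U : Set ℂ} {F : ℂ → ℂ} (hU : IsOpen U)
    (hsU : closure ϖ ∩ periodicDomain ϖ ⊆ U) (hF : DifferentiableOn ℂ F U)
    (hq : IsQuasiperiodic (periodicDomain ϖ) η F) :
    DifferentiableOn ℂ (quasiperiodicExtension η F) (periodicDomain ϖ) := by
  set Ω := periodicDomain ϖ with hΩdef
  have hΩ : IsOpen Ω := isOpen_periodicDomain ϖ
  have han : ∀ z ∈ Ω, z ∈ closure unitSquare → AnalyticAt ℂ F z := fun z hz hzQ =>
    hF.analyticAt (hU.mem_nhds (hsU ⟨h.mem_closure_of_mem hz hzQ, hz⟩))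
  set g : ℤ × ℤ → ℂ → ℂ := fun k z => latticeCharacter η k * F (z - latticePoint k) with hg
  -- compatibility of neighbouring pieces
  have hstep : ∀ (z₀ : ℂ) (k j : ℤ × ℤ),
      (∀ᶠ z in 𝓝 (z₀ - latticePoint (k + j)),
        F (z + latticePoint j) = latticeCharacter η j * F z) →
      ∀ᶠ z in 𝓝 z₀, g k z = g (k + j) z := by
    intro z₀ k j hz
    have ht : Tendsto (fun z => z - latticePoint (k + j)) (𝓝 z₀) (𝓝 (z₀ - latticePoint (k + j))) :=
      (continuous_id.sub continuous_const).continuousAt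
    filter_upwards [ht.eventually hz] with z hz'
    have h1 : z - latticePoint (k + j) + latticePoint j = z - latticePoint k := by
      rw [latticePoint_add]; ring
    rw [h1] at hz'
    simp only [hg]
    rw [hz', latticeCharacter_add, mul_assoc]
  have hH : ∀ z₀ ∈ Ω, ∀ k : ℤ × ℤ, z₀ - latticePoint k ∈ closure unitSquare →
      z₀ - latticePoint (k + (1, 0)) ∈ closure unitSquare →
      ∀ᶠ z in 𝓝 z₀, g k z = g (k + (1, 0)) z := by
    intro z₀ hz₀ k hk hk1
    apply hstep
    have ek : z₀ - latticePoint k = z₀ - latticePoint (k + (1, 0)) + 1 := by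
      rw [latticePoint_add, latticePoint_one_zero]; ring
    have a1 := han _ (sub_latticePoint_mem_iff.2 hz₀) hk1
    have a2 := han _ (sub_latticePoint_mem_iff.2 hz₀) hk
    rw [ek] at a2 hk
    have hmem : z₀ - latticePoint (k + (1, 0)) ∈ Ω := sub_latticePoint_mem_iff.2 hz₀
    set w := z₀ - latticePoint (k + (1, 0))
    rw [closure_unitSquare] at hk hk1
    have hre : w.re = 0 := by
      have h1 := hk.1.2
      rw [Complex.add_re, Complex.one_re] at h1
      linarith [hk1.1.1]
    have hw : ((w.im : ℝ) : ℂ) * Complex.I = w := by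
      refine Complex.ext ?_ ?_ <;> simp [hre]
    rw [latticePoint_one_zero, latticeCharacter_one_zero, ← hw]
    rw [← hw] at a1 a2 hmem
    refine eventually_quasiperiodic hΩ (p := fun y : ℝ => (y : ℂ) * Complex.I)
      (by fun_prop) (fun y y' hyy => ?_) hk1.2 hmem a1 a2 fun y hy hyΩ => ?_
    · simpa using hyy
    · rw [add_comm]
      exact hq.1 y hy hyΩ
  have hV : ∀ z₀ ∈ Ω, ∀ k : ℤ × ℤ, z₀ - latticePoint k ∈ closure unitSquare →
      z₀ - latticePoint (k + (0, 1)) ∈ closure unitSquare →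
      ∀ᶠ z in 𝓝 z₀, g k z = g (k + (0, 1)) z := by
    intro z₀ hz₀ k hk hk1
    apply hstep
    have ek : z₀ - latticePoint k = z₀ - latticePoint (k + (0, 1)) + Complex.I := by
      rw [latticePoint_add, latticePoint_zero_one]; ring
    have a1 := han _ (sub_latticePoint_mem_iff.2 hz₀) hk1
    have a2 := han _ (sub_latticePoint_mem_iff.2 hz₀) hk
    rw [ek] at a2 hk
    have hmem : z₀ - latticePoint (k + (0, 1)) ∈ Ω := sub_latticePoint_mem_iff.2 hz₀
    set w := z₀ - latticePoint (k + (0, 1))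
    rw [closure_unitSquare] at hk hk1
    have him : w.im = 0 := by
      have h1 := hk.2.2
      rw [Complex.add_im, Complex.I_im] at h1
      linarith [hk1.2.1]
    have hw : ((w.re : ℝ) : ℂ) = w := by
      refine Complex.ext ?_ ?_ <;> simp [him]
    rw [latticePoint_zero_one, latticeCharacter_zero_one, ← hw]
    rw [← hw] at a1 a2 hmem
    refine eventually_quasiperiodic hΩ (p := fun y : ℝ => (y : ℂ))
      (by fun_prop) (fun y y' hyy => ?_) hk1.1 hmem a1 a2 fun y hy hyΩ => ?_
    · simpa using hyy
    · exact hq.2 y hy hyΩ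
  have hclose : ∀ {z₀ : ℂ} {k l : ℤ × ℤ}, z₀ - latticePoint k ∈ closure unitSquare →
      z₀ - latticePoint l ∈ closure unitSquare →
      (k.1 = l.1 ∨ k.1 = l.1 + 1 ∨ l.1 = k.1 + 1) ∧
        (k.2 = l.2 ∨ k.2 = l.2 + 1 ∨ l.2 = k.2 + 1) := by
    intro z₀ k l hk hl
    rw [closure_unitSquare] at hk hl
    simp only [mem_ofPred_eq, Complex.sub_re, Complex.sub_im, latticePoint_re, latticePoint_im,
      mem_Icc] at hk hl
    obtain ⟨⟨a1, a2⟩, a3, a4⟩ := hk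
    obtain ⟨⟨b1, b2⟩, b3, b4⟩ := hl
    have c1 : (k.1 : ℝ) ≤ l.1 + 1 := by linarith
    have c2 : (l.1 : ℝ) ≤ k.1 + 1 := by linarith
    have c3 : (k.2 : ℝ) ≤ l.2 + 1 := by linarith
    have c4 : (l.2 : ℝ) ≤ k.2 + 1 := by linarith
    have d1 : k.1 ≤ l.1 + 1 := by exact_mod_cast c1
    have d2 : l.1 ≤ k.1 + 1 := by exact_mod_cast c2
    have d3 : k.2 ≤ l.2 + 1 := by exact_mod_cast c3
    have d4 : l.2 ≤ k.2 + 1 := by exact_mod_cast c4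
    omega
  -- Two squares meeting only at a corner are compared through a third one, with index (l.1, k.2),
  -- which shares an edge with each of them.
  have hcompat : ∀ z₀ ∈ Ω, ∀ k l : ℤ × ℤ, z₀ - latticePoint k ∈ closure unitSquare →
      z₀ - latticePoint l ∈ closure unitSquare → ∀ᶠ z in 𝓝 z₀, g k z = g l z := by
    intro z₀ hz₀ k l hk hl
    have hj : z₀ - latticePoint (l.1, k.2) ∈ closure unitSquare := by
      have hk' := hk
      have hl' := hl
      rw [closure_unitSquare] at hk' hl' ⊢
      simp only [mem_ofPred_eq, Complex.sub_re, Complex.sub_im, latticePoint_re,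
        latticePoint_im] at hk' hl' ⊢
      exact ⟨hl'.1, hk'.2⟩
    obtain ⟨h1, h2⟩ := hclose hk hl
    have e1 : ∀ᶠ z in 𝓝 z₀, g k z = g (l.1, k.2) z := by
      rcases h1 with h1 | h1 | h1
      · rw [← h1]
        exact Eventually.of_forall fun _ => rfl
      · have hk2 : k = (l.1, k.2) + (1, 0) := Prod.ext (by simpa using h1) (by simp)
        have := hH z₀ hz₀ (l.1, k.2) hj (hk2 ▸ hk)
        rw [← hk2] at this
        exact this.mono fun z hz => hz.symm
      · have hk2 : (l.1, k.2) = k + (1, 0) := Prod.ext (by simpa using h1) (by simp)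
        have := hH z₀ hz₀ k hk (hk2 ▸ hj)
        rwa [← hk2] at this
    have e2 : ∀ᶠ z in 𝓝 z₀, g (l.1, k.2) z = g l z := by
      rcases h2 with h2 | h2 | h2
      · rw [h2]
        exact Eventually.of_forall fun _ => rfl
      · have hk2 : (l.1, k.2) = l + (0, 1) := Prod.ext (by simp) (by simpa using h2)
        have := hV z₀ hz₀ l hl (hk2 ▸ hj)
        rw [← hk2] at this
        exact this.mono fun z hz => hz.symm
      · have hk2 : l = (l.1, k.2) + (0, 1) := Prod.ext (by simp) (by simpa using h2)
        have := hV z₀ hz₀ (l.1, k.2) hj (hk2 ▸ hl)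
        rwa [← hk2] at this
    filter_upwards [e1, e2] with z hz1 hz2
    rw [hz1, hz2]
  intro z₀ hz₀
  refine DifferentiableAt.differentiableWithinAt ?_
  set k₀ := latticeFloor z₀
  have hk₀ : z₀ - latticePoint k₀ ∈ closure unitSquare := sub_latticeFloor_mem z₀
  have hgd : DifferentiableAt ℂ (g k₀) z₀ := by
    have a1 := (han _ (sub_latticePoint_mem_iff.2 hz₀) hk₀).differentiableAt
    exact (a1.comp z₀ (differentiableAt_id.sub_const _)).const_mul _
  refine hgd.congr_of_eventuallyEq ?_
  have hfin := finite_setOf_norm_le (‖z₀‖ + 3)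
  -- Near z₀ only finitely many closed squares occur. Those containing z₀ carry pieces agreeing with
  -- g k₀ nearby; the others stay away from z₀.
  have hev : ∀ᶠ z in 𝓝 z₀, ∀ k ∈ {m : ℤ × ℤ | ‖m‖ ≤ ‖z₀‖ + 3},
      z - latticePoint k ∈ closure unitSquare → g k z = g k₀ z := by
    rw [eventually_all_finite hfin]
    intro k _
    by_cases hk : z₀ - latticePoint k ∈ closure unitSquare
    · exact (hcompat z₀ hz₀ k k₀ hk hk₀).mono fun z hz _ => hz
    · have ht : ContinuousAt (fun z => z - latticePoint k) z₀ :=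
        (continuous_id.sub continuous_const).continuousAt
      exact (ht.eventually (isClosed_closure.isOpen_compl.mem_nhds hk)).mono
        fun z hz hz' => absurd hz' hz
  filter_upwards [hev, Metric.ball_mem_nhds z₀ one_pos] with z hz1 hz2
  refine hz1 (latticeFloor z) ?_ (sub_latticeFloor_mem z)
  have h2 := norm_le_two_of_mem_closure (sub_latticeFloor_mem z)
  have h3 := norm_le_norm_latticePoint (latticeFloor z)
  have h4 := Metric.mem_ball.1 hz2
  rw [dist_eq_norm] at h4
  have h5 := norm_le_norm_add_norm_sub' z z₀
  have h6 := norm_sub_le z (z - latticePoint (latticeFloor z))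
  rw [sub_sub_cancel] at h6
  change ‖latticeFloor z‖ ≤ ‖z₀‖ + 3
  linarith

/-! ### Restriction to the cells -/

theorem measurableEmbedding_add_latticePoint (m : ℤ × ℤ) :
    MeasurableEmbedding (fun z : ℂ => z + latticePoint m) :=
  measurableEmbedding_addRight _

namespace IsPeriodicCell

variable {ϖ : Set ℂ}

theorem measurePreserving_cell (m : ℤ × ℤ) :
    MeasurePreserving (fun z : ℂ => z + latticePoint m) (volume.restrict ϖ)
      (volume.restrict (cellTranslate ϖ m)) :=
  (measurePreserving_add_right volume (latticePoint m)).restrict_image_emb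
    (measurableEmbedding_add_latticePoint m) ϖ

theorem quasiMeasurePreserving_cell (h : IsPeriodicCell ϖ) (m : ℤ × ℤ) :
    Measure.QuasiMeasurePreserving (fun z : ℂ => z + latticePoint m) (volume.restrict ϖ)
      (volume.restrict (periodicDomain ϖ)) :=
  (measurePreserving_cell m).quasiMeasurePreserving.mono_right
    (Measure.restrict_mono (h.cellTranslate_subset m) le_rfl).absolutelyContinuous

theorem memLp_cell (h : IsPeriodicCell ϖ) (m : ℤ × ℤ) {p : ℝ≥0∞} {f : ℂ → ℂ}
    (hf : MemLp f p (volume.restrict (periodicDomain ϖ))) :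
    MemLp (fun z => f (z + latticePoint m)) p (volume.restrict ϖ) :=
  (hf.mono_measure (Measure.restrict_mono (h.cellTranslate_subset m) le_rfl)).comp_measurePreserving
    (measurePreserving_cell m)

/-- The restriction of `f(· + m)` to the cell. -/
noncomputable def cellRestriction (h : IsPeriodicCell ϖ) (m : ℤ × ℤ) :
    Lp ℂ 2 (volume.restrict (periodicDomain ϖ)) →ₗ[ℂ] Lp ℂ 2 (volume.restrict ϖ) where
  toFun f := (h.memLp_cell m (Lp.memLp f)).toLp _
  map_add' f g := by
    rw [← MemLp.toLp_add]
    refine MemLp.toLp_congr _ _ ?_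
    exact (h.quasiMeasurePreserving_cell m).ae_eq_comp (Lp.coeFn_add f g)
  map_smul' c f := by
    rw [RingHom.id_apply, ← MemLp.toLp_const_smul]
    refine MemLp.toLp_congr _ _ ?_
    exact (h.quasiMeasurePreserving_cell m).ae_eq_comp (Lp.coeFn_smul c f)

theorem cellRestriction_coeFn (h : IsPeriodicCell ϖ) (m : ℤ × ℤ)
    (f : Lp ℂ 2 (volume.restrict (periodicDomain ϖ))) :
    h.cellRestriction m f =ᵐ[volume.restrict ϖ] fun z => f (z + latticePoint m) :=
  MemLp.coeFn_toLp (h.memLp_cell m (Lp.memLp f))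

theorem cellRestriction_ae_eq (h : IsPeriodicCell ϖ) (m : ℤ × ℤ)
    {f : Lp ℂ 2 (volume.restrict (periodicDomain ϖ))} {F : ℂ → ℂ}
    (hf : f =ᵐ[volume.restrict (periodicDomain ϖ)] F) :
    h.cellRestriction m f =ᵐ[volume.restrict ϖ] fun z => F (z + latticePoint m) :=
  (h.cellRestriction_coeFn m f).trans ((h.quasiMeasurePreserving_cell m).ae_eq_comp hf)

theorem measurePreserving_domain (k : ℤ × ℤ) :
    MeasurePreserving (fun z : ℂ => z + latticePoint k) (volume.restrict (periodicDomain ϖ))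
      (volume.restrict (periodicDomain ϖ)) := by
  have h1 := (measurePreserving_add_right volume (latticePoint k)).restrict_preimage
    (isOpen_periodicDomain ϖ).measurableSet
  rwa [preimage_periodicDomain] at h1

/-- Translation by a lattice point on the periodic domain. -/
noncomputable def domainTranslation (ϖ : Set ℂ) (k : ℤ × ℤ) :
    Lp ℂ 2 (volume.restrict (periodicDomain ϖ)) →ₗ[ℂ]
      Lp ℂ 2 (volume.restrict (periodicDomain ϖ)) :=
  Lp.compMeasurePreservingₗ ℂ _ (measurePreserving_domain k)

theorem domainTranslation_coeFn (k : ℤ × ℤ) (f : Lp ℂ 2 (volume.restrict (periodicDomain ϖ))) :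
    domainTranslation ϖ k f =ᵐ[volume.restrict (periodicDomain ϖ)]
      fun z => f (z + latticePoint k) :=
  Lp.coeFn_compMeasurePreserving f (measurePreserving_domain k)

theorem domainTranslation_ae_eq (k : ℤ × ℤ) {f : Lp ℂ 2 (volume.restrict (periodicDomain ϖ))}
    {F : ℂ → ℂ} (hf : f =ᵐ[volume.restrict (periodicDomain ϖ)] F) :
    domainTranslation ϖ k f =ᵐ[volume.restrict (periodicDomain ϖ)]
      fun z => F (z + latticePoint k) :=
  (domainTranslation_coeFn k f).trans
    ((measurePreserving_domain k).quasiMeasurePreserving.ae_eq_comp hf)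

theorem restrict_periodicDomain (h : IsPeriodicCell ϖ)
    (hnull : volume (periodicDomain ϖ \ ⋃ m : ℤ × ℤ, cellTranslate ϖ m) = 0) :
    volume.restrict (periodicDomain ϖ) = volume.restrict (⋃ m : ℤ × ℤ, cellTranslate ϖ m) := by
  refine Measure.restrict_congr_set (Filter.EventuallyLE.antisymm ?_ ?_)
  · exact ae_le_set.2 hnull
  · exact (iUnion_subset h.cellTranslate_subset).eventuallyLE

theorem hasSum_setIntegral_cell (h : IsPeriodicCell ϖ)
    (hnull : volume (periodicDomain ϖ \ ⋃ m : ℤ × ℤ, cellTranslate ϖ m) = 0)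
    {F : ℂ → ℂ} (hF : Integrable F (volume.restrict (periodicDomain ϖ))) :
    HasSum (fun m : ℤ × ℤ => ∫ z in ϖ, F (z + latticePoint m)) (∫ z in periodicDomain ϖ, F z) := by
  rw [h.restrict_periodicDomain hnull] at hF ⊢
  have h1 := hasSum_integral_iUnion
    (fun m => (isOpen_cellTranslate h.isOpen m).measurableSet) h.pairwise_disjoint hF
  refine h1.congr_fun fun m => ?_
  exact ((measurePreserving_add_right volume (latticePoint m)).setIntegral_image_emb
    (measurableEmbedding_add_latticePoint m) F ϖ).symm

/-- The translated cells are disjoint and fill Ω up to a null set, so integrals over Ω split into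
sums of integrals over ϖ. -/
theorem isFamilySpace (h : IsPeriodicCell ϖ)
    (hnull : volume (periodicDomain ϖ \ ⋃ m : ℤ × ℤ, cellTranslate ϖ m) = 0) :
    IsFamilySpace h.cellRestriction (domainTranslation ϖ) where
  hasSum_inner f g := by
    rw [L2.inner_def]
    refine (h.hasSum_setIntegral_cell hnull (L2.integrable_inner f g)).congr_fun fun m => ?_
    rw [L2.inner_def]
    refine integral_congr_ae ?_
    filter_upwards [h.cellRestriction_coeFn m f, h.cellRestriction_coeFn m g] with z h1 h2
    rw [h1, h2]
  translate m k f := by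
    refine Lp.ext ?_
    refine (h.cellRestriction_ae_eq m (domainTranslation_coeFn k f)).trans ?_
    filter_upwards [h.cellRestriction_coeFn (m + k) f] with z hz
    rw [hz, latticePoint_add, add_assoc]

theorem domainTranslation_mem (k : ℤ × ℤ) {f : Lp ℂ 2 (volume.restrict (periodicDomain ϖ))}
    (hf : f ∈ bergmanSpace (periodicDomain ϖ)) :
    domainTranslation ϖ k f ∈ bergmanSpace (periodicDomain ϖ) := by
  obtain ⟨F, hF, hfF⟩ := hf
  refine ⟨fun z => F (z + latticePoint k), ?_, domainTranslation_ae_eq k hfF⟩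
  exact hF.comp (differentiableOn_id.add_const _) fun z hz => add_latticePoint_mem_iff.2 hz

/-- Gluing functions on the translates of the cell. -/
theorem memLp_of_summable (h : IsPeriodicCell ϖ)
    (hnull : volume (periodicDomain ϖ \ ⋃ m : ℤ × ℤ, cellTranslate ϖ m) = 0)
    {F : ℂ → ℂ} (hF : DifferentiableOn ℂ F (periodicDomain ϖ)) {v : ℂ → ℂ}
    (hv : MemLp v 2 (volume.restrict ϖ)) {κ : ℤ × ℤ → ℝ} (hκ : Summable fun m => κ m ^ 2)
    (hb : ∀ m, ∀ᵐ z ∂volume.restrict ϖ, ‖F (z + latticePoint m)‖ ≤ κ m * ‖v z‖) :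
    MemLp F 2 (volume.restrict (periodicDomain ϖ)) := by
  have hmeas : AEStronglyMeasurable F (volume.restrict (periodicDomain ϖ)) :=
    hF.continuousOn.aestronglyMeasurable (isOpen_periodicDomain ϖ).measurableSet
  have hv2 : Integrable (fun z => ‖v z‖ ^ 2) (volume.restrict ϖ) :=
    (memLp_two_iff_integrable_sq_norm hv.1).1 hv
  have hint : ∀ m, Integrable (fun z => ‖F (z + latticePoint m)‖ ^ 2) (volume.restrict ϖ) ∧
      ∫ z in ϖ, ‖F (z + latticePoint m)‖ ^ 2 ≤ κ m ^ 2 * ∫ z in ϖ, ‖v z‖ ^ 2 := fun m => by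
    have h1 : ∀ᵐ z ∂volume.restrict ϖ, ‖F (z + latticePoint m)‖ ^ 2 ≤ κ m ^ 2 * ‖v z‖ ^ 2 := by
      filter_upwards [hb m] with z hz
      rw [← mul_pow]
      exact pow_le_pow_left₀ (norm_nonneg _) hz 2
    have h2 : AEStronglyMeasurable (fun z => F (z + latticePoint m)) (volume.restrict ϖ) :=
      hmeas.comp_quasiMeasurePreserving (h.quasiMeasurePreserving_cell m)
    have h3 : Integrable (fun z => ‖F (z + latticePoint m)‖ ^ 2) (volume.restrict ϖ) := by
      refine (hv2.const_mul (κ m ^ 2)).mono' (h2.norm.pow 2) ?_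
      filter_upwards [h1] with z hz
      rwa [Real.norm_of_nonneg (sq_nonneg _)]
    refine ⟨h3, ?_⟩
    rw [← integral_const_mul]
    exact integral_mono_ae h3 (hv2.const_mul _) h1
  rw [memLp_two_iff_integrable_sq_norm hmeas, h.restrict_periodicDomain hnull]
  refine integrableOn_iUnion_of_summable_integral_norm (fun m => ?_) ?_
  · exact ((measurePreserving_cell m).integrable_comp_emb
      (measurableEmbedding_add_latticePoint m)).1 (hint m).1
  · refine Summable.of_nonneg_of_le (fun m => integral_nonneg fun _ => norm_nonneg _) (fun m => ?_)
      (hκ.mul_right (∫ z in ϖ, ‖v z‖ ^ 2))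
    refine le_trans (le_of_eq ?_) (hint m).2
    refine ((measurePreserving_add_right volume (latticePoint m)).setIntegral_image_emb
      (measurableEmbedding_add_latticePoint m) (fun z => ‖‖F z‖ ^ 2‖) ϖ).trans ?_
    simp only [norm_pow, norm_norm]

end IsPeriodicCell

/-! ### The Bergman space on Ω and its fibres on the cell -/

/-- The sum of a norm-convergent series in `L²` is almost everywhere the pointwise sum. -/
theorem hasSum_Lp_and_ae {μ : Measure ℂ} {ι : Type*} [Countable ι] {f : ι → Lp ℂ 2 μ} {κ : ι → ℝ}
    (hκ : Summable κ) (hf : ∀ m, ‖f m‖ ≤ κ m) :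
    HasSum f (∑' m, f m) ∧ ∀ᵐ z ∂μ, HasSum (fun m => f m z) ((∑' m, f m : Lp ℂ 2 μ) z) := by
  have h1 : Summable fun m => ‖f m‖ := Summable.of_nonneg_of_le (fun _ => norm_nonneg _) hf hκ
  refine ⟨h1.of_norm.hasSum, Lp.hasSum_coeFn_tsum ?_⟩
  have h2 := ENNReal.ofReal_tsum_of_nonneg (fun m => norm_nonneg (f m)) h1
  simp only [ofReal_norm] at h2
  rw [← h2]
  exact ENNReal.ofReal_ne_top

theorem norm_mulOperator_le {μ : Measure ℂ} {a : ℂ → ℂ} (ha : MemLp a ∞ μ) {c : ℝ}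
    (hc : ∀ᵐ z ∂μ, ‖a z‖ ≤ c) (f : Lp ℂ 2 μ) : ‖mulOperator a ha f‖ ≤ c * ‖f‖ := by
  refine Lp.norm_le_mul_norm_of_ae_le_mul ?_
  filter_upwards [hc, mulOperator_coeFn a ha f] with z h1 h2
  rw [h2, norm_mul]
  exact mul_le_mul_of_nonneg_right h1 (norm_nonneg _)

/-- Lifts of elements of a subspace to families extend to the closure of the subspace. -/
theorem IsFamilySpace.exists_lift_of_mem_closure {ι X H : Type*} [AddCommGroup ι]
    [NormedAddCommGroup X] [InnerProductSpace ℂ X] [NormedAddCommGroup H] [InnerProductSpace ℂ H]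
    [CompleteSpace X] {R : ι → X →ₗ[ℂ] H} {S : ι → X →ₗ[ℂ] X} (h : IsFamilySpace R S)
    {A : Submodule ℂ X} (hA : IsClosed (A : Set X)) {W : ι → H →ₗ[ℂ] H} {κ : ι → ℝ}
    (hκ : Summable fun m => κ m ^ 2) (hW : ∀ m v, ‖W m v‖ ≤ κ m * ‖v‖) {E : Submodule ℂ H}
    (hE : ∀ v ∈ E, ∃ g ∈ A, ∀ m, R m g = W m v) {v : H} (hv : v ∈ E.topologicalClosure) :
    ∃ g ∈ A, ∀ m, R m g = W m v := by
  obtain ⟨w, hwE, hw⟩ := mem_closure_iff_seq_limit.1 hv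
  choose g hgA hg using fun n => hE (w n) (hwE n)
  set K := Real.sqrt (∑' m, κ m ^ 2) with hK
  have hR : ∀ m g, ‖R m g‖ ≤ ‖g‖ := fun m g => by
    refine (abs_le_of_sq_le_sq' ?_ (norm_nonneg _)).2
    exact le_hasSum (h.hasSum_norm_sq g) m fun _ _ => sq_nonneg _
  -- Parseval makes lifting Lipschitz, so lifts of a convergent sequence form a Cauchy sequence,
  -- whose limit stays in the closed space A.
  have hdist : ∀ n k, dist (g n) (g k) ≤ K * dist (w n) (w k) := fun n k => by
    rw [dist_eq_norm, dist_eq_norm]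
    refine (abs_le_of_sq_le_sq' ?_ (by positivity)).2
    rw [mul_pow, Real.sq_sqrt (tsum_nonneg fun _ => sq_nonneg _)]
    refine hasSum_le (fun m => ?_) (h.hasSum_norm_sq (g n - g k)) (hκ.hasSum.mul_right _)
    rw [map_sub, hg, hg, ← map_sub, ← mul_pow]
    exact pow_le_pow_left₀ (norm_nonneg _) (hW _ _) 2
  have hcau : CauchySeq g := by
    have hcw : CauchySeq w := hw.cauchySeq
    rw [Metric.cauchySeq_iff'] at hcw ⊢
    intro ε hε
    obtain ⟨N, hN⟩ := hcw (ε / (K + 1)) (by positivity)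
    refine ⟨N, fun n hn => (hdist n N).trans_lt ?_⟩
    have h1 := hN n hn
    rw [lt_div_iff₀ (by positivity)] at h1
    nlinarith [dist_nonneg (x := w n) (y := w N)]
  obtain ⟨g₀, hg₀⟩ := cauchySeq_tendsto_of_complete hcau
  refine ⟨g₀, hA.mem_of_tendsto hg₀ (Eventually.of_forall hgA), fun m => ?_⟩
  have h1 : Tendsto (fun n => R m (g n)) atTop (𝓝 (R m g₀)) := by
    rw [tendsto_iff_norm_sub_tendsto_zero] at hg₀ ⊢
    refine squeeze_zero (fun _ => norm_nonneg _) (fun n => ?_) hg₀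
    rw [← map_sub]
    exact hR _ _
  have h2 : Tendsto (fun n => W m (w n)) atTop (𝓝 (W m v)) := by
    rw [tendsto_iff_norm_sub_tendsto_zero] at hw ⊢
    refine squeeze_zero (fun _ => norm_nonneg _) (fun n => ?_) (by simpa using hw.const_mul (κ m))
    rw [← map_sub]
    exact hW _ _
  refine tendsto_nhds_unique h1 ?_
  simpa only [hg] using h2

namespace IsPeriodicCell

variable {ϖ : Set ℂ}

/-- Multiplication by the translates of a bounded continuous function. -/
theorem memLp_top_translate (h : IsPeriodicCell ϖ) {u : ℂ → ℂ}
    (hu : DifferentiableOn ℂ u (periodicDomain ϖ)) {κ : ℤ × ℤ → ℝ}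
    (hκ : ∀ m, ∀ z ∈ ϖ, ‖u (z + latticePoint m)‖ ≤ κ m) (m : ℤ × ℤ) :
    MemLp (fun z => u (z + latticePoint m)) ∞ (volume.restrict ϖ) := by
  refine memLp_top_of_bound ?_ (κ m) ?_
  · refine ContinuousOn.aestronglyMeasurable ?_ h.isOpen.measurableSet
    refine hu.continuousOn.comp (continuous_id.add continuous_const).continuousOn fun z hz => ?_
    exact add_latticePoint_mem_iff.2 (h.subset_periodicDomain hz)
  · filter_upwards [ae_restrict_mem h.isOpen.measurableSet] with z hz
    exact hκ m z hz

/-- The quasiperiodic sum of the translates of a function in the Bergman space, damped by a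
decaying holomorphic function, belongs to the quasiperiodic space on the cell. -/
theorem tsum_mem_cellSpaceExt (h : IsPeriodicCell ϖ) (η : ℝ × ℝ) {u : ℂ → ℂ} {b C : ℝ}
    (hu : DifferentiableOn ℂ u (periodicDomain ϖ)) (hb : 2 < b) (hC : 0 ≤ C)
    (hud : ∀ z ∈ periodicDomain ϖ, ‖u z‖ ≤ C * (1 + ‖z‖) ^ (-b))
    {g : Lp ℂ 2 (volume.restrict (periodicDomain ϖ))} (hg : g ∈ bergmanSpace (periodicDomain ϖ))
    {f : Lp ℂ 2 (volume.restrict ϖ)}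
    (hf : ∀ᵐ z ∂volume.restrict ϖ, HasSum (fun m => starRingEnd ℂ (latticeCharacter η m) *
      (u (z + latticePoint m) * h.cellRestriction m g z)) (f z)) :
    f ∈ cellSpaceExt ϖ η := by
  obtain ⟨W, hW, hgW⟩ := hg
  have hΩ := isOpen_periodicDomain ϖ
  set F : ℂ → ℂ := fun z => ∑' m : ℤ × ℤ, starRingEnd ℂ (latticeCharacter η m) *
    (u (z + latticePoint m) * W (z + latticePoint m)) with hF
  -- The bound is uniform in m: the local point evaluation estimate at z₀ is applied to the
  -- translates of g, all of which have the same norm.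
  have hWbd : ∀ z₀ ∈ periodicDomain ϖ, ∃ r > 0, ∃ B, 0 ≤ B ∧ ∀ z ∈ Metric.ball z₀ r, ∀ m,
      ‖W (z + latticePoint m)‖ ≤ B := by
    intro z₀ hz₀
    obtain ⟨ρ, hρ, hρΩ⟩ := Metric.isOpen_iff.1 hΩ z₀ hz₀
    obtain ⟨c, hc, hbd⟩ := exists_norm_le_of_bergman (D := periodicDomain ϖ) (z := z₀) (r := ρ / 4)
      (by positivity) ((Metric.closedBall_subset_ball (by linarith)).trans hρΩ)
    refine ⟨ρ / 4, by positivity, ‖g‖ / c, by positivity, fun z hz m => ?_⟩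
    have h1 := hbd (domainTranslation ϖ m g) (fun z => W (z + latticePoint m))
      (hW.comp (differentiableOn_id.add_const _) fun z hz => add_latticePoint_mem_iff.2 hz)
      (domainTranslation_ae_eq m hgW) z hz
    have h2 : ‖domainTranslation ϖ m g‖ = ‖g‖ :=
      Lp.norm_compMeasurePreserving g (measurePreserving_domain m)
    rw [le_div_iff₀ hc, mul_comm, ← h2]
    exact h1
  have hFd : DifferentiableOn ℂ F (periodicDomain ϖ) := by
    choose! r hr B hB hWB using hWbd
    refine differentiableOn_tsum_translates hΩ (fun m => ?_) hb
      (C := fun z₀ => C * (1 + (‖z₀‖ + 1)) ^ b * B z₀) fun z₀ hz₀ =>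
        ⟨min (r z₀) 1, lt_min (hr z₀ hz₀) one_pos, fun z hz m => ?_⟩
    · exact ((hu.mul hW).comp (differentiableOn_id.add_const _)
        fun z hz => add_latticePoint_mem_iff.2 hz).const_mul _
    · have hz2 := Metric.mem_ball.1 hz.2
      have hzn : ‖z‖ ≤ ‖z₀‖ + 1 := by
        have h1 := hz2.trans_le (min_le_right _ _)
        rw [dist_eq_norm] at h1
        linarith [norm_le_norm_add_norm_sub' z z₀]
      rw [norm_mul, RCLike.norm_conj, norm_latticeCharacter, one_mul, norm_mul]
      have h1 := hud (z + latticePoint m) (add_latticePoint_mem_iff.2 hz.1)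
      have h2 := mul_le_mul_of_nonneg_left (one_add_norm_rpow_le (b := b) (by linarith)
        (by positivity) hzn m) hC
      have h3 := hWB z₀ hz₀ z (Metric.mem_ball.2 (hz2.trans_le (min_le_left _ _))) m
      calc _ ≤ (C * ((1 + (‖z₀‖ + 1)) ^ b * (1 + ‖m‖) ^ (-b))) * B z₀ :=
            mul_le_mul (h1.trans h2) h3 (norm_nonneg _) (by positivity)
        _ = _ := by ring
  have hquasi : ∀ z k, F (z + latticePoint k) = latticeCharacter η k * F z := by
    intro z k
    have h1 := (Equiv.addRight k).tsum_eq fun m : ℤ × ℤ =>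
      latticeCharacter η k * (starRingEnd ℂ (latticeCharacter η m) *
        (u (z + latticePoint m) * W (z + latticePoint m)))
    simp only [hF]
    rw [← tsum_mul_left, ← h1]
    refine tsum_congr fun m => ?_
    have h2 : latticeCharacter η k * starRingEnd ℂ (latticeCharacter η k) = 1 := by
      rw [Complex.mul_conj, Complex.normSq_eq_norm_sq, norm_latticeCharacter]
      simp
    rw [Equiv.coe_addRight, latticeCharacter_add, map_mul, latticePoint_add,
      add_comm (latticePoint m), ← add_assoc]
    linear_combination (-(starRingEnd ℂ (latticeCharacter η m) *
      (u (z + latticePoint k + latticePoint m) * W (z + latticePoint k + latticePoint m)))) * h2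
  refine ⟨_, F, hΩ, inter_subset_right, subset_rfl, hFd, ⟨fun y _ _ => ?_, fun x _ _ => ?_⟩, ?_⟩
  · rw [← latticeCharacter_one_zero, ← hquasi, latticePoint_one_zero, add_comm]
  · rw [← latticeCharacter_zero_one, ← hquasi, latticePoint_zero_one]
  · filter_upwards [hf, ae_all_iff.2 fun m => h.cellRestriction_ae_eq m hgW] with z h1 h2
    simp only [h2] at h1
    exact h1.tsum_eq.symm

/-- An element of the quasiperiodic space on the cell, damped by a decaying holomorphic function,
extends to an element of the Bergman space. -/
theorem exists_lift_of_mem_cellSpaceExt (h : IsPeriodicCell ϖ)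
    (hnull : volume (periodicDomain ϖ \ ⋃ m : ℤ × ℤ, cellTranslate ϖ m) = 0) (η : ℝ × ℝ)
    {u : ℂ → ℂ} (hu : DifferentiableOn ℂ u (periodicDomain ϖ)) {κ : ℤ × ℤ → ℝ}
    (hκ : ∀ m, ∀ z ∈ ϖ, ‖u (z + latticePoint m)‖ ≤ κ m) (hκ2 : Summable fun m => κ m ^ 2)
    {v : Lp ℂ 2 (volume.restrict ϖ)} (hv : v ∈ cellSpaceExt ϖ η) :
    ∃ g ∈ bergmanSpace (periodicDomain ϖ), ∀ m, h.cellRestriction m g =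
      latticeCharacter η m • mulOperator _ (h.memLp_top_translate hu hκ m) v := by
  obtain ⟨U, F, hU, hsU, -, hF, hq, hvF⟩ := hv
  -- The quasiperiodic extension has pieces of constant norm; the factor u makes it square
  -- integrable and keeps it holomorphic.
  set G : ℂ → ℂ := fun z => quasiperiodicExtension η F z * u z with hG
  have hGd : DifferentiableOn ℂ G (periodicDomain ϖ) :=
    (h.differentiableOn_quasiperiodicExtension hU hsU hF hq).mul hu
  have hval : ∀ m, ∀ z ∈ ϖ, G (z + latticePoint m) =
      latticeCharacter η m * (u (z + latticePoint m) * F z) := fun m z hz => by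
    simp only [hG, quasiperiodicExtension, h.latticeFloor_add hz, add_sub_cancel_right]
    ring
  have hGm : MemLp G 2 (volume.restrict (periodicDomain ϖ)) := by
    refine h.memLp_of_summable hnull hGd (Lp.memLp v) hκ2 fun m => ?_
    filter_upwards [hvF, ae_restrict_mem h.isOpen.measurableSet] with z hz1 hz2
    rw [hval m z hz2, norm_mul, norm_latticeCharacter, one_mul, norm_mul, hz1]
    exact mul_le_mul_of_nonneg_right (hκ m z hz2) (norm_nonneg _)
  refine ⟨hGm.toLp G, ⟨G, hGd, hGm.coeFn_toLp⟩, fun m => Lp.ext ?_⟩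
  filter_upwards [h.cellRestriction_ae_eq m hGm.coeFn_toLp, hvF,
    Lp.coeFn_smul (latticeCharacter η m) (mulOperator _ (h.memLp_top_translate hu hκ m) v),
    mulOperator_coeFn _ (h.memLp_top_translate hu hκ m) v,
    ae_restrict_mem h.isOpen.measurableSet] with z h1 h2 h3 h4 h5
  rw [h1, h3, Pi.smul_apply, h4, h2, hval m z h5, smul_eq_mul]

/-- The quasiperiodic Bergman spaces on the cell are the fibres of the Bergman space on the
periodic domain. -/
theorem isFiber (h : IsPeriodicCell ϖ)
    (hnull : volume (periodicDomain ϖ \ ⋃ m : ℤ × ℤ, cellTranslate ϖ m) = 0)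
    {u : ℂ → ℂ} {b C : ℝ} (hu : DifferentiableOn ℂ u (periodicDomain ϖ)) (hb : 2 < b) (hC : 0 ≤ C)
    (hud : ∀ z ∈ periodicDomain ϖ, ‖u z‖ ≤ C * (1 + ‖z‖) ^ (-b))
    (hsum : ∀ z ∈ periodicDomain ϖ, HasSum (fun m : ℤ × ℤ => u (z + latticePoint m)) 1)
    {κ : ℤ × ℤ → ℝ} (hκ : ∀ m, ∀ z ∈ ϖ, ‖u (z + latticePoint m)‖ ≤ κ m) (hκ0 : ∀ m, 0 ≤ κ m)
    (hκs : Summable κ) (η : ℝ × ℝ) :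
    IsFiber h.cellRestriction (domainTranslation ϖ)
      (fun m => (mulOperator _ (h.memLp_top_translate hu hκ m) :
        Lp ℂ 2 (volume.restrict ϖ) →ₗ[ℂ] Lp ℂ 2 (volume.restrict ϖ)))
      κ (latticeCharacter η) (bergmanSpace (periodicDomain ϖ)) (cellSpace ϖ η) := by
  have hUn : ∀ m v, ‖mulOperator _ (h.memLp_top_translate hu hκ m) v‖ ≤ κ m * ‖v‖ := fun m v => by
    refine norm_mulOperator_le _ ?_ v
    filter_upwards [ae_restrict_mem h.isOpen.measurableSet] with z hz
    exact hκ m z hz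
  have hκ2 : Summable fun m => κ m ^ 2 := by
    refine Summable.of_nonneg_of_le (fun m => sq_nonneg _) (fun m => ?_)
      (hκs.mul_left (∑' m, κ m))
    rw [sq]
    exact mul_le_mul_of_nonneg_right (hκs.le_tsum m fun k _ => hκ0 k) (hκ0 m)
  have hfam := h.isFamilySpace hnull
  refine { hfam with
    summable := hκs
    norm_le := hUn
    kappa_nonneg := hκ0
    partition := fun v => ?_
    norm_char := norm_latticeCharacter η
    char_add := latticeCharacter_add η
    invariant := fun k g hg => domainTranslation_mem k hg
    lift := fun v hv => ?_
    fiber := fun g hg => ?_ }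
  · obtain ⟨h1, h2⟩ := hasSum_Lp_and_ae (hκs.mul_right ‖v‖) (fun m => hUn m v)
    have h3 : (∑' m, mulOperator _ (h.memLp_top_translate hu hκ m) v) = v := by
      refine Lp.ext ?_
      filter_upwards [h2, ae_all_iff.2 fun m => mulOperator_coeFn _
        (h.memLp_top_translate hu hκ m) v, ae_restrict_mem h.isOpen.measurableSet] with z h4 h5 h6
      simp only [h5] at h4
      have h7 := (hsum z (h.subset_periodicDomain h6)).mul_right (v z)
      rw [one_mul] at h7
      exact h4.unique h7
    rw [h3] at h1
    exact h1
  · refine hfam.exists_lift_of_mem_closure (isClosed_bergmanSpace (isOpen_periodicDomain ϖ)) hκ2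
      (W := fun m => latticeCharacter η m • (mulOperator _ (h.memLp_top_translate hu hκ m) :
        Lp ℂ 2 (volume.restrict ϖ) →ₗ[ℂ] Lp ℂ 2 (volume.restrict ϖ))) (fun m v => ?_)
      (fun v hv => h.exists_lift_of_mem_cellSpaceExt hnull η hu hκ hκ2 hv) hv
    rw [LinearMap.smul_apply, norm_smul, norm_latticeCharacter, one_mul]
    exact hUn m v
  · refine Submodule.le_topologicalClosure _ (h.tsum_mem_cellSpaceExt η hu hb hC hud hg ?_)
    have hR : ∀ m, ‖h.cellRestriction m g‖ ≤ ‖g‖ := fun m => by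
      refine (abs_le_of_sq_le_sq' ?_ (norm_nonneg _)).2
      exact le_hasSum (hfam.hasSum_norm_sq g) m fun _ _ => sq_nonneg _
    obtain ⟨-, h2⟩ := hasSum_Lp_and_ae (hκs.mul_right ‖g‖)
      (f := fun m => starRingEnd ℂ (latticeCharacter η m) •
        mulOperator _ (h.memLp_top_translate hu hκ m) (h.cellRestriction m g)) (fun m => by
          rw [norm_smul, RCLike.norm_conj, norm_latticeCharacter, one_mul]
          exact (hUn m _).trans (mul_le_mul_of_nonneg_left (hR m) (hκ0 m)))
    filter_upwards [h2, ae_all_iff.2 fun m => mulOperator_coeFn _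
      (h.memLp_top_translate hu hκ m) (h.cellRestriction m g),
      ae_all_iff.2 fun m => Lp.coeFn_smul (starRingEnd ℂ (latticeCharacter η m))
        (mulOperator _ (h.memLp_top_translate hu hκ m) (h.cellRestriction m g))] with z h3 h4 h5
    simp only [h5, Pi.smul_apply, h4, smul_eq_mul] at h3
    exact h3

end IsPeriodicCell

/-! ### Toeplitz operators with periodic symbols -/

theorem memLp_conj {μ : Measure ℂ} {a : ℂ → ℂ} (ha : MemLp a ∞ μ) :
    MemLp (fun z => starRingEnd ℂ (a z)) ∞ μ := ha.star

theorem inner_mulOperator {μ : Measure ℂ} {a : ℂ → ℂ} (ha : MemLp a ∞ μ) (x y : Lp ℂ 2 μ) :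
    inner ℂ (mulOperator a ha x) y =
      inner ℂ x (mulOperator (fun z => starRingEnd ℂ (a z)) (memLp_conj ha) y) := by
  rw [L2.inner_def, L2.inner_def]
  refine integral_congr_ae ?_
  filter_upwards [mulOperator_coeFn a ha x, mulOperator_coeFn _ (memLp_conj ha) y] with z h1 h2
  rw [h1, h2]
  simp only [RCLike.inner_apply, map_mul]
  ring

theorem memLp_sub_const {μ : Measure ℂ} {a : ℂ → ℂ} (ha : MemLp a ∞ μ) (c : ℂ) :
    MemLp (fun z => a z - c) ∞ μ := ha.sub (memLp_top_const c)

/-- Subtracting c from the operator amounts to subtracting c from the symbol, so every spectral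
question becomes invertibility for the symbol a - c. -/
theorem toeplitz_sub_const {μ : Measure ℂ} (K : Submodule ℂ (Lp ℂ 2 μ))
    [K.HasOrthogonalProjection] {a : ℂ → ℂ} (ha : MemLp a ∞ μ) (c : ℂ) :
    toeplitz K a ha - c • ContinuousLinearMap.id ℂ K =
      compression K (mulOperator (fun z => a z - c) (memLp_sub_const ha c)) := by
  ext1 f
  have h1 : mulOperator (fun z => a z - c) (memLp_sub_const ha c) (f : Lp ℂ 2 μ) =
      mulOperator a ha (f : Lp ℂ 2 μ) - c • (f : Lp ℂ 2 μ) := by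
    refine Lp.ext ?_
    filter_upwards [mulOperator_coeFn _ (memLp_sub_const ha c) (f : Lp ℂ 2 μ),
      mulOperator_coeFn a ha (f : Lp ℂ 2 μ), Lp.coeFn_sub (mulOperator a ha (f : Lp ℂ 2 μ))
        (c • (f : Lp ℂ 2 μ)), Lp.coeFn_smul c (f : Lp ℂ 2 μ)] with z h2 h3 h4 h5
    rw [h2, h4, Pi.sub_apply, h3, h5, Pi.smul_apply, smul_eq_mul]
    ring
  rw [compression_apply, h1, map_sub, map_smul,
    Submodule.orthogonalProjectionOnto_mem_subspace_eq_self]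
  rfl

theorem mem_spectrum_iff {V : Type*} [NormedAddCommGroup V] [InnerProductSpace ℂ V]
    (T : V →L[ℂ] V) (c : ℂ) :
    c ∈ spectrum ℂ T ↔ ¬ IsUnit (T - c • ContinuousLinearMap.id ℂ V) := by
  rw [spectrum.mem_iff, ← IsUnit.neg_iff, neg_sub, Algebra.algebraMap_eq_smul_one]
  rfl

/-- An almost everywhere periodic function agrees almost everywhere with its translates. -/
theorem ae_periodic {ϖ : Set ℂ} {a : ℂ → ℂ}
    (hper : ∀ᵐ z ∂(volume.restrict (periodicDomain ϖ)),
      a z = a (z + 1) ∧ a z = a (z + Complex.I)) (m : ℤ × ℤ) :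
    ∀ᵐ z ∂(volume.restrict (periodicDomain ϖ)), a (z + latticePoint m) = a z := by
  set p : ℤ × ℤ → Prop := fun m =>
    ∀ᵐ z ∂(volume.restrict (periodicDomain ϖ)), a (z + latticePoint m) = a z with hp
  have hpull : ∀ (k : ℤ × ℤ) {q : ℂ → Prop}, (∀ᵐ z ∂(volume.restrict (periodicDomain ϖ)), q z) →
      ∀ᵐ z ∂(volume.restrict (periodicDomain ϖ)), q (z + latticePoint k) := fun k q hq =>
    (IsPeriodicCell.measurePreserving_domain k).quasiMeasurePreserving.ae hq
  have h0 : p 0 := by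
    simp only [hp, latticePoint_zero, add_zero]
    exact Eventually.of_forall fun _ => trivial
  have hadd : ∀ m k, p m → p k → p (m + k) := fun m k hm hk => by
    filter_upwards [hm, hpull m hk] with z h1 h2
    rw [latticePoint_add, ← add_assoc, h2, h1]
  have hneg : ∀ m, p m → p (-m) := fun m hm => by
    filter_upwards [hpull (-m) hm] with z h1
    rw [latticePoint_neg] at h1 ⊢
    rw [neg_add_cancel_right] at h1
    exact h1.symm
  have hzsmul : ∀ (n : ℤ) m, p m → p (n • m) := fun n m hm => by
    have hnat : ∀ n : ℕ, p (n • m) := fun n => by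
      induction n with
      | zero => rwa [zero_nsmul]
      | succ n ih =>
        rw [succ_nsmul]
        exact hadd _ _ ih hm
    obtain ⟨k, rfl | rfl⟩ := n.eq_nat_or_neg
    · rw [natCast_zsmul]
      exact hnat k
    · rw [neg_smul, natCast_zsmul]
      exact hneg _ (hnat k)
  have hm : m = m.1 • ((1, 0) : ℤ × ℤ) + m.2 • ((0, 1) : ℤ × ℤ) := by ext <;> simp
  change p m
  rw [hm]
  refine hadd _ _ (hzsmul _ _ ?_) (hzsmul _ _ ?_)
  · simp only [hp, latticePoint_one_zero]
    exact hper.mono fun z hz => hz.1.symm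
  · simp only [hp, latticePoint_zero_one]
    exact hper.mono fun z hz => hz.2.symm

theorem IsPeriodicCell.cellRestriction_mulOperator {ϖ : Set ℂ} (h : IsPeriodicCell ϖ) {a : ℂ → ℂ}
    (ha : MemLp a ∞ (volume.restrict (periodicDomain ϖ)))
    (ha' : MemLp a ∞ (volume.restrict ϖ))
    (hper : ∀ m : ℤ × ℤ, ∀ᵐ z ∂(volume.restrict (periodicDomain ϖ)), a (z + latticePoint m) = a z)
    (m : ℤ × ℤ) (g : Lp ℂ 2 (volume.restrict (periodicDomain ϖ))) :
    h.cellRestriction m (mulOperator a ha g) = mulOperator a ha' (h.cellRestriction m g) := by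
  refine Lp.ext ?_
  have h1 : ∀ᵐ z ∂(volume.restrict ϖ), a (z + latticePoint m) = a z :=
    ae_mono (Measure.restrict_mono h.subset_periodicDomain le_rfl) (hper m)
  filter_upwards [h.cellRestriction_ae_eq m (mulOperator_coeFn a ha g),
    mulOperator_coeFn a ha' (h.cellRestriction m g), h.cellRestriction_coeFn m g, h1]
    with z h2 h3 h4 h5
  rw [h2, h3, h4, h5]

theorem theorem5p1 (ϖ : Set ℂ) (hϖ : IsPeriodicCell ϖ)
    (hnull : volume (periodicDomain ϖ \ ⋃ m : ℤ × ℤ, cellTranslate ϖ m) = 0)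
    (hA : ConditionA (periodicDomain ϖ))
    (a : ℂ → ℂ) (ha : MemLp a ∞ (volume.restrict (periodicDomain ϖ)))
    (hper : ∀ᵐ z ∂(volume.restrict (periodicDomain ϖ)), a z = a (z + 1) ∧ a z = a (z + Complex.I)) :
    essentialSpectrum (toeplitz (bergmanSpace (periodicDomain ϖ)) a ha) =
        ⋃ η ∈ Icc (-Real.pi) Real.pi ×ˢ Icc (-Real.pi) Real.pi,
          spectrum ℂ (toeplitz (cellSpace ϖ η) a (hϖ.memLp_restrict ha)) ∧
      spectrum ℂ (toeplitz (bergmanSpace (periodicDomain ϖ)) a ha) =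
        essentialSpectrum (toeplitz (bergmanSpace (periodicDomain ϖ)) a ha) := by
  obtain ⟨u, b, C, hu, hb, hC, hud, hsum⟩ := hA.exists_partition (isOpen_periodicDomain ϖ)
    fun z hz m => add_latticePoint_mem_iff.2 hz
  -- The 2 bounds the norm of points of the unit square, so κ m bounds u on the whole translate ϖ +
  -- m.
  set κ : ℤ × ℤ → ℝ := fun m => C * (1 + 2) ^ b * (1 + ‖m‖) ^ (-b)
  have hκ0 : ∀ m, 0 ≤ κ m := fun m => by positivity
  have hκs : Summable κ := (summable_one_add_norm_rpow hb).mul_left _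
  have hκ : ∀ m, ∀ z ∈ ϖ, ‖u (z + latticePoint m)‖ ≤ κ m := fun m z hz => by
    refine (hud _ (add_latticePoint_mem_iff.2 (hϖ.subset_periodicDomain hz))).trans ?_
    have h1 := one_add_norm_rpow_le (b := b) (by linarith) zero_le_two
      (norm_le_two_of_mem_closure (subset_closure (hϖ.subset_unitSquare hz))) m
    exact (mul_le_mul_of_nonneg_left h1 hC).trans_eq (mul_assoc _ _ _).symm
  have hF := hϖ.isFiber hnull hu hb hC hud hsum hκ hκ0 hκs
  have hfam := hϖ.isFamilySpace hnull
  have : CompleteSpace (bergmanSpace (periodicDomain ϖ)) :=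
    (isClosed_bergmanSpace (isOpen_periodicDomain ϖ)).completeSpace_coe
  have : ∀ η, CompleteSpace (cellSpace ϖ η) := fun η =>
    (cellSpaceExt ϖ η).isClosed_topologicalClosure.completeSpace_coe
  have ha' := hϖ.memLp_restrict ha
  have hper' := ae_periodic hper
  have hcomm : ∀ (c : ℂ) m g, hϖ.cellRestriction m (mulOperator _ (memLp_sub_const ha c) g) =
      mulOperator _ (memLp_sub_const ha' c) (hϖ.cellRestriction m g) := fun c =>
    hϖ.cellRestriction_mulOperator _ _ fun m => (hper' m).mono fun z hz => by simp only [hz]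
  have hcomm' : ∀ (c : ℂ) m g,
      hϖ.cellRestriction m (mulOperator _ (memLp_conj (memLp_sub_const ha c)) g) =
      mulOperator _ (memLp_conj (memLp_sub_const ha' c)) (hϖ.cellRestriction m g) := fun c =>
    hϖ.cellRestriction_mulOperator _ _ fun m => (hper' m).mono fun z hz => by simp only [hz]
  have hess : spectrum ℂ (toeplitz (bergmanSpace (periodicDomain ϖ)) a ha) =
      essentialSpectrum (toeplitz (bergmanSpace (periodicDomain ϖ)) a ha) := by
    ext c
    rw [mem_spectrum_iff, essentialSpectrum, mem_ofPred_eq, toeplitz_sub_const,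
      isFredholm_compression_iff hfam (fun k g hg => IsPeriodicCell.domainTranslation_mem k hg)
        (inner_mulOperator _) (hcomm c) (hcomm' c)]
  refine ⟨?_, hess⟩
  rw [← hess]
  ext c
  simp only [mem_iUnion, exists_prop]
  rw [mem_spectrum_iff, toeplitz_sub_const, isUnit_compression_iff hF (inner_mulOperator _)
    (inner_mulOperator (memLp_sub_const ha' c)) (hcomm c) (hcomm' c)]
  push Not
  refine exists_congr fun η => and_congr_right fun _ => ?_
  rw [mem_spectrum_iff, toeplitz_sub_const]
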